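/- **Setting.** Let $\Omega\subset\mathbb R^3$ be open, $T>0$, $k\ge 0$, and let $\mathcal T_h$ be a finite conforming mesh of $\Omega$ by curved elements $K=\psi_K(K_{ref})$, where $K_{ref}$ is the unit tetrahedron or the unit cube and each $\psi_K$ is a polynomial map of degree at most $p$, injective with non-vanishing Jacobian on the closed reference element. Faces are $F=\phi_F(F_{ref})$ with polynomial $\phi_F$ of degree at most $p$; each face either lies on $\partial\Omega$ and belongs to one element, or lies inside $\Omega$ and is shared by two elements, and on the faces of $K$ the maps $\psi_K$ and $\phi_F$ agree up to an affine symmetry of $F_{ref}$. Let $n$ denote the unit outward normal of $K$ on $\partial K$, $\mathcal E_h$ the set of faces, $(\cdot,\cdot)_D$ and $\langle\cdot,\cdot\rangle_D$ the $L^2$ products on volumes and surfaces; a subscript $\mathcal T_h$ or $\partial\mathcal T_h$ means summation over $K$ or $\partial K$, and $a^t:=n\times a\times n$. Let $V_h=\{v: v|_K\circ\psi_K\in[\mathcal P_k]^3\ \forall K\}$, $W_h=\{\psi:\psi|_K\circ\psi_K\in\mathcal P_k\ \forall K\}$, $S_h=\{m: m|_F\circ\phi_F\in[\mathcal P_k]^3,\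 m\cdot n|_F=0\ \forall F\in\mathcal E_h\}$. The functions $\varepsilon,\mu$ are measurable and bounded between positive constants on $\Omega$; $\varepsilon_0,\alpha_1,\alpha_2,\alpha_3>0$; $\tau>0$ is constant on each face of each element; $j,\rho\in C([0,T];L^2(\Omega))$ and $e^{inc}\in C([0,T];L^2(\partial\Omega))$. The GLM-Maxwell system is $\varepsilon\partial_te-\operatorname{curl}h+\nabla\phi=-j$, $\mu\partial_th+\operatorname{curl}e=0$, $\alpha_1^{-2}\partial_t\phi+\alpha_2^{-2}\phi+\nabla\cdot e=\rho/\varepsilon_0$ in $\Omega\times(0,T)$, with $n\times e\times n=-n\times e^{inc}\times n$ and $\phi=0$ on $\partial\Omega\times(0,T)$. The semi-discrete HDG method: find $(e_h,h_h,\phi_h,\hat e_h^t)(t)\in V_h\times V_h\times W_h\times S_h$ for $t\in[0,T]$, with $e_h,h_h,\phi_h$ differentiable in time and with given initial values in $V_h\times V_h\times W_h$, such that for every $K$, every $t\in[0,T]$ and all $(v,w,\psi)\in V_h\times V_h\times W_h$ $$(\varepsilon\partial_te_h,v)_K-(h_h,\operatorname{curl}v)_K-\langle\hat h_h^t,v\times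 n\rangle_{\partial K}-(\phi_h,\nabla\cdot v)_K=-(j,v)_K,$$ $$(\mu\partial_th_h,w)_K+(e_h,\operatorname{curl}w)_K+\langle\hat e_h^t,w\times n\rangle_{\partial K}=0,$$ $$\tfrac1{\alpha_1^2}(\partial_t\phi_h,\psi)_K+\tfrac1{\alpha_2^2}(\phi_h,\psi)_K+\tfrac1{\alpha_3^2}\langle\phi_h,\psi\rangle_{\partial K}+(\nabla\cdot e_h,\psi)_K=(\rho/\varepsilon_0,\psi)_K,$$ where $\hat h_h^t=h_h^t-\tau(e_h-\hat e_h^t)\times n$, and for all $m\in S_h$ $$\langle n\times\hat h_h^t,m\rangle_{\partial\mathcal T_h\setminus\partial\Omega}+\langle\hat e_h^t+n\times e^{inc}\times n,m\rangle_{\partial\Omega}=0.$$ **Theorem.** 1. (Local problem.) For each $K$, each numerical trace $\hat e_h^t(t)\in S_h$ continuous in $t\in[0,T]$, and all discrete initial values, the three element equations on $K$ have exactly one solution $(e_h,h_h,\phi_h)$ on $[0,T]$. It satisfies, for $t\in[0,T]$, with $E_K=\frac12(\varepsilon e_h,e_h)_K+\frac12(\mu h_h,h_h)_K+\frac1{2\alpha_1^2}(\phi_h,\phi_h)_K$,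 $$E_K(t)+\int_0^t\Big(\tfrac1{\alpha_2^2}(\phi_h,\phi_h)_K+\tfrac1{\alpha_3^2}\langle\phi_h,\phi_h\rangle_{\partial K}+\langle\tau e_h\times n,e_h\times n\rangle_{\partial K}\Big)ds$$ $$=E_K(0)+\int_0^t\Big(\langle\tau\hat e_h^t\times n,e_h\times n\rangle_{\partial K}-(j,e_h)_K-\langle\hat e_h^t,h_h\times n\rangle_{\partial K}+(\rho/\varepsilon_0,\phi_h)_K\Big)ds.$$ 2. (Well-posedness.) For all discrete initial values the semi-discrete problem has exactly one solution on $[0,T]$. 3. (Energy identity.) Assume that for each boundary face $F$, either $F$ is contained in a plane, or $n\times e^{inc}(t)\times n|_F\in S_h|_F$ for all $t\in[0,T]$. Then every semi-discrete solution satisfies, for $t\in[0,T]$, with $E=\sum_KE_K$, $$E(t)+\int_0^t\Big(\tfrac1{\alpha_2^2}(\phi_h,\phi_h)_{\mathcal T_h}+\tfrac1{\alpha_3^2}\langle\phi_h,\phi_h\rangle_{\partial\mathcal T_h}+\langle\tau(e_h-\hat e_h^t)\times n,(e_h-\hat e_h^t)\times n\rangle_{\partial\mathcal T_h}\Big)ds$$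 $$=E(0)+\int_0^t\Big(-(j,e_h)_{\mathcal T_h}+(\rho/\varepsilon_0,\phi_h)_{\mathcal T_h}-\langle n\times\hat h_h^t,n\times e^{inc}\times n\rangle_{\partial\Omega}\Big)ds.$$ 4. (Stability.) If $j=0$, $\rho=0$ in $\Omega$ and $e^{inc}=0$ on $\partial\Omega$, then $E$ is non-increasing on $[0,T]$ (on every mesh as above). 5. (Consistency.) Let $(e,h,\phi)$ be a classical solution of the GLM-Maxwell system with the above boundary conditions, differentiable in time and $C^1$ in space up to the boundary, whose Lagrange multiplier vanishes on all faces of the mesh; in particular, this covers $\phi\equiv0$, that is, every such solution $(e,h)$ of the Maxwell equations with $\nabla\cdot e=\rho/\varepsilon_0$. Then $(e,h,\phi,e^t)$ satisfies all the equations of the HDG method for all $t\in(0,T)$ and all discrete test functions. -/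

import Mathlib

open scoped Matrix
open MeasureTheory Set Filter Topology

noncomputable section

namespace GLMHDG

/-! Vectors are coordinate vectors; the Euclidean inner product is `⬝ᵥ`, the cross product `⨯₃`. -/

abbrev R2 := Fin 2 → ℝ
abbrev R3 := Fin 3 → ℝ

/-- The partial derivative `∂_i v_j` at `x`. -/
def pd (v : R3 → R3) (x : R3) (i j : Fin 3) : ℝ := fderiv ℝ v x (Pi.single i 1) j

def curl (v : R3 → R3) (x : R3) : R3 :=
  ![pd v x 1 2 - pd v x 2 1, pd v x 2 0 - pd v x 0 2, pd v x 0 1 - pd v x 1 0]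

def div (v : R3 → R3) (x : R3) : ℝ := ∑ i, pd v x i i

def grad (f : R3 → ℝ) (x : R3) : R3 := fun i => fderiv ℝ f x (Pi.single i 1)

/-- The tangential part `n × a × n` of `a` (for a unit vector `n`). -/
def tang (n a : R3) : R3 := (n ⨯₃ a) ⨯₃ n

/-- `m / |m|` for the Euclidean norm. -/
def unit (m : R3) : R3 := (1 / Real.sqrt (m ⬝ᵥ m)) • m

/-! ### Reference elements -/

/-- The type of the reference element of the mesh. -/
inductive Shape
  | tet
  | hex

/-- The (closed) reference element: the unit tetrahedron or the unit cube. -/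
def Shape.body : Shape → Set R3
  | .tet => {x | (∀ i, 0 ≤ x i) ∧ x 0 + x 1 + x 2 ≤ 1}
  | .hex => Icc 0 1

/-- The (closed) reference face: the unit triangle or the unit square. -/
def Shape.face : Shape → Set R2
  | .tet => {ξ | (∀ i, 0 ≤ ξ i) ∧ ξ 0 + ξ 1 ≤ 1}
  | .hex => Icc 0 1

/-- Labels of the faces of the reference element.  Tetrahedron: `some i` is the face `x_i = 0`,
`none` is the face `x_0 + x_1 + x_2 = 1`.  Cube: `(i, false)` is `x_i = 0`, `(i, true)` is
`x_i = 1`. -/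
def Shape.Idx : Shape → Type
  | .tet => Option (Fin 3)
  | .hex => Fin 3 × Bool

instance (s : Shape) : Fintype s.Idx :=
  match s with
  | .tet => inferInstanceAs (Fintype (Option (Fin 3)))
  | .hex => inferInstanceAs (Fintype (Fin 3 × Bool))

instance (s : Shape) : DecidableEq s.Idx :=
  match s with
  | .tet => inferInstanceAs (DecidableEq (Option (Fin 3)))
  | .hex => inferInstanceAs (DecidableEq (Fin 3 × Bool))

/-- The affine parametrization of a face of the reference element by the reference face. -/
def Shape.emb : (s : Shape) → s.Idx → R2 → R3
  | .tet, some i, ξ => i.insertNth (α := fun _ => ℝ) 0 ξ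
  | .tet, none, ξ => ![1 - ξ 0 - ξ 1, ξ 0, ξ 1]
  | .hex, (i, false), ξ => i.insertNth (α := fun _ => ℝ) 0 ξ
  | .hex, (i, true), ξ => i.insertNth (α := fun _ => ℝ) 1 ξ

/-- An outward normal (not normalized) to a face of the reference element. -/
def Shape.refNormal : (s : Shape) → s.Idx → R3
  | .tet, some i => -Pi.single i 1
  | .tet, none => 1
  | .hex, (i, false) => -Pi.single i 1
  | .hex, (i, true) => Pi.single i 1

/-- `f` agrees on `D` with a polynomial of total degree at most `k`. -/
def IsPolyOn {n : ℕ} (k : ℕ) (D : Set (Fin n → ℝ)) (f : (Fin n → ℝ) → ℝ) : Prop :=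
  ∃ q : MvPolynomial (Fin n) ℝ, q.totalDegree ≤ k ∧ ∀ x ∈ D, f x = MvPolynomial.eval x q

/-- The normal vector `∂_1 γ × ∂_2 γ` of a parametrized surface; its length is the area element. -/
def paramNormal (γ : R2 → R3) (ξ : R2) : R3 :=
  fderiv ℝ γ ξ (Pi.single 0 1) ⨯₃ fderiv ℝ γ ξ (Pi.single 1 1)

def areaElem (γ : R2 → R3) (ξ : R2) : ℝ :=
  Real.sqrt (paramNormal γ ξ ⬝ᵥ paramNormal γ ξ)

/-! ### Meshes -/

/-- A conforming mesh of `Ω` by curved elements of degree `p`. The element `K` is the image of the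
reference element under `map K`, the face `F` is the image of the reference face under
`faceMap F`, and `faceOf K i` is the face of the mesh on which the `i`-th face of `K` lies. -/
structure Mesh (Ω : Set R3) (p : ℕ) where
  shape : Shape
  Elem : Type
  [fintypeElem : Fintype Elem]
  Face : Type
  [fintypeFace : Fintype Face]
  map : Elem → R3 → R3
  faceMap : Face → R2 → R3
  faceOf : Elem → shape.Idx → Face
  map_poly : ∀ K i, IsPolyOn p univ fun x => map K x i
  map_inj : ∀ K, InjOn (map K) shape.body
  map_jac : ∀ K, ∀ x ∈ shape.body, (fderiv ℝ (map K) x).det ≠ 0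
  faceMap_poly : ∀ F i, IsPolyOn p univ fun ξ => faceMap F ξ i
  /-- On their common face the parametrizations agree up to an affine symmetry of the reference
  face. -/
  compat : ∀ K i, ∃ σ : R2 ≃ᵃ[ℝ] R2, σ '' shape.face = shape.face ∧
    ∀ ξ ∈ shape.face, map K (shape.emb i ξ) = faceMap (faceOf K i) (σ ξ)
  disjoint : ∀ K K', K ≠ K' →
    Disjoint (map K '' interior shape.body) (map K' '' interior shape.body)
  subset : ∀ K, map K '' interior shape.body ⊆ Ω
  cover : (⋃ K, map K '' shape.body) = closure Ω
  /-- A face either lies on `∂Ω` and belongs to one element, or lies inside `Ω` and is shared by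
  two different elements. -/
  conform : ∀ F,
    (faceMap F '' shape.face ⊆ frontier Ω ∧ ∃! s : Elem × shape.Idx, faceOf s.1 s.2 = F) ∨
    (faceMap F '' interior shape.face ⊆ Ω ∧ ∃ s s' : Elem × shape.Idx, s.1 ≠ s'.1 ∧
      ∀ r : Elem × shape.Idx, faceOf r.1 r.2 = F ↔ r = s ∨ r = s')

attribute [instance] Mesh.fintypeElem Mesh.fintypeFace

namespace Mesh

variable {Ω : Set R3} {p : ℕ} (M : Mesh Ω p)

/-- The open element `K`. -/
def elem (K : M.Elem) : Set R3 := M.map K '' interior M.shape.body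

/-- The parametrization of the `i`-th face of `K` by the reference face. -/
def bmap (K : M.Elem) (i : M.shape.Idx) (ξ : R2) : R3 := M.map K (M.shape.emb i ξ)

/-- The face lies on `∂Ω`. -/
def IsBdry (F : M.Face) : Prop := M.faceMap F '' M.shape.face ⊆ frontier Ω

/-- The face is contained in a plane. -/
def IsPlanar (F : M.Face) : Prop :=
  ∃ (c : R3) (d : ℝ), c ≠ 0 ∧ ∀ ξ ∈ M.shape.face, c ⬝ᵥ M.faceMap F ξ = d

/-- The Jacobian matrix of `map K`. -/
def jac (K : M.Elem) (x : R3) : Matrix (Fin 3) (Fin 3) ℝ :=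
  LinearMap.toMatrix' (fderiv ℝ (M.map K) x : R3 →ₗ[ℝ] R3)

/-- The unit outward normal of `K` at the point of its `i`-th face with parameter `ξ`: normals are
transported by the inverse transpose of the Jacobian matrix. -/
def normal (K : M.Elem) (i : M.shape.Idx) (ξ : R2) : R3 :=
  unit (((M.jac K (M.shape.emb i ξ))⁻¹)ᵀ *ᵥ M.shape.refNormal i)

/-- The surface integral over the `i`-th face of `K` of a function given in the parameter `ξ`. -/
def faceInt (K : M.Elem) (i : M.shape.Idx) (f : R2 → ℝ) : ℝ :=
  ∫ ξ in M.shape.face, f ξ * areaElem (M.bmap K i) ξ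

/-- The surface integral over `∂K`. -/
def bdInt (K : M.Elem) (f : M.shape.Idx → R2 → ℝ) : ℝ := ∑ i, M.faceInt K i (f i)

/-! ### Finite element spaces

A function on the mesh is a family of functions, one for each element; its values on the closed
element contain the trace on the boundary of the element. A function on the skeleton is a family of
functions, one for each face. -/

/-- `W_h^k` on the element `K`. -/
def InW (k : ℕ) (K : M.Elem) (f : R3 → ℝ) : Prop :=
  IsPolyOn k M.shape.body fun x => f (M.map K x)

/-- `V_h^k` on the element `K` (with three components). -/
def InV (k : ℕ) (K : M.Elem) (v : R3 → R3) : Prop := ∀ i, M.InW k K fun x => v x i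

/-- `S_h^k`: polynomial vector fields on the faces with vanishing normal component. -/
def InS (k : ℕ) (m : M.Face → R3 → R3) : Prop :=
  ∀ F, (∀ i, IsPolyOn k M.shape.face fun ξ => m F (M.faceMap F ξ) i) ∧
    ∀ ξ ∈ M.shape.face, m F (M.faceMap F ξ) ⬝ᵥ paramNormal (M.faceMap F) ξ = 0

end Mesh

/-- The coefficients of the problem on `Ω` and of the method on the mesh: permittivity,
permeability, the constants, and the stabilization parameter `τ`, constant on each face of each
element. -/
structure Coeff {Ω : Set R3} {p : ℕ} (M : Mesh Ω p) where
  ε : R3 → ℝ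
  μ : R3 → ℝ
  ε₀ : ℝ
  α₁ : ℝ
  α₂ : ℝ
  α₃ : ℝ
  τ : M.Elem → M.shape.Idx → ℝ
  ε_meas : Measurable ε
  μ_meas : Measurable μ
  ε_bdd : ∃ c C : ℝ, 0 < c ∧ ∀ x ∈ Ω, c ≤ ε x ∧ ε x ≤ C
  μ_bdd : ∃ c C : ℝ, 0 < c ∧ ∀ x ∈ Ω, c ≤ μ x ∧ μ x ≤ C
  ε₀_pos : 0 < ε₀
  α₁_pos : 0 < α₁
  α₂_pos : 0 < α₂
  α₃_pos : 0 < α₃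
  τ_pos : ∀ K i, 0 < τ K i

variable {Ω : Set R3} {p : ℕ} {M : Mesh Ω p} (C : Coeff M)

/-! ### The method -/

/-- The numerical trace `ĥ^t = h^t - τ (e - ê^t) × n` on the `i`-th face of `K`. -/
def hHat (K : M.Elem) (e h : R3 → R3) (eh : M.Face → R3 → R3) (i : M.shape.Idx) (ξ : R2) : R3 :=
  tang (M.normal K i ξ) (h (M.bmap K i ξ)) -
    C.τ K i • ((e (M.bmap K i ξ) - eh (M.faceOf K i) (M.bmap K i ξ)) ⨯₃ M.normal K i ξ)

/-- The three equations of the local problem on `K` at one instant. Here `e h φ` are the fields on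
`K`, `et ht φt` their time derivatives, `eh` the numerical trace `ê^t`, and `j ρ` the sources. -/
def LocalEqs (k : ℕ) (K : M.Elem) (e h : R3 → R3) (φ : R3 → ℝ) (et ht : R3 → R3) (φt : R3 → ℝ)
    (eh : M.Face → R3 → R3) (j : R3 → R3) (ρ : R3 → ℝ) : Prop :=
  (∀ v, M.InV k K v →
    (∫ x in M.elem K, C.ε x * (et x ⬝ᵥ v x)) - (∫ x in M.elem K, h x ⬝ᵥ curl v x)
      - M.bdInt K (fun i ξ => hHat C K e h eh i ξ ⬝ᵥ (v (M.bmap K i ξ) ⨯₃ M.normal K i ξ))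
      - (∫ x in M.elem K, φ x * div v x)
    = - ∫ x in M.elem K, j x ⬝ᵥ v x) ∧
  (∀ w, M.InV k K w →
    (∫ x in M.elem K, C.μ x * (ht x ⬝ᵥ w x)) + (∫ x in M.elem K, e x ⬝ᵥ curl w x)
      + M.bdInt K (fun i ξ => eh (M.faceOf K i) (M.bmap K i ξ) ⬝ᵥ
          (w (M.bmap K i ξ) ⨯₃ M.normal K i ξ))
    = 0) ∧
  (∀ ψ, M.InW k K ψ →
    1 / C.α₁ ^ 2 * (∫ x in M.elem K, φt x * ψ x) + 1 / C.α₂ ^ 2 * (∫ x in M.elem K, φ x * ψ x)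
      + 1 / C.α₃ ^ 2 * M.bdInt K (fun i ξ => φ (M.bmap K i ξ) * ψ (M.bmap K i ξ))
      + (∫ x in M.elem K, div e x * ψ x)
    = ∫ x in M.elem K, ρ x / C.ε₀ * ψ x)

open Classical in
/-- The conservativity condition and the boundary condition:
`⟨n × ĥ^t, m⟩_{∂T_h \ ∂Ω} + ⟨ê^t + n × e^inc × n, m⟩_{∂Ω} = 0` for all `m` in `S_h^k`. -/
def TraceEq (k : ℕ) (e h : M.Elem → R3 → R3) (eh : M.Face → R3 → R3) (einc : R3 → R3) : Prop :=
  ∀ m, M.InS k m →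
    (∑ K, ∑ i, if M.IsBdry (M.faceOf K i) then 0 else
        M.faceInt K i fun ξ => (M.normal K i ξ ⨯₃ hHat C K (e K) (h K) eh i ξ) ⬝ᵥ
          m (M.faceOf K i) (M.bmap K i ξ))
    + (∑ K, ∑ i, if M.IsBdry (M.faceOf K i) then
        M.faceInt K i fun ξ => (eh (M.faceOf K i) (M.bmap K i ξ) +
          tang (M.normal K i ξ) (einc (M.bmap K i ξ))) ⬝ᵥ m (M.faceOf K i) (M.bmap K i ξ)
        else 0)
    = 0

/-- All the equations of the method at one instant. -/
def Scheme (k : ℕ) (e h : M.Elem → R3 → R3) (φ : M.Elem → R3 → ℝ) (et ht : M.Elem → R3 → R3)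
    (φt : M.Elem → R3 → ℝ) (eh : M.Face → R3 → R3) (j : R3 → R3) (ρ : R3 → ℝ)
    (einc : R3 → R3) : Prop :=
  (∀ K, LocalEqs C k K (e K) (h K) (φ K) (et K) (ht K) (φt K) eh j ρ) ∧ TraceEq C k e h eh einc

/-- Time derivative on `[0, T]`, one-sided at the end points. -/
def dt {α E : Type*} [NormedAddCommGroup E] [NormedSpace ℝ E] (T : ℝ) (f : ℝ → α → E) (t : ℝ)
    (x : α) : E :=
  derivWithin (fun s => f s x) (Icc 0 T) t

/-- `(e, h, φ)` solves the local problem on `K` on the time interval `[0, T]`, for the given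
numerical trace `eh`, with initial values `(e0, h0, φ0)`. -/
structure IsLocalSol (k : ℕ) (T : ℝ) (K : M.Elem) (eh : ℝ → M.Face → R3 → R3) (j : ℝ → R3 → R3)
    (ρ : ℝ → R3 → ℝ) (e0 h0 : R3 → R3) (φ0 : R3 → ℝ)
    (e h : ℝ → R3 → R3) (φ : ℝ → R3 → ℝ) : Prop where
  mem_e : ∀ t ∈ Icc 0 T, M.InV k K (e t)
  mem_h : ∀ t ∈ Icc 0 T, M.InV k K (h t)
  mem_φ : ∀ t ∈ Icc 0 T, M.InW k K (φ t)
  diff_e : ∀ x ∈ M.map K '' M.shape.body, DifferentiableOn ℝ (fun t => e t x) (Icc 0 T)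
  diff_h : ∀ x ∈ M.map K '' M.shape.body, DifferentiableOn ℝ (fun t => h t x) (Icc 0 T)
  diff_φ : ∀ x ∈ M.map K '' M.shape.body, DifferentiableOn ℝ (fun t => φ t x) (Icc 0 T)
  init_e : EqOn (e 0) e0 (M.map K '' M.shape.body)
  init_h : EqOn (h 0) h0 (M.map K '' M.shape.body)
  init_φ : EqOn (φ 0) φ0 (M.map K '' M.shape.body)
  eqs : ∀ t ∈ Icc 0 T,
    LocalEqs C k K (e t) (h t) (φ t) (dt T e t) (dt T h t) (dt T φ t) (eh t) (j t) (ρ t)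

/-- `(e, h, φ, eh)` is a solution of the semi-discrete method on the time interval `[0, T]` with
initial values `(e0, h0, φ0)`. -/
structure IsSol (k : ℕ) (T : ℝ) (j : ℝ → R3 → R3) (ρ : ℝ → R3 → ℝ) (einc : ℝ → R3 → R3)
    (e0 h0 : M.Elem → R3 → R3) (φ0 : M.Elem → R3 → ℝ)
    (e h : ℝ → M.Elem → R3 → R3) (φ : ℝ → M.Elem → R3 → ℝ) (eh : ℝ → M.Face → R3 → R3) :
    Prop where
  mem_e : ∀ t ∈ Icc 0 T, ∀ K, M.InV k K (e t K)
  mem_h : ∀ t ∈ Icc 0 T, ∀ K, M.InV k K (h t K)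
  mem_φ : ∀ t ∈ Icc 0 T, ∀ K, M.InW k K (φ t K)
  mem_eh : ∀ t ∈ Icc 0 T, M.InS k (eh t)
  diff_e : ∀ K, ∀ x ∈ M.map K '' M.shape.body, DifferentiableOn ℝ (fun t => e t K x) (Icc 0 T)
  diff_h : ∀ K, ∀ x ∈ M.map K '' M.shape.body, DifferentiableOn ℝ (fun t => h t K x) (Icc 0 T)
  diff_φ : ∀ K, ∀ x ∈ M.map K '' M.shape.body, DifferentiableOn ℝ (fun t => φ t K x) (Icc 0 T)
  init_e : ∀ K, EqOn (e 0 K) (e0 K) (M.map K '' M.shape.body)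
  init_h : ∀ K, EqOn (h 0 K) (h0 K) (M.map K '' M.shape.body)
  init_φ : ∀ K, EqOn (φ 0 K) (φ0 K) (M.map K '' M.shape.body)
  eqs : ∀ t ∈ Icc 0 T,
    Scheme C k (e t) (h t) (φ t) (fun K => dt T (fun s => e s K) t) (fun K => dt T (fun s => h s K) t)
      (fun K => dt T (fun s => φ s K) t) (eh t) (j t) (ρ t) (einc t)

/-! ### Energies -/

/-- The energy in `K`: `½ (ε e, e)_K + ½ (μ h, h)_K + 1/(2 α₁²) (φ, φ)_K`. -/
def localEnergy (K : M.Elem) (e h : R3 → R3) (φ : R3 → ℝ) : ℝ :=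
  1 / 2 * (∫ x in M.elem K, C.ε x * (e x ⬝ᵥ e x)) + 1 / 2 * (∫ x in M.elem K, C.μ x * (h x ⬝ᵥ h x))
    + 1 / (2 * C.α₁ ^ 2) * ∫ x in M.elem K, φ x * φ x

def energy (e h : M.Elem → R3 → R3) (φ : M.Elem → R3 → ℝ) : ℝ :=
  ∑ K, localEnergy C K (e K) (h K) (φ K)

/-- `1/α₂² (φ, φ)_K + 1/α₃² ⟨φ, φ⟩_{∂K}`. -/
def phiDissip (K : M.Elem) (φ : R3 → ℝ) : ℝ :=
  1 / C.α₂ ^ 2 * (∫ x in M.elem K, φ x * φ x)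
    + 1 / C.α₃ ^ 2 * M.bdInt K (fun i ξ => φ (M.bmap K i ξ) * φ (M.bmap K i ξ))

/-- `⟨τ a × n, b × n⟩_{∂K}` for functions on `∂K` given in the parameters of the faces. -/
def tauForm (K : M.Elem) (a b : M.shape.Idx → R2 → R3) : ℝ :=
  M.bdInt K fun i ξ => C.τ K i * ((a i ξ ⨯₃ M.normal K i ξ) ⬝ᵥ (b i ξ ⨯₃ M.normal K i ξ))

/-- The dissipation in the local energy identity:
`1/α₂² (φ, φ)_K + 1/α₃² ⟨φ, φ⟩_{∂K} + ⟨τ e × n, e × n⟩_{∂K}`. -/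
def localDissip (K : M.Elem) (e : R3 → R3) (φ : R3 → ℝ) : ℝ :=
  phiDissip C K φ + tauForm C K (fun i ξ => e (M.bmap K i ξ)) (fun i ξ => e (M.bmap K i ξ))

/-- The right-hand side of the local energy identity:
`⟨τ ê × n, e × n⟩_{∂K} - (j, e)_K - ⟨ê, h × n⟩_{∂K} + (ρ/ε₀, φ)_K`. -/
def localSource (K : M.Elem) (e h : R3 → R3) (φ : R3 → ℝ) (eh : M.Face → R3 → R3)
    (j : R3 → R3) (ρ : R3 → ℝ) : ℝ :=
  tauForm C K (fun i ξ => eh (M.faceOf K i) (M.bmap K i ξ)) (fun i ξ => e (M.bmap K i ξ))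
    - (∫ x in M.elem K, j x ⬝ᵥ e x)
    - M.bdInt K (fun i ξ => eh (M.faceOf K i) (M.bmap K i ξ) ⬝ᵥ
        (h (M.bmap K i ξ) ⨯₃ M.normal K i ξ))
    + ∫ x in M.elem K, ρ x / C.ε₀ * φ x

/-- The dissipation in the global energy identity: `1/α₂² (φ, φ) + 1/α₃² ⟨φ, φ⟩ +
⟨τ (e - ê) × n, (e - ê) × n⟩`, over the mesh and its element boundaries. -/
def dissip (e : M.Elem → R3 → R3) (φ : M.Elem → R3 → ℝ) (eh : M.Face → R3 → R3) : ℝ :=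
  ∑ K, (phiDissip C K (φ K) +
    tauForm C K (fun i ξ => e K (M.bmap K i ξ) - eh (M.faceOf K i) (M.bmap K i ξ))
      (fun i ξ => e K (M.bmap K i ξ) - eh (M.faceOf K i) (M.bmap K i ξ)))

open Classical in
/-- The right-hand side of the global energy identity:
`- (j, e) + (ρ/ε₀, φ) - ⟨n × ĥ^t, n × e^inc × n⟩_{∂Ω}`. -/
def source (e h : M.Elem → R3 → R3) (φ : M.Elem → R3 → ℝ) (eh : M.Face → R3 → R3)
    (j : R3 → R3) (ρ : R3 → ℝ) (einc : R3 → R3) : ℝ :=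
  (∑ K, (- (∫ x in M.elem K, j x ⬝ᵥ e K x) + ∫ x in M.elem K, ρ x / C.ε₀ * φ K x))
    - ∑ K, ∑ i, if M.IsBdry (M.faceOf K i) then
        M.faceInt K i fun ξ => (M.normal K i ξ ⨯₃ hHat C K (e K) (h K) eh i ξ) ⬝ᵥ
          tang (M.normal K i ξ) (einc (M.bmap K i ξ))
        else 0

/-! ### Data and exact solutions -/

/-- `f ∈ C([0, T]; L²(μ))`. -/
def ContInL2 {α E : Type*} [MeasurableSpace α] [NormedAddCommGroup E] (μ : Measure α) (T : ℝ)
    (f : ℝ → α → E) : Prop :=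
  (∀ t ∈ Icc 0 T, MemLp (f t) 2 μ) ∧
    ∀ t ∈ Icc 0 T, Tendsto (fun s => eLpNorm (f s - f t) 2 μ) (𝓝[Icc 0 T] t) (𝓝 0)

/-- The incident field is continuous in time with values in `L²(∂Ω)`. The area elements are bounded
above and below, so that this can be said in the parameters of the boundary faces. -/
def ContInL2Bdry (M : Mesh Ω p) (T : ℝ) (einc : ℝ → R3 → R3) : Prop :=
  ∀ K i, M.IsBdry (M.faceOf K i) →
    ContInL2 (volume.restrict M.shape.face) T (fun t ξ => einc t (M.bmap K i ξ))

/-- `f` is continuously differentiable up to the boundary of `Ω`. -/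
def C1Closure {E : Type*} [NormedAddCommGroup E] [NormedSpace ℝ E] (Ω : Set R3) (f : R3 → E) :
    Prop :=
  ∃ U, IsOpen U ∧ closure Ω ⊆ U ∧ ContDiffOn ℝ 1 f U

/-- `(e, h, φ)` is a classical solution of the GLM-Maxwell system
`ε ∂_t e - curl h + ∇φ = -j`, `μ ∂_t h + curl e = 0`, `D(φ) + div e = ρ/ε₀` in `Ω × (0, T)` with
`D(φ) = 1/α₁² ∂_t φ + 1/α₂² φ`, and with the boundary conditions `n × e × n = - n × e^inc × n` and
`φ = 0` on `∂Ω × (0, T)`. -/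
structure IsExact (T : ℝ) (j : ℝ → R3 → R3) (ρ : ℝ → R3 → ℝ) (einc : ℝ → R3 → R3)
    (e h : ℝ → R3 → R3) (φ : ℝ → R3 → ℝ) : Prop where
  smooth_e : ∀ t ∈ Ioo 0 T, C1Closure Ω (e t)
  smooth_h : ∀ t ∈ Ioo 0 T, C1Closure Ω (h t)
  smooth_φ : ∀ t ∈ Ioo 0 T, C1Closure Ω (φ t)
  diff_e : ∀ t ∈ Ioo 0 T, ∀ x ∈ Ω, DifferentiableAt ℝ (fun s => e s x) t
  diff_h : ∀ t ∈ Ioo 0 T, ∀ x ∈ Ω, DifferentiableAt ℝ (fun s => h s x) t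
  diff_φ : ∀ t ∈ Ioo 0 T, ∀ x ∈ Ω, DifferentiableAt ℝ (fun s => φ s x) t
  ampere : ∀ t ∈ Ioo 0 T, ∀ x ∈ Ω,
    C.ε x • deriv (fun s => e s x) t - curl (h t) x + grad (φ t) x = - j t x
  faraday : ∀ t ∈ Ioo 0 T, ∀ x ∈ Ω,
    C.μ x • deriv (fun s => h s x) t + curl (e t) x = 0
  gauss : ∀ t ∈ Ioo 0 T, ∀ x ∈ Ω,
    1 / C.α₁ ^ 2 * deriv (fun s => φ s x) t + 1 / C.α₂ ^ 2 * φ t x + div (e t) x = ρ t x / C.ε₀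
  bc_e : ∀ t ∈ Ioo 0 T, ∀ K i, M.IsBdry (M.faceOf K i) → ∀ ξ ∈ interior M.shape.face,
    tang (M.normal K i ξ) (e t (M.bmap K i ξ)) = - tang (M.normal K i ξ) (einc t (M.bmap K i ξ))
  bc_φ : ∀ t ∈ Ioo 0 T, ∀ x ∈ frontier Ω, φ t x = 0

end GLMHDG

end

noncomputable section

namespace GLMHDG

/-! ### Linear differential-algebraic systems in finite dimensions -/

section ODE

variable {E : Type*} [NormedAddCommGroup E] [NormedSpace ℝ E]

/-! Once polynomial bases are fixed, the method is a linear differential-algebraic system `A(u', ·)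
+ R((u, s), ·) = f`, `D((u, s), ·) = l`. Here `u` collects the coefficients of `(e, h, φ)` on the
elements and `s` those of the numerical trace. The mass form `A` is symmetric and positive definite:
`ε`, `μ`, `α₁` are positive, and a polynomial vanishing on an open set is zero. The trace form is
definite in `s`: with `e = h = 0` an interior face contributes `n × (τ ê × n) = τ ê`, because `ê` is
tangential, and a boundary face contributes `ê` itself. So `D((0, s), s)` is a sum of `L²` norms of
`ê` with positive weights. The algebraic equation can be solved for `s`, and `u' = L u + b` remains,
with `b` continuous because the data are continuous in time with values in `L²`. Existence is
Duhamel's formula, uniqueness is Grönwall's inequality (`exists_dae_reduction`, `massC_pos`,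
`traceC_pos`). In the local problem the trace is part of the data and there is no algebraic
equation.

The energy identities come from testing with `(e, h, φ)`. The two terms with `(φ, div e)` cancel,
and the curl terms differ by a boundary integral. In the local identity this boundary integral is
rewritten pointwise. In the global one the square of `(e - ê) × n` is completed, and `⟨n × ĥ, ê⟩` is
left on each `∂K` (`LocalEqs.trace_energy`). Testing the trace equation with `ê` removes the
interior faces. On a boundary face `ê + n × e^inc × n` has to be orthogonal to `n × ĥ`. If the face
is planar, `n` is constant, so `n × ĥ` is itself an admissible polynomial test function. If the
incident trace is discrete, `ê + n × e^inc × n` may be tested with itself and vanishes. Zero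
incident field is of the second kind, so stability holds on curved meshes too.

Consistency is integration by parts on each element. With `ê = e^t` the stabilization drops out of
`ĥ`, and the vanishing of `φ` on the faces removes the boundary terms with `φ`. Over interior faces
`n × h` cancels, since the two outward normals are opposite.

The geometric work is the divergence theorem on a curved element. It combines Fubini on the
reference element, the Piola transformation (the second derivatives of `map K` cancel by symmetry)
and the transport of normals by the inverse transpose of the Jacobian matrix
(`Mesh.integral_div_elem`). Normals are opposite because the points just behind a face belong to the
element: equal normals would make two different elements overlap (`Mesh.normal_eq_neg`). -/

theorem linear_ode_unique {T : ℝ} (L : E →L[ℝ] E) {b u v : ℝ → E}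
    (hu : ∀ t ∈ Icc 0 T, HasDerivWithinAt u (L (u t) + b t) (Icc 0 T) t)
    (hv : ∀ t ∈ Icc 0 T, HasDerivWithinAt v (L (v t) + b t) (Icc 0 T) t) (h0 : u 0 = v 0) :
    EqOn u v (Icc 0 T) := by
  -- For `t < T` the interval `[0, T]` is a right neighbourhood of `t`, so the derivative along `[0,
  -- T]` gives the right derivative used in Grönwall's argument.
  have hd : ∀ w : ℝ → E, (∀ t ∈ Icc 0 T, HasDerivWithinAt w (L (w t) + b t) (Icc 0 T) t) →
      ∀ t ∈ Ico 0 T, HasDerivWithinAt w (L (w t) + b t) (Ici t) t := fun w hw t ht =>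
    (hw t (Ico_subset_Icc_self ht)).mono_of_mem_nhdsWithin
      (mem_of_superset (Icc_mem_nhdsGE ht.2) (Icc_subset_Icc_left ht.1))
  refine ODE_solution_unique (v := fun t x => L x + b t) (K := ‖L‖₊) (fun t => ?_)
    (fun t ht => (hu t ht).continuousWithinAt) (hd u hu)
    (fun t ht => (hv t ht).continuousWithinAt) (hd v hv) h0
  simpa using L.lipschitz.add (LipschitzWith.const (b t))

variable [FiniteDimensional ℝ E]

/-- Duhamel's formula `u(t) = exp(tL) (u₀ + ∫₀ᵗ exp(-sL) b(s) ds)`. The function `b` is first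
extended to the line by its end values, so that the integrand is continuous everywhere and the end
points need no separate treatment. -/
theorem exists_linear_ode_solution {T : ℝ} (hT : 0 < T) (L : E →L[ℝ] E) {b : ℝ → E}
    (hb : ContinuousOn b (Icc 0 T)) (u₀ : E) :
    ∃ u : ℝ → E, u 0 = u₀ ∧ ∀ t ∈ Icc 0 T, HasDerivWithinAt u (L (u t) + b t) (Icc 0 T) t := by
  have : CompleteSpace E := FiniteDimensional.complete ℝ E
  set b' : ℝ → E := fun t => b (projIcc 0 T hT.le t) with hb'
  have hbc : Continuous b' := by
    have : Continuous ((Icc (0 : ℝ) T).domRestrict b) := hb.domRestrict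
    exact this.comp continuous_projIcc
  have hbe : ∀ t ∈ Icc 0 T, b' t = b t := fun t ht => by
    simp [hb', projIcc_of_mem hT.le ht]
  have hexp : ∀ M : E →L[ℝ] E, Continuous fun t : ℝ => NormedSpace.exp (t • M) := fun M =>
    (differentiable_exp_smul_const ℝ M).continuous
  set g : ℝ → E := fun s => NormedSpace.exp (s • (-L)) (b' s) with hg
  have hgc : Continuous g := (hexp (-L)).clm_apply hbc
  refine ⟨fun t => NormedSpace.exp (t • L) (u₀ + ∫ s in (0)..t, g s), by simp, fun t ht => ?_⟩
  have h1 := hasDerivAt_exp_smul_const' (𝕂 := ℝ) L t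
  have h2 : HasDerivAt (fun t => u₀ + ∫ s in (0)..t, g s) (g t) t :=
    (intervalIntegral.integral_hasDerivAt_right (hgc.intervalIntegrable _ _)
      (hgc.stronglyMeasurableAtFilter _ _) hgc.continuousAt).const_add u₀
  have h3 := h1.clm_apply h2
  let _ : NormedAlgebra ℚ (E →L[ℝ] E) := NormedAlgebra.restrictScalars ℚ ℝ _
  have h4 : NormedSpace.exp (t • L) (g t) = b t := by
    have : NormedSpace.exp (t • L) * NormedSpace.exp (t • (-L)) = 1 := by
      rw [← NormedSpace.exp_add_of_commute, smul_neg, add_neg_cancel, NormedSpace.exp_zero]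
      rw [smul_neg]
      exact (Commute.refl _).neg_right
    calc _ = (NormedSpace.exp (t • L) * NormedSpace.exp (t • (-L))) (b' t) := rfl
      _ = _ := by rw [this, hbe t ht]; rfl
  rw [h4] at h3
  exact h3.hasDerivWithinAt

/-- A positive definite bilinear form on a finite-dimensional space represents every functional. -/
theorem exists_riesz_of_posDef {F : E → E → ℝ} (hF : IsBilinearMap ℝ F)
    (hpos : ∀ u, u ≠ 0 → 0 < F u u) :
    ∃ G : (E →L[ℝ] ℝ) →L[ℝ] E, ∀ u f, (∀ v, F u v = f v) ↔ u = G f := by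
  let Φ : E →ₗ[ℝ] (E →L[ℝ] ℝ) :=
    (LinearMap.toContinuousLinearMap : (E →ₗ[ℝ] ℝ) ≃ₗ[ℝ] (E →L[ℝ] ℝ)).toLinearMap ∘ₗ hF.toLinearMap
  have hΦ : ∀ u v, Φ u v = F u v := fun u v => rfl
  have hinj : Function.Injective Φ := by
    rw [injective_iff_map_eq_zero]
    intro u hu
    by_contra h
    have := hpos u h
    rw [← hΦ, hu] at this
    simp at this
  have hfr : Module.finrank ℝ E = Module.finrank ℝ (E →L[ℝ] ℝ) := by
    rw [← (LinearMap.toContinuousLinearMap : (E →ₗ[ℝ] ℝ) ≃ₗ[ℝ] (E →L[ℝ] ℝ)).finrank_eq]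
    exact (Subspace.dual_finrank_eq (K := ℝ) (V := E)).symm
  let e := LinearEquiv.ofInjectiveOfFinrankEq Φ hinj hfr
  refine ⟨e.symm.toLinearMap.toContinuousLinearMap, fun u f => ?_⟩
  have he : ∀ u, e u = Φ u := fun u => rfl
  constructor
  · intro h
    have : e u = f := by ext v; rw [he, hΦ, h]
    simp [← this]
  · rintro rfl v
    have : e (e.symm f) = f := e.apply_symm_apply f
    rw [he] at this
    simpa [hΦ] using congrArg (fun g => g v) this

theorem exists_clm_of_isBilinearMap {E' : Type*} [NormedAddCommGroup E'] [NormedSpace ℝ E']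
    [FiniteDimensional ℝ E'] {F : E → E' → ℝ} (hF : IsBilinearMap ℝ F) :
    ∃ B : E →L[ℝ] E' →L[ℝ] ℝ, ∀ u v, B u v = F u v :=
  ⟨((LinearMap.toContinuousLinearMap :
      (E' →ₗ[ℝ] ℝ) ≃ₗ[ℝ] (E' →L[ℝ] ℝ)).toLinearMap ∘ₗ hF.toLinearMap).toContinuousLinearMap,
    fun _ _ => rfl⟩

/-- In finite dimensions, continuity in time of `f t v` for each fixed `v` is continuity in the
operator norm. The data of the method are known to be continuous only when tested. -/
theorem exists_clm_of_isLinearMap {I : Set ℝ} {f : ℝ → E → ℝ} (hl : ∀ t ∈ I, IsLinearMap ℝ (f t))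
    (hc : ∀ v, ContinuousOn (fun t => f t v) I) :
    ∃ g : ℝ → E →L[ℝ] ℝ, ContinuousOn g I ∧ ∀ t ∈ I, ∀ v, g t v = f t v := by
  classical
  let g : ℝ → E →L[ℝ] ℝ := fun t =>
    if h : t ∈ I then ((hl t h).mk' (f t)).toContinuousLinearMap else 0
  have hg : ∀ t ∈ I, ∀ v, g t v = f t v := fun t ht v => by simp [g, ht]
  refine ⟨g, ?_, hg⟩
  rw [continuousOn_clm_apply]
  exact fun v => (hc v).congr fun t ht => hg t ht v

end ODE

/-! ### Elimination of the algebraic variable -/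

section DAE

variable {U S : Type*} [NormedAddCommGroup U] [NormedSpace ℝ U] [FiniteDimensional ℝ U]
  [NormedAddCommGroup S] [NormedSpace ℝ S] [FiniteDimensional ℝ S]

/-- `(u, s)` with velocity `u'` solves `A(u', ·) + R((u, s), ·) = f`, `D((u, s), ·) = l`
on `[0, T]`. -/
structure IsDAESol (A : U → U → ℝ) (R : U × S → U → ℝ) (D : U × S → S → ℝ) (T : ℝ)
    (f : ℝ → U → ℝ) (l : ℝ → S → ℝ) (u : ℝ → U) (u' : ℝ → U) (s : ℝ → S) : Prop where
  deriv : ∀ t ∈ Icc 0 T, HasDerivWithinAt u (u' t) (Icc 0 T) t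
  diff : ∀ t ∈ Icc 0 T, ∀ v, A (u' t) v + R (u t, s t) v = f t v
  alg : ∀ t ∈ Icc 0 T, ∀ m, D (u t, s t) m = l t m

variable {A : U → U → ℝ} {R : U × S → U → ℝ} {D : U × S → S → ℝ} {T : ℝ}
  {f : ℝ → U → ℝ} {l : ℝ → S → ℝ}

/-- If `A` and the restriction of `D` to the algebraic variable are positive definite, the system is
equivalent to an ordinary differential equation. -/
theorem exists_dae_reduction (hA : IsBilinearMap ℝ A) (hApos : ∀ u, u ≠ 0 → 0 < A u u)
    (hR : IsBilinearMap ℝ R) (hD : IsBilinearMap ℝ D) (hDpos : ∀ s, s ≠ 0 → 0 < D (0, s) s)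
    (hf : ∀ t ∈ Icc 0 T, IsLinearMap ℝ (f t)) (hfc : ∀ v, ContinuousOn (fun t => f t v) (Icc 0 T))
    (hl : ∀ t ∈ Icc 0 T, IsLinearMap ℝ (l t)) (hlc : ∀ v, ContinuousOn (fun t => l t v) (Icc 0 T)) :
    ∃ (L : U →L[ℝ] U) (b : ℝ → U) (N : U →L[ℝ] S) (c : ℝ → S), ContinuousOn b (Icc 0 T) ∧
      ContinuousOn c (Icc 0 T) ∧ ∀ u u' s, IsDAESol A R D T f l u u' s ↔
        ∀ t ∈ Icc 0 T, HasDerivWithinAt u (u' t) (Icc 0 T) t ∧ u' t = L (u t) + b t ∧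
          s t = N (u t) + c t := by
  obtain ⟨G, hG⟩ := exists_riesz_of_posDef hA hApos
  have hD' : IsBilinearMap ℝ fun s m => D ((0 : U), s) m :=
    ⟨fun x y z => by rw [← hD.add_left]; simp, fun c x z => by rw [← hD.smul_left]; simp,
      fun x y z => hD.add_right _ _ _, fun c x z => hD.smul_right _ _ _⟩
  obtain ⟨H, hH⟩ := exists_riesz_of_posDef hD' hDpos
  obtain ⟨Rc, hRc⟩ := exists_clm_of_isBilinearMap hR
  obtain ⟨Dc, hDc⟩ := exists_clm_of_isBilinearMap hD
  obtain ⟨fc, hfc', hfe⟩ := exists_clm_of_isLinearMap hf hfc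
  obtain ⟨lc, hlc', hle⟩ := exists_clm_of_isLinearMap hl hlc
  -- The algebraic equation reads `D((0, s), ·) = l - D((u, 0), ·)`, and inverting the definite form
  -- by `H` gives `s = N u + c`. Inserting this into the differential equation and inverting `A` by
  -- `G` gives `u' = L u + b`.
  let N : U →L[ℝ] S := -(H ∘L Dc ∘L ContinuousLinearMap.inl ℝ U S)
  let c : ℝ → S := fun t => H (lc t)
  have hc : ContinuousOn c (Icc 0 T) := H.continuous.comp_continuousOn hlc'
  let L : U →L[ℝ] U := -(G ∘L Rc ∘L (ContinuousLinearMap.id ℝ U).prod N)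
  let b : ℝ → U := fun t => G (fc t - Rc (0, c t))
  have hb : ContinuousOn b (Icc 0 T) :=
    G.continuous.comp_continuousOn
      (hfc'.sub (Rc.continuous.comp_continuousOn (continuousOn_const.prodMk hc)))
  refine ⟨L, b, N, c, hb, hc, fun u u' s => ?_⟩
  have halg : ∀ t ∈ Icc 0 T, (∀ m, D (u t, s t) m = l t m) ↔ s t = N (u t) + c t := fun t ht => by
    have h1 : (∀ m, D (u t, s t) m = l t m) ↔ ∀ m, D (0, s t) m = (lc t - Dc (u t, 0)) m := by
      refine forall_congr' fun m => ?_
      have : D (u t, s t) m = D (u t, 0) m + D (0, s t) m := by rw [← hD.add_left]; simp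
      rw [this, _root_.sub_apply, hle t ht, hDc]
      constructor <;> intro h <;> linarith
    rw [h1, hH, map_sub]
    simp only [N, c, _root_.neg_apply, ContinuousLinearMap.comp_apply,
      ContinuousLinearMap.inl_apply]
    rw [sub_eq_neg_add]
  have hdiff : ∀ t ∈ Icc 0 T, s t = N (u t) + c t →
      ((∀ v, A (u' t) v + R (u t, s t) v = f t v) ↔ u' t = L (u t) + b t) := fun t ht hs => by
    have h1 : (∀ v, A (u' t) v + R (u t, s t) v = f t v) ↔
        ∀ v, A (u' t) v = (fc t - Rc (u t, s t)) v := by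
      refine forall_congr' fun m => ?_
      rw [_root_.sub_apply, hfe t ht, hRc]
      constructor <;> intro h <;> linarith
    have h2 : (u t, s t) = (u t, N (u t)) + ((0 : U), c t) := by simp [hs]
    rw [h1, hG, h2, map_add, ← sub_sub, sub_right_comm, map_sub]
    simp only [L, b, _root_.neg_apply, ContinuousLinearMap.comp_apply,
      ContinuousLinearMap.prod_apply, ContinuousLinearMap.id_apply]
    rw [sub_eq_neg_add]
  constructor
  · intro h t ht
    have h1 := (halg t ht).1 (h.alg t ht)
    exact ⟨h.deriv t ht, (hdiff t ht h1).1 (h.diff t ht), h1⟩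
  · intro h
    exact ⟨fun t ht => (h t ht).1, fun t ht => (hdiff t ht (h t ht).2.2).2 (h t ht).2.1,
      fun t ht => (halg t ht).2 (h t ht).2.2⟩

theorem exists_daeSol (hT : 0 < T) (hA : IsBilinearMap ℝ A) (hApos : ∀ u, u ≠ 0 → 0 < A u u)
    (hR : IsBilinearMap ℝ R) (hD : IsBilinearMap ℝ D) (hDpos : ∀ s, s ≠ 0 → 0 < D (0, s) s)
    (hf : ∀ t ∈ Icc 0 T, IsLinearMap ℝ (f t)) (hfc : ∀ v, ContinuousOn (fun t => f t v) (Icc 0 T))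
    (hl : ∀ t ∈ Icc 0 T, IsLinearMap ℝ (l t)) (hlc : ∀ v, ContinuousOn (fun t => l t v) (Icc 0 T))
    (u₀ : U) : ∃ u u' s, IsDAESol A R D T f l u u' s ∧ u 0 = u₀ := by
  obtain ⟨L, b, N, c, hb, hc, h⟩ := exists_dae_reduction hA hApos hR hD hDpos hf hfc hl hlc
  obtain ⟨u, h0, hu⟩ := exists_linear_ode_solution hT L hb u₀
  exact ⟨u, fun t => L (u t) + b t, fun t => N (u t) + c t,
    (h _ _ _).2 fun t ht => ⟨hu t ht, rfl, rfl⟩, h0⟩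

theorem IsDAESol.unique (hA : IsBilinearMap ℝ A) (hApos : ∀ u, u ≠ 0 → 0 < A u u)
    (hR : IsBilinearMap ℝ R) (hD : IsBilinearMap ℝ D) (hDpos : ∀ s, s ≠ 0 → 0 < D (0, s) s)
    (hf : ∀ t ∈ Icc 0 T, IsLinearMap ℝ (f t)) (hfc : ∀ v, ContinuousOn (fun t => f t v) (Icc 0 T))
    (hl : ∀ t ∈ Icc 0 T, IsLinearMap ℝ (l t)) (hlc : ∀ v, ContinuousOn (fun t => l t v) (Icc 0 T))
    {u u' s v v' r} (h₁ : IsDAESol A R D T f l u u' s) (h₂ : IsDAESol A R D T f l v v' r)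
    (h0 : u 0 = v 0) : ∀ t ∈ Icc 0 T, u t = v t ∧ s t = r t := by
  obtain ⟨L, b, N, c, hb, hc, h⟩ := exists_dae_reduction hA hApos hR hD hDpos hf hfc hl hlc
  have e₁ := (h _ _ _).1 h₁
  have e₂ := (h _ _ _).1 h₂
  have := linear_ode_unique L (fun t ht => (e₁ t ht).2.1 ▸ (e₁ t ht).1)
    (fun t ht => (e₂ t ht).2.1 ▸ (e₂ t ht).1) h0
  exact fun t ht => ⟨this ht, by rw [(e₁ t ht).2.2, (e₂ t ht).2.2, this ht]⟩

/-- A solution is only assumed differentiable, with no regularity of `u'` or `s`. Both are affine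
functions of `u` with continuous coefficients, and this continuity makes the rates in the energy
identities integrable. -/
theorem IsDAESol.continuousOn (hA : IsBilinearMap ℝ A) (hApos : ∀ u, u ≠ 0 → 0 < A u u)
    (hR : IsBilinearMap ℝ R) (hD : IsBilinearMap ℝ D) (hDpos : ∀ s, s ≠ 0 → 0 < D (0, s) s)
    (hf : ∀ t ∈ Icc 0 T, IsLinearMap ℝ (f t)) (hfc : ∀ v, ContinuousOn (fun t => f t v) (Icc 0 T))
    (hl : ∀ t ∈ Icc 0 T, IsLinearMap ℝ (l t)) (hlc : ∀ v, ContinuousOn (fun t => l t v) (Icc 0 T))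
    {u u' s} (h₁ : IsDAESol A R D T f l u u' s) :
    ContinuousOn u (Icc 0 T) ∧ ContinuousOn u' (Icc 0 T) ∧ ContinuousOn s (Icc 0 T) := by
  obtain ⟨L, b, N, c, hb, hc, h⟩ := exists_dae_reduction hA hApos hR hD hDpos hf hfc hl hlc
  have e := (h _ _ _).1 h₁
  have hu : ContinuousOn u (Icc 0 T) := fun t ht => (e t ht).1.continuousWithinAt
  exact ⟨hu, ((L.continuous.comp_continuousOn hu).add hb).congr fun t ht => (e t ht).2.1,
    ((N.continuous.comp_continuousOn hu).add hc).congr fun t ht => (e t ht).2.2⟩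

end DAE

/-! ### The reference elements -/

theorem fin_three_cases (i : Fin 3) : i = 0 ∨ i = 1 ∨ i = 2 := by
  fin_cases i <;> simp

theorem insertNth_zero_eq (r : ℝ) (ξ : R2) :
    ((0 : Fin 3).insertNth (α := fun _ => ℝ) r ξ : R3) = ![r, ξ 0, ξ 1] := by
  ext j; fin_cases j <;> rfl

theorem insertNth_one_eq (r : ℝ) (ξ : R2) :
    ((1 : Fin 3).insertNth (α := fun _ => ℝ) r ξ : R3) = ![ξ 0, r, ξ 1] := by
  ext j; fin_cases j <;> rfl

theorem insertNth_two_eq (r : ℝ) (ξ : R2) :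
    ((2 : Fin 3).insertNth (α := fun _ => ℝ) r ξ : R3) = ![ξ 0, ξ 1, r] := by
  ext j; fin_cases j <;> rfl

namespace Shape

/-- Over the point `ξ` of a coordinate face the reference element has the height `top ξ`. -/
def top : Shape → R2 → ℝ
  | .tet, ξ => 1 - ξ 0 - ξ 1
  | .hex, _ => 1

theorem continuous_top (s : Shape) : Continuous s.top := by
  cases s
  · exact (by fun_prop : Continuous fun ξ : R2 => 1 - ξ 0 - ξ 1)
  · exact continuous_const

theorem top_nonneg (s : Shape) {ξ : R2} (hξ : ξ ∈ s.face) : 0 ≤ s.top ξ := by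
  cases s
  · have := hξ.2; simp only [top]; linarith
  · exact zero_le_one

/-- Both bodies are the region between a coordinate face and the graph of `top` over it, with the
same formula for all three coordinates. This is the form that Fubini's theorem needs. -/
theorem insertNth_mem_body (s : Shape) (i : Fin 3) (r : ℝ) (ξ : R2) :
    (i.insertNth (α := fun _ => ℝ) r ξ : R3) ∈ s.body ↔ ξ ∈ s.face ∧ r ∈ Icc 0 (s.top ξ) := by
  cases s <;> obtain rfl | rfl | rfl := fin_three_cases i <;>
    simp only [insertNth_zero_eq, insertNth_one_eq, insertNth_two_eq] <;>
    simp [body, face, top, Fin.forall_fin_succ, Pi.le_def] <;>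
    constructor <;> intro h <;> refine ⟨?_, ?_⟩ <;> grind

/-- The offset of the half space that bounds the reference element at a face. -/
def offset : (s : Shape) → s.Idx → ℝ
  | .tet, some _ => 0
  | .tet, none => 1
  | .hex, (_, false) => 0
  | .hex, (_, true) => 1

/-- The description by half spaces treats both shapes at once: closedness and convexity follow from
it, and strict inequalities give interior points. -/
theorem mem_body_iff (s : Shape) (x : R3) :
    x ∈ s.body ↔ ∀ i, s.refNormal i ⬝ᵥ x ≤ s.offset i := by
  cases s
  · change _ ↔ ∀ i : Option (Fin 3), _
    simp [body, Option.forall, Fin.forall_fin_succ, refNormal, offset, dotProduct, Fin.sum_univ_three]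
    tauto
  · change _ ↔ ∀ i : Fin 3 × Bool, _
    simp [body, Fin.forall_fin_succ, refNormal, offset, dotProduct, Fin.sum_univ_three, Pi.le_def]
    tauto

theorem isClosed_body (s : Shape) : IsClosed s.body := by
  have : s.body = ⋂ i, {x | s.refNormal i ⬝ᵥ x ≤ s.offset i} := by
    ext x; simp [mem_body_iff]
  rw [this]
  exact isClosed_iInter fun i =>
    isClosed_le (continuous_const.dotProduct continuous_id) continuous_const

theorem convex_body (s : Shape) : Convex ℝ s.body := by
  have : s.body = ⋂ i, {x | s.refNormal i ⬝ᵥ x ≤ s.offset i} := by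
    ext x; simp [mem_body_iff]
  rw [this]
  refine convex_iInter fun i => convex_halfSpace_le ?_ _
  exact ⟨fun x y => dotProduct_add _ _ _, fun c x => by simp⟩

theorem isCompact_body (s : Shape) : IsCompact s.body := by
  refine isCompact_Icc.of_isClosed_subset s.isClosed_body (s := Icc (0 : R3) 1) ?_
  cases s
  · rintro x ⟨h0, h1⟩
    have a := h0 0; have b := h0 1; have c := h0 2
    refine ⟨fun i => h0 i, fun i => ?_⟩
    fin_cases i <;> simp <;> linarith
  · exact subset_rfl

theorem mem_interior_body_of_lt (s : Shape) {x : R3} (hx : ∀ i, s.refNormal i ⬝ᵥ x < s.offset i) :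
    x ∈ interior s.body := by
  refine mem_interior.2 ⟨⋂ i, {x | s.refNormal i ⬝ᵥ x < s.offset i}, ?_, ?_, by simpa using hx⟩
  · intro y hy
    rw [mem_body_iff]
    exact fun i => (mem_iInter.1 hy i).le
  · exact isOpen_iInter_of_finite fun i =>
      isOpen_lt (continuous_const.dotProduct continuous_id) continuous_const

theorem interior_body_nonempty (s : Shape) : (interior s.body).Nonempty := by
  refine ⟨fun _ => 1 / 4, s.mem_interior_body_of_lt fun i => ?_⟩
  cases s
  · rcases i with _ | i <;>
      simp [refNormal, offset, dotProduct, Pi.single_apply]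
    · norm_num [Fin.sum_univ_three]
  · rcases i with ⟨i, _ | _⟩ <;> fin_cases i <;>
      simp [refNormal, offset, dotProduct, Pi.single_apply] <;> norm_num

theorem isClosed_face (s : Shape) : IsClosed s.face := by
  cases s
  · have : face .tet = {ξ : R2 | 0 ≤ ξ 0} ∩ {ξ | 0 ≤ ξ 1} ∩ {ξ | ξ 0 + ξ 1 ≤ 1} := by
      ext ξ; simp [face, Fin.forall_fin_two]
    rw [this]
    exact ((isClosed_le (by fun_prop) (by fun_prop)).inter
      (isClosed_le (by fun_prop) (by fun_prop))).inter (isClosed_le (by fun_prop) (by fun_prop))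
  · exact isClosed_Icc

theorem convex_face (s : Shape) : Convex ℝ s.face := by
  cases s
  · rintro x ⟨hx, hx'⟩ y ⟨hy, hy'⟩ a b ha hb hab
    refine ⟨fun i => ?_, ?_⟩
    · have := mul_nonneg ha (hx i); have := mul_nonneg hb (hy i)
      simp only [Pi.add_apply, Pi.smul_apply, smul_eq_mul]; linarith
    · simp only [Pi.add_apply, Pi.smul_apply, smul_eq_mul]
      nlinarith
  · exact convex_Icc _ _

theorem isCompact_face (s : Shape) : IsCompact s.face := by
  refine isCompact_Icc.of_isClosed_subset s.isClosed_face (s := Icc (0 : R2) 1) ?_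
  cases s
  · rintro x ⟨h0, h1⟩
    have a := h0 0; have b := h0 1
    refine ⟨fun i => h0 i, fun i => ?_⟩
    fin_cases i <;> simp <;> linarith
  · exact subset_rfl

theorem interior_face_nonempty (s : Shape) : (interior s.face).Nonempty := by
  have : IsOpen ({ξ : R2 | 0 < ξ 0} ∩ ({ξ | 0 < ξ 1} ∩ {ξ | ξ 0 + ξ 1 < 1})) :=
    (isOpen_lt (by fun_prop) (by fun_prop)).inter
      ((isOpen_lt (by fun_prop) (by fun_prop)).inter (isOpen_lt (by fun_prop) (by fun_prop)))
  refine ⟨fun _ => 1 / 4, mem_interior.2 ⟨_, ?_, this, by norm_num⟩⟩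
  rintro ξ ⟨h0, h1, h2⟩
  cases s
  · exact ⟨by simpa [Fin.forall_fin_two] using ⟨h0.le, h1.le⟩, h2.le⟩
  · simp only [face, mem_Icc, Pi.le_def, Fin.forall_fin_two, Pi.zero_apply, Pi.one_apply]
    simp only [mem_ofPred_eq] at h0 h1 h2
    refine ⟨⟨h0.le, h1.le⟩, ?_, ?_⟩ <;> linarith

theorem subset_closure_interior_face (s : Shape) : s.face ⊆ closure (interior s.face) :=
  (s.convex_face.closure_interior_eq_closure_of_nonempty_interior s.interior_face_nonempty).symm ▸
    subset_closure

theorem measurableSet_face (s : Shape) : MeasurableSet s.face := s.isClosed_face.measurableSet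

theorem measurableSet_body (s : Shape) : MeasurableSet s.body := s.isClosed_body.measurableSet

theorem interior_face_ae_eq (s : Shape) : interior s.face =ᵐ[volume] s.face :=
  interior_ae_eq_of_null_frontier (s.convex_face.addHaar_frontier volume)

theorem interior_body_ae_eq (s : Shape) : interior s.body =ᵐ[volume] s.body :=
  interior_ae_eq_of_null_frontier (s.convex_body.addHaar_frontier volume)

theorem setIntegral_body_eq (s : Shape) (i : Fin 3) {f : R3 → ℝ} (hf : IntegrableOn f s.body) :
    ∫ x in s.body, f x
      = ∫ ξ in s.face, ∫ r in (0)..(s.top ξ), f (i.insertNth (α := fun _ => ℝ) r ξ) := by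
  have hmp := (volume_preserving_piFinSuccAbove (fun _ : Fin 3 => ℝ) i).symm
  set e := (MeasurableEquiv.piFinSuccAbove (fun _ : Fin 3 => ℝ) i).symm with he
  have hee : ∀ r ξ, e (r, ξ) = i.insertNth (α := fun _ => ℝ) r ξ := fun r ξ => rfl
  have hI : Integrable (s.body.indicator f) := hf.integrable_indicator s.measurableSet_body
  have hI' : Integrable (fun q => s.body.indicator f (e q)) (volume.prod volume) :=
    (hmp.integrable_comp_emb e.measurableEmbedding).2 hI
  rw [← integral_indicator s.measurableSet_body, ← hmp.integral_comp e.measurableEmbedding,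
    Measure.volume_eq_prod, integral_prod_symm _ hI', ← integral_indicator s.measurableSet_face]
  refine integral_congr_ae (Eventually.of_forall fun ξ => ?_)
  by_cases hξ : ξ ∈ s.face
  · have htop : 0 ≤ s.top ξ := by
      cases s
      · have := hξ.2; simp only [top]; linarith
      · exact zero_le_one
    simp only [indicator_of_mem hξ]
    rw [intervalIntegral.integral_of_le htop, ← integral_Icc_eq_integral_Ioc,
      ← integral_indicator measurableSet_Icc]
    refine integral_congr_ae (Eventually.of_forall fun r => ?_)
    simp only [hee, indicator, insertNth_mem_body, hξ, true_and]
  · simp only [indicator_of_notMem hξ]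
    refine integral_eq_zero_of_ae (Eventually.of_forall fun r => ?_)
    simp [hee, indicator, insertNth_mem_body, hξ]

/-- Fubini's theorem reduces the integral to segments in the `i`-th coordinate direction, on which
the fundamental theorem of calculus applies. -/
theorem setIntegral_fderiv_body (s : Shape) (i : Fin 3) {g : R3 → ℝ} {V : Set R3} (hV : IsOpen V)
    (hb : s.body ⊆ V) (hg : ContDiffOn ℝ 1 g V) :
    ∫ x in s.body, fderiv ℝ g x (Pi.single i 1)
      = ∫ ξ in s.face, (g (i.insertNth (α := fun _ => ℝ) (s.top ξ) ξ)
          - g (i.insertNth (α := fun _ => ℝ) 0 ξ)) := by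
  have hc : ContinuousOn (fun x => fderiv ℝ g x (Pi.single i 1)) V :=
    (hg.continuousOn_fderiv_of_isOpen hV le_rfl).clm_apply continuousOn_const
  rw [s.setIntegral_body_eq i ((hc.mono hb).integrableOn_compact s.isCompact_body)]
  refine setIntegral_congr_fun s.measurableSet_face fun ξ hξ => ?_
  have htop := s.top_nonneg hξ
  have hmem : ∀ r ∈ uIcc 0 (s.top ξ), (i.insertNth (α := fun _ => ℝ) r ξ : R3) ∈ V := fun r hr =>
    hb ((s.insertNth_mem_body i r ξ).2 ⟨hξ, by rwa [uIcc_of_le htop] at hr⟩)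
  have hd : ∀ r, HasDerivAt (fun r : ℝ => (i.insertNth (α := fun _ => ℝ) r ξ : R3))
      (Pi.single i 1) r := fun r => by
    rw [hasDerivAt_pi]
    intro j
    rcases eq_or_ne j i with rfl | hj
    · simpa using hasDerivAt_id' r
    · obtain ⟨l, rfl⟩ := Fin.exists_succAbove_eq hj
      simpa [Pi.single_apply, hj] using hasDerivAt_const r (ξ l)
  have hcont : Continuous fun r : ℝ => (i.insertNth (α := fun _ => ℝ) r ξ : R3) :=
    continuous_iff_continuousAt.2 fun r => (hd r).continuousAt
  refine intervalIntegral.integral_eq_sub_of_hasDerivAt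
    (f := fun r => g (i.insertNth (α := fun _ => ℝ) r ξ)) (fun r hr => ?_) ?_
  · have h1 : HasFDerivAt g (fderiv ℝ g (i.insertNth (α := fun _ => ℝ) r ξ))
        (i.insertNth (α := fun _ => ℝ) r ξ) :=
      ((hg.differentiableOn one_ne_zero).differentiableAt (hV.mem_nhds (hmem r hr))).hasFDerivAt
    exact h1.comp_hasDerivAt r (hd r)
  · exact (hc.comp hcont.continuousOn hmem).intervalIntegrable

end Shape

/-! ### Symmetries of the reference face -/

/-- Change of variables by a map of the plane that preserves a set and has constant Jacobian
determinant `±1`. -/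
theorem setIntegral_comp_of_abs_det_eq_one {D : Set R2} (hD : MeasurableSet D) {φ : R2 → R2}
    {A : R2 →L[ℝ] R2} (hφ : ∀ ξ, HasFDerivAt φ A ξ) (hA : |A.det| = 1) (hinj : InjOn φ D)
    (him : φ '' D = D) (f : R2 → ℝ) : ∫ ξ in D, f (φ ξ) = ∫ ξ in D, f ξ := by
  conv_rhs => rw [← him]
  rw [integral_image_eq_integral_abs_det_fderiv_smul volume hD
    (fun ξ _ => (hφ ξ).hasFDerivWithinAt) hinj]
  simp [hA]

theorem AffineEquiv.hasFDerivAt_plane (σ : R2 ≃ᵃ[ℝ] R2) (ξ : R2) :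
    HasFDerivAt σ (LinearMap.toContinuousLinearMap (σ.linear : R2 →ₗ[ℝ] R2)) ξ := by
  have h : (σ : R2 → R2) = fun η =>
      LinearMap.toContinuousLinearMap (σ.linear : R2 →ₗ[ℝ] R2) η + σ 0 := by
    ext1 η
    have := σ.map_vadd 0 η
    simpa using this
  rw [h]
  exact (ContinuousLinearMap.hasFDerivAt _).add_const _

/-- The area of the face is positive and finite, and the map multiplies it by `|det|` while mapping
the face onto itself. -/
theorem AffineEquiv.abs_det_eq_one {s : Shape} {σ : R2 ≃ᵃ[ℝ] R2} (hσ : σ '' s.face = s.face) :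
    |(LinearMap.toContinuousLinearMap (σ.linear : R2 →ₗ[ℝ] R2)).det| = 1 := by
  have h := lintegral_abs_det_fderiv_eq_addHaar_image volume s.measurableSet_face
    (fun ξ _ => (AffineEquiv.hasFDerivAt_plane σ ξ).hasFDerivWithinAt) σ.injective.injOn
  rw [hσ, lintegral_const, Measure.restrict_apply_univ] at h
  have hpos : volume s.face ≠ 0 :=
    ((isOpen_interior.measure_pos volume s.interior_face_nonempty).trans_le
      (measure_mono interior_subset)).ne'
  have hfin : volume s.face ≠ ⊤ := s.isCompact_face.measure_lt_top.ne
  have h1 : ENNReal.ofReal |(LinearMap.toContinuousLinearMap (σ.linear : R2 →ₗ[ℝ] R2)).det| = 1 := by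
    refine (ENNReal.mul_left_inj hpos hfin).1 ?_
    rw [h, one_mul]
  simpa using h1

theorem AffineEquiv.setIntegral_comp_face {s : Shape} {σ : R2 ≃ᵃ[ℝ] R2} (hσ : σ '' s.face = s.face)
    (f : R2 → ℝ) : ∫ ξ in s.face, f (σ ξ) = ∫ ξ in s.face, f ξ :=
  setIntegral_comp_of_abs_det_eq_one s.measurableSet_face (AffineEquiv.hasFDerivAt_plane σ)
    (AffineEquiv.abs_det_eq_one hσ) σ.injective.injOn hσ f

namespace Shape

/-- The oblique face is a graph over each of the three coordinate faces. Passing from one graph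
parametrization to another is an affine map of the triangle onto itself with determinant `±1`, so
the integrals agree without an area factor. -/
theorem setIntegral_tet_top (i : Fin 3) (g : R3 → ℝ) :
    ∫ ξ in face .tet, g (i.insertNth (α := fun _ => ℝ) (top .tet ξ) ξ)
      = ∫ ξ in face .tet, g (emb .tet none ξ) := by
  have key : ∀ (φ : R2 → R2) (A : Matrix (Fin 2) (Fin 2) ℝ) (b : R2), (∀ ξ, φ ξ = A *ᵥ ξ + b) →
      |A.det| = 1 → φ '' face .tet = face .tet →
      (∀ ξ, (i.insertNth (α := fun _ => ℝ) (top .tet (φ ξ)) (φ ξ) : R3) = emb .tet none ξ) →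
      ∫ ξ in face .tet, g (i.insertNth (α := fun _ => ℝ) (top .tet ξ) ξ)
        = ∫ ξ in face .tet, g (emb .tet none ξ) := by
    intro φ A b hφ hA him hξ
    have hd : ∀ ξ, HasFDerivAt φ (LinearMap.toContinuousLinearMap (Matrix.toLin' A)) ξ := fun ξ => by
      have : φ = fun ξ => LinearMap.toContinuousLinearMap (Matrix.toLin' A) ξ + b := by
        ext1 ξ; simp [hφ]
      rw [this]
      exact (ContinuousLinearMap.hasFDerivAt _).add_const _
    have hdet : |(LinearMap.toContinuousLinearMap (Matrix.toLin' A)).det| = 1 := by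
      simpa [ContinuousLinearMap.det] using hA
    have hinj : Function.Injective φ := by
      intro x y hxy
      rw [hφ, hφ] at hxy
      have hu : IsUnit A := by
        rw [Matrix.isUnit_iff_isUnit_det, isUnit_iff_ne_zero]
        intro h; simp [h] at hA
      exact Matrix.mulVec_injective_iff_isUnit.2 hu (add_right_cancel hxy)
    rw [← setIntegral_comp_of_abs_det_eq_one (Shape.measurableSet_face .tet) hd hdet hinj.injOn him]
    simp only [hξ]
  obtain rfl | rfl | rfl := fin_three_cases i
  · simp only [insertNth_zero_eq]; rfl
  · refine key (fun ξ => ![1 - ξ 0 - ξ 1, ξ 1]) !![-1, -1; 0, 1] ![1, 0] (fun ξ => ?_) ?_ ?_ ?_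
    · ext j; fin_cases j <;> simp [dotProduct]; ring
    · simp [Matrix.det_fin_two]
    · apply Subset.antisymm
      · rintro _ ⟨ξ, ⟨h0, h1⟩, rfl⟩
        have a := h0 0; have b := h0 1
        refine ⟨fun j => ?_, ?_⟩
        · fin_cases j <;> simp <;> linarith
        · simp; linarith
      · rintro ξ ⟨h0, h1⟩
        have a := h0 0; have b := h0 1
        refine ⟨![1 - ξ 0 - ξ 1, ξ 1], ⟨fun j => ?_, ?_⟩, ?_⟩
        · fin_cases j <;> simp <;> linarith
        · simp; linarith
        · ext j; fin_cases j <;> simp; ring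
    · intro ξ
      ext j; fin_cases j <;> simp [emb, top, insertNth_one_eq]; ring
  · refine key (fun ξ => ![1 - ξ 0 - ξ 1, ξ 0]) !![-1, -1; 1, 0] ![1, 0] (fun ξ => ?_) ?_ ?_ ?_
    · ext j; fin_cases j <;> simp [dotProduct]; ring
    · simp [Matrix.det_fin_two]
    · apply Subset.antisymm
      · rintro _ ⟨ξ, ⟨h0, h1⟩, rfl⟩
        have a := h0 0; have b := h0 1
        refine ⟨fun j => ?_, ?_⟩
        · fin_cases j <;> simp <;> linarith
        · simp; linarith
      · rintro ξ ⟨h0, h1⟩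
        have a := h0 0; have b := h0 1
        refine ⟨![ξ 1, 1 - ξ 0 - ξ 1], ⟨fun j => ?_, ?_⟩, ?_⟩
        · fin_cases j <;> simp <;> linarith
        · simp; linarith
        · ext j; fin_cases j <;> simp
    · intro ξ
      ext j; fin_cases j <;> simp [emb, top, insertNth_two_eq]; ring

theorem emb_mem_body (s : Shape) (i : s.Idx) {ξ : R2} (hξ : ξ ∈ s.face) : s.emb i ξ ∈ s.body := by
  have h0 : ∀ j : Fin 3, (j.insertNth (α := fun _ => ℝ) 0 ξ : R3) ∈ s.body := fun j => by
    rw [insertNth_mem_body]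
    exact ⟨hξ, le_rfl, s.top_nonneg hξ⟩
  cases s
  · rcases i with _ | j
    · have := hξ.1 0; have := hξ.1 1; have := hξ.2
      refine ⟨fun j => ?_, ?_⟩
      · fin_cases j <;> simp [emb] <;> linarith
      · simp [emb]; linarith
    · exact h0 j
  · rcases i with ⟨j, _ | _⟩
    · exact h0 j
    · exact (insertNth_mem_body .hex j 1 ξ).2 ⟨hξ, zero_le_one, le_rfl⟩

theorem contDiff_emb (s : Shape) (i : s.Idx) {n : WithTop ℕ∞} : ContDiff ℝ n (s.emb i) := by
  rw [contDiff_pi]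
  intro l
  cases s
  · rcases i with _ | j
    · fin_cases l <;> simp [emb] <;> fun_prop
    · fin_cases j <;> fin_cases l <;> simp [emb, Fin.insertNth, Fin.succAboveCases] <;> fun_prop
  · rcases i with ⟨j, _ | _⟩ <;> fin_cases j <;> fin_cases l <;>
      simp [emb, Fin.insertNth, Fin.succAboveCases] <;> fun_prop

/-- The divergence theorem on the reference element. -/
theorem setIntegral_div_body (s : Shape) {G : R3 → R3} {V : Set R3} (hV : IsOpen V)
    (hb : s.body ⊆ V) (hG : ContDiffOn ℝ 1 G V) :
    ∫ x in s.body, ∑ i, fderiv ℝ G x (Pi.single i 1) i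
      = ∑ i, ∫ ξ in s.face, s.refNormal i ⬝ᵥ G (s.emb i ξ) := by
  have hGi : ∀ i, ContDiffOn ℝ 1 (fun x => G x i) V := fun i => (contDiffOn_pi.1 hG) i
  have hfd : ∀ i, ∀ x ∈ V, fderiv ℝ G x (Pi.single i 1) i
      = fderiv ℝ (fun x => G x i) x (Pi.single i 1) := fun i x hx => by
    have := (hG.differentiableOn one_ne_zero).differentiableAt (hV.mem_nhds hx)
    rw [fderiv_apply this]; rfl
  have hc : ∀ i : Fin 3, ContinuousOn (fun x => fderiv ℝ G x (Pi.single i 1) i) s.body := fun i =>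
    (continuous_apply i).comp_continuousOn
      (((hG.continuousOn_fderiv_of_isOpen hV le_rfl).clm_apply continuousOn_const).mono hb)
  rw [integral_finsetSum _ fun i _ => (hc i).integrableOn_compact s.isCompact_body]
  have h1 : ∀ i, ∫ x in s.body, fderiv ℝ G x (Pi.single i 1) i
      = (∫ ξ in s.face, G (i.insertNth (α := fun _ => ℝ) (s.top ξ) ξ) i)
        - ∫ ξ in s.face, G (i.insertNth (α := fun _ => ℝ) 0 ξ) i := fun i => by
    rw [setIntegral_congr_fun s.measurableSet_body fun x hx => hfd i x (hb hx),
      s.setIntegral_fderiv_body i hV hb (hGi i)]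
    have hins : ∀ r : R2 → ℝ, Continuous r →
        Continuous fun ξ : R2 => (i.insertNth (α := fun _ => ℝ) (r ξ) ξ : R3) := fun r hr => by
      refine continuous_pi fun l => ?_
      rcases eq_or_ne l i with rfl | hl
      · simpa using hr
      · obtain ⟨l, rfl⟩ := Fin.exists_succAbove_eq hl
        simpa using continuous_apply l
    have hcont : ∀ r : R2 → ℝ, Continuous r → (∀ ξ ∈ s.face, r ξ ∈ Icc 0 (s.top ξ)) →
        IntegrableOn (fun ξ => G (i.insertNth (α := fun _ => ℝ) (r ξ) ξ) i) s.face :=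
      fun r hr hmem => ((hGi i).continuousOn.comp (hins r hr).continuousOn fun ξ hξ =>
        hb ((s.insertNth_mem_body i _ ξ).2 ⟨hξ, hmem ξ hξ⟩)).integrableOn_compact s.isCompact_face
    have htop : ∀ ξ ∈ s.face, 0 ≤ s.top ξ := fun ξ hξ => s.top_nonneg hξ
    exact integral_sub (hcont _ s.continuous_top fun ξ hξ => ⟨htop ξ hξ, le_rfl⟩)
      (hcont _ continuous_const fun ξ hξ => ⟨le_rfl, htop ξ hξ⟩)
  simp only [h1]
  have hcG : ∀ (i : s.Idx) (l : Fin 3), IntegrableOn (fun ξ => G (s.emb i ξ) l) s.face := fun i l =>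
    ((hGi l).continuousOn.comp (s.contDiff_emb i (n := 1)).continuous.continuousOn
      fun ξ hξ => hb (s.emb_mem_body i hξ)).integrableOn_compact s.isCompact_face
  -- For the tetrahedron the three upper boundary terms are integrals over the same oblique face.
  -- Together they give the product of `G` with its normal `(1, 1, 1)`. For the cube the faces
  -- simply pair off by direction.
  cases s
  · change _ = ∑ i : Option (Fin 3), _
    rw [Fintype.sum_option]
    simp only [refNormal, Finset.sum_sub_distrib]
    have h2 := setIntegral_tet_top
    have h3 : ∀ i, ∫ ξ in face .tet, G (i.insertNth (α := fun _ => ℝ) (top .tet ξ) ξ) i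
        = ∫ ξ in face .tet, G (emb .tet none ξ) i := fun i => h2 i fun x => G x i
    simp only [h3, one_dotProduct, neg_dotProduct, single_dotProduct, one_mul, integral_neg,
      Finset.sum_neg_distrib, sub_eq_add_neg]
    congr 1
    rw [integral_finsetSum _ fun l _ => hcG none l]
  · change _ = ∑ i : Fin 3 × Bool, _
    rw [Fintype.sum_prod_type]
    refine Finset.sum_congr rfl fun i _ => ?_
    simp [refNormal, top, emb, integral_neg, sub_eq_add_neg]

end Shape

theorem cons_apply_two (r : ℝ) (ξ : R2) : (Fin.cons r ξ : R3) 2 = ξ 1 := rfl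

/-! ### Vector identities -/

/-- The cofactor matrix acts on cross products. This gives the transport of surface normals under a
change of variables. -/
theorem mulVec_cross_mulVec (A : Matrix (Fin 3) (Fin 3) ℝ) (a b : R3) :
    (A *ᵥ a) ⨯₃ (A *ᵥ b) = A.adjugateᵀ *ᵥ (a ⨯₃ b) := by
  ext i
  fin_cases i <;>
    simp [cross_apply, Matrix.adjugate_fin_three, Matrix.mulVec, dotProduct, Fin.sum_univ_three] <;>
    ring

theorem dotProduct_self_pos {a : R3} (ha : a ≠ 0) : 0 < a ⬝ᵥ a :=
  lt_of_le_of_ne (Finset.sum_nonneg fun i _ => mul_self_nonneg (a i))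
    (Ne.symm (dotProduct_self_eq_zero.not.2 ha))

theorem sqrt_dotProduct_self_pos {a : R3} (ha : a ≠ 0) : 0 < Real.sqrt (a ⬝ᵥ a) :=
  Real.sqrt_pos.2 (dotProduct_self_pos ha)

theorem sqrt_dotProduct_self_smul (c : ℝ) (a : R3) :
    Real.sqrt ((c • a) ⬝ᵥ (c • a)) = |c| * Real.sqrt (a ⬝ᵥ a) := by
  rw [smul_dotProduct, dotProduct_smul, smul_eq_mul, smul_eq_mul, ← mul_assoc,
    Real.sqrt_mul (mul_self_nonneg c), Real.sqrt_mul_self_eq_abs]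

theorem unit_dotProduct_unit {a : R3} (ha : a ≠ 0) : unit a ⬝ᵥ unit a = 1 := by
  have := dotProduct_self_pos ha
  have h := sqrt_dotProduct_self_pos ha
  rw [unit, smul_dotProduct, dotProduct_smul, smul_eq_mul, smul_eq_mul, ← mul_assoc, div_mul_div_comm,
    Real.mul_self_sqrt this.le, mul_one, one_div, inv_mul_cancel₀ this.ne']

theorem sqrt_smul_unit (a : R3) : Real.sqrt (a ⬝ᵥ a) • unit a = a := by
  rcases eq_or_ne a 0 with rfl | ha
  · simp [unit]
  · rw [unit, smul_smul, mul_one_div_cancel (sqrt_dotProduct_self_pos ha).ne', one_smul]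

theorem tang_eq (n a : R3) : tang n a = (n ⬝ᵥ n) • a - (n ⬝ᵥ a) • n := by
  rw [tang, cross_cross_eq_smul_sub_smul]
  simp [dotProduct_comm]

/-! ### Geometry of the reference faces -/

namespace Shape

/-- The linear part of the parametrization of a face of the reference element. -/
def embMat (s : Shape) (i : s.Idx) : Matrix (Fin 3) (Fin 2) ℝ :=
  Matrix.of fun a b => s.emb i (Pi.single b 1) a - s.emb i 0 a

theorem emb_eq (s : Shape) (i : s.Idx) (ξ : R2) : s.emb i ξ = s.embMat i *ᵥ ξ + s.emb i 0 := by
  ext l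
  cases s
  · rcases i with _ | j
    · fin_cases l <;> simp [embMat, emb, Matrix.mulVec, dotProduct]; ring
    · obtain rfl | rfl | rfl := fin_three_cases j <;> fin_cases l <;>
        simp [embMat, emb, Matrix.mulVec, dotProduct, cons_apply_two, insertNth_one_eq,
          insertNth_two_eq]
  · rcases i with ⟨j, _ | _⟩ <;> obtain rfl | rfl | rfl := fin_three_cases j <;> fin_cases l <;>
      simp [embMat, emb, Matrix.mulVec, dotProduct, cons_apply_two, insertNth_one_eq,
          insertNth_two_eq]

theorem hasFDerivAt_emb (s : Shape) (i : s.Idx) (ξ : R2) :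
    HasFDerivAt (s.emb i) (LinearMap.toContinuousLinearMap (Matrix.toLin' (s.embMat i))) ξ := by
  have : s.emb i = fun ξ =>
      LinearMap.toContinuousLinearMap (Matrix.toLin' (s.embMat i)) ξ + s.emb i 0 := by
    ext1 ξ; rw [s.emb_eq i ξ]; simp
  rw [this]
  exact (ContinuousLinearMap.hasFDerivAt _).add_const _

/-- The sign relating the orientation of the parametrization of a face to the outward normal. -/
theorem exists_sign_cross_embMat (s : Shape) (i : s.Idx) : ∃ κ : ℝ, |κ| = 1 ∧
    (s.embMat i *ᵥ Pi.single 0 1) ⨯₃ (s.embMat i *ᵥ Pi.single 1 1) = κ • s.refNormal i := by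
  have hcol : ∀ b, s.embMat i *ᵥ Pi.single b 1 = fun a => s.embMat i a b := fun b => by
    ext a; simp
  rw [hcol, hcol]
  cases s
  · rcases i with _ | j
    · refine ⟨1, by simp, ?_⟩
      ext l; fin_cases l <;> simp [embMat, emb, cross_apply, refNormal]
    · obtain rfl | rfl | rfl := fin_three_cases j
      · refine ⟨-1, by simp, ?_⟩
        ext l; fin_cases l <;> simp [embMat, emb, cross_apply, refNormal, cons_apply_two]
      · refine ⟨1, by simp, ?_⟩
        ext l; fin_cases l <;> simp [embMat, emb, cross_apply, refNormal, insertNth_one_eq]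
      · refine ⟨-1, by simp, ?_⟩
        ext l; fin_cases l <;> simp [embMat, emb, cross_apply, refNormal, insertNth_two_eq]
  · rcases i with ⟨j, _ | _⟩ <;> obtain rfl | rfl | rfl := fin_three_cases j
    · refine ⟨-1, by simp, ?_⟩
      ext l; fin_cases l <;> simp [embMat, emb, cross_apply, refNormal, cons_apply_two]
    · refine ⟨1, by simp, ?_⟩
      ext l; fin_cases l <;> simp [embMat, emb, cross_apply, refNormal, insertNth_one_eq]
    · refine ⟨-1, by simp, ?_⟩
      ext l; fin_cases l <;> simp [embMat, emb, cross_apply, refNormal, insertNth_two_eq]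
    · refine ⟨1, by simp, ?_⟩
      ext l; fin_cases l <;> simp [embMat, emb, cross_apply, refNormal, cons_apply_two]
    · refine ⟨-1, by simp, ?_⟩
      ext l; fin_cases l <;> simp [embMat, emb, cross_apply, refNormal, insertNth_one_eq]
    · refine ⟨1, by simp, ?_⟩
      ext l; fin_cases l <;> simp [embMat, emb, cross_apply, refNormal, insertNth_two_eq]

theorem refNormal_ne_zero (s : Shape) (i : s.Idx) : s.refNormal i ≠ 0 := by
  cases s
  · rcases i with _ | j <;> simp [refNormal]
  · rcases i with ⟨j, _ | _⟩ <;> simp [refNormal]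

theorem refNormal_dotProduct_emb (s : Shape) (i : s.Idx) (ξ : R2) :
    s.refNormal i ⬝ᵥ s.emb i ξ = s.offset i := by
  cases s
  · rcases i with _ | j
    · simp [refNormal, emb, offset, dotProduct, Fin.sum_univ_three]; ring
    · simp [refNormal, emb, offset]
  · rcases i with ⟨j, _ | _⟩ <;> simp [refNormal, emb, offset]

/-- A nonzero linear functional is an open map, so an upper bound that it satisfies on the face is
strict in the interior. -/
theorem interior_face_subset (s : Shape) {ξ : R2} (hξ : ξ ∈ interior s.face) :
    (∀ i, 0 < ξ i) ∧ match s with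
      | .tet => ξ 0 + ξ 1 < 1
      | .hex => ∀ i, ξ i < 1 := by
  have key : ∀ (ℓ : R2 →L[ℝ] ℝ) (c : ℝ), ℓ ≠ 0 → s.face ⊆ ℓ ⁻¹' Iic c → ℓ ξ < c := by
    intro ℓ c hℓ hs
    have hopen : IsOpenMap ℓ := ℓ.isOpenMap_of_ne_zero hℓ
    have h1 := hopen.preimage_interior_eq_interior_preimage ℓ.continuous (Iic c)
    rw [interior_Iic] at h1
    have h2 := interior_mono hs hξ
    rwa [← h1] at h2
  have hp : ∀ i : Fin 2, (ContinuousLinearMap.proj i : R2 →L[ℝ] ℝ) ≠ 0 := fun i h => by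
    have := congrArg (fun g => g (Pi.single i 1)) h
    simp at this
  have hn : ∀ i : Fin 2, -(ContinuousLinearMap.proj i : R2 →L[ℝ] ℝ) ≠ 0 :=
    fun i => neg_ne_zero.2 (hp i)
  cases s
  · refine ⟨fun i => ?_, ?_⟩
    · have := key _ 0 (hn i) fun η hη => by simpa using hη.1 i
      simpa using this
    · let π : Fin 2 → R2 →L[ℝ] ℝ := ContinuousLinearMap.proj
      have h01 : π 0 + π 1 ≠ 0 := fun h => by
        have : (Pi.single 0 1 : R2) 0 + (Pi.single 0 1 : R2) 1 = 0 :=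
          congrArg (fun g : R2 →L[ℝ] ℝ => g (Pi.single 0 1)) h
        simp at this
      have := key _ 1 h01 fun η hη => hη.2
      exact this
  · refine ⟨fun i => ?_, fun i => ?_⟩
    · have := key _ 0 (hn i) fun η hη => by simpa using hη.1 i
      simpa using this
    · have := key _ 1 (hp i) fun η hη => by simpa using hη.2 i
      simpa using this

/-- At relatively interior points of a face only the inequality of that face is an equality. The
others are strict and survive small displacements. -/
theorem refNormal_dotProduct_emb_lt (s : Shape) {i j : s.Idx} (hij : j ≠ i) {ξ : R2}
    (hξ : ξ ∈ interior s.face) : s.refNormal j ⬝ᵥ s.emb i ξ < s.offset j := by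
  have h := s.interior_face_subset hξ
  cases s
  · obtain ⟨h0, h1⟩ := h
    have a := h0 0; have b := h0 1
    rcases i with _ | i
    · rcases j with _ | j
      · exact absurd rfl hij
      · fin_cases j <;> simp [refNormal, emb, offset, a, b]
        simp at h1; linarith
    · rcases j with _ | j
      · obtain rfl | rfl | rfl := fin_three_cases i <;>
          simpa [refNormal, emb, offset, insertNth_zero_eq, insertNth_one_eq, insertNth_two_eq,
            dotProduct, Fin.sum_univ_three] using h1
      · have : j ≠ i := fun h => hij (by rw [h])
        obtain ⟨l, rfl⟩ := Fin.exists_succAbove_eq this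
        simpa [refNormal, emb, offset] using h0 l
  · obtain ⟨h0, h1⟩ := h
    rcases i with ⟨i, x⟩
    rcases j with ⟨j, y⟩
    rcases eq_or_ne j i with rfl | h
    · cases x <;> cases y <;> first | exact absurd rfl hij | simp [refNormal, emb, offset]
    · obtain ⟨l, rfl⟩ := Fin.exists_succAbove_eq h
      cases x <;> cases y <;> simp [refNormal, emb, offset, h0 l, h1 l]

/-- A curve that starts in the relative interior of a face and moves inward enters the reference
element. -/
theorem eventually_mem_interior_body (s : Shape) (i : s.Idx) {ξ : R2} (hξ : ξ ∈ interior s.face)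
    {x : ℝ → R3} {d : R3} (hx : HasDerivAt x d 0) (h0 : x 0 = s.emb i ξ)
    (hd : s.refNormal i ⬝ᵥ d < 0) : ∀ᶠ r in 𝓝[>] 0, x r ∈ interior s.body := by
  have hder : ∀ j, HasDerivAt (fun r => s.refNormal j ⬝ᵥ x r) (s.refNormal j ⬝ᵥ d) 0 := fun j => by
    simp only [dotProduct]
    exact HasDerivAt.fun_sum fun l _ => ((hasDerivAt_pi.1 hx) l).const_mul _
  have : ∀ j, ∀ᶠ r in 𝓝[>] (0 : ℝ), s.refNormal j ⬝ᵥ x r < s.offset j := fun j => by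
    -- The inequality of the face itself becomes strict through the negative derivative, the others
    -- stay strict by continuity.
    rcases eq_or_ne j i with rfl | hj
    · have h1 := (hasDerivAt_iff_tendsto_slope.1 (hder j)).eventually_lt_const hd
      have h2 : 𝓝[>] (0 : ℝ) ≤ 𝓝[≠] 0 := nhdsWithin_mono _ fun r hr => ne_of_gt hr
      filter_upwards [h2 h1, self_mem_nhdsWithin] with r hr hr0
      rw [slope_def_field, h0, refNormal_dotProduct_emb, sub_zero] at hr
      have hr0' : (0 : ℝ) < r := hr0
      have := (div_lt_iff₀ hr0').1 hr
      linarith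
    · have h1 : s.refNormal j ⬝ᵥ x 0 < s.offset j := h0 ▸ s.refNormal_dotProduct_emb_lt hj hξ
      exact nhdsWithin_le_nhds ((hder j).continuousAt.eventually_lt_const h1)
  filter_upwards [eventually_all.2 this] with r hr using s.mem_interior_body_of_lt hr

end Shape

/-! ### Geometry of the elements -/

theorem IsPolyOn.contDiff {n k : ℕ} {f : (Fin n → ℝ) → ℝ} (hf : IsPolyOn k univ f)
    {m : WithTop ℕ∞} : ContDiff ℝ m f := by
  obtain ⟨q, -, hq⟩ := hf
  have h : AnalyticOnNhd ℝ (fun x : Fin n → ℝ => MvPolynomial.aeval x q) univ :=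
    AnalyticOnNhd.aeval_mvPolynomial
      (fun i => (ContinuousLinearMap.proj (R := ℝ) (φ := fun _ : Fin n => ℝ) i).analyticOnNhd _) q
  have : f = fun x => MvPolynomial.aeval x q := by
    ext1 x
    rw [hq x trivial, MvPolynomial.aeval_eq_eval]
  rw [this]
  exact contDiffOn_univ.1 (h.contDiffOn (n := m) uniqueDiffOn_univ)

namespace Mesh

variable {Ω : Set R3} {p : ℕ} (M : Mesh Ω p) (K : M.Elem)

theorem contDiff_map {m : WithTop ℕ∞} : ContDiff ℝ m (M.map K) :=
  contDiff_pi.2 fun i => (M.map_poly K i).contDiff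

theorem contDiff_faceMap (F : M.Face) {m : WithTop ℕ∞} : ContDiff ℝ m (M.faceMap F) :=
  contDiff_pi.2 fun i => (M.faceMap_poly F i).contDiff

theorem differentiableAt_map (x : R3) : DifferentiableAt ℝ (M.map K) x :=
  (M.contDiff_map K (m := 1)).differentiable one_ne_zero x

theorem hasFDerivAt_map (x : R3) : HasFDerivAt (M.map K) (fderiv ℝ (M.map K) x) x :=
  (M.differentiableAt_map K x).hasFDerivAt

theorem jac_mulVec (x v : R3) : M.jac K x *ᵥ v = fderiv ℝ (M.map K) x v :=
  LinearMap.toMatrix'_mulVec _ _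

theorem det_jac (x : R3) : (M.jac K x).det = (fderiv ℝ (M.map K) x).det := by
  rw [jac, LinearMap.det_toMatrix', ContinuousLinearMap.det]

theorem det_jac_ne_zero {x : R3} (hx : x ∈ M.shape.body) : (M.jac K x).det ≠ 0 := by
  rw [det_jac]; exact M.map_jac K x hx

theorem continuous_fderiv_map : Continuous (fderiv ℝ (M.map K)) :=
  (M.contDiff_map K (m := 1)).continuous_fderiv one_ne_zero

theorem continuous_jac : Continuous (M.jac K) := by
  refine continuous_matrix fun i j => ?_
  have : ∀ x, M.jac K x i j = fderiv ℝ (M.map K) x (Pi.single j 1) i := fun x => by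
    rw [← jac_mulVec]; simp
  simp only [this]
  exact (continuous_apply i).comp ((M.continuous_fderiv_map K).clm_apply continuous_const)

theorem continuous_det_jac : Continuous fun x => (M.jac K x).det :=
  (M.continuous_jac K).matrix_det

/-- The Jacobian determinant has a constant sign on the reference element. -/
theorem exists_sign_det : ∃ c : ℝ, |c| = 1 ∧
    ∀ x ∈ M.shape.body, |(M.jac K x).det| = c * (M.jac K x).det := by
  have hpre : IsPreconnected M.shape.body := M.shape.convex_body.isPreconnected
  have hcont : ContinuousOn (fun x => (M.jac K x).det) M.shape.body :=
    (M.continuous_det_jac K).continuousOn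
  by_cases h : ∃ x ∈ M.shape.body, 0 < (M.jac K x).det
  · obtain ⟨x, hx, hpos⟩ := h
    refine ⟨1, by simp, fun y hy => ?_⟩
    rw [one_mul, abs_of_pos]
    by_contra hneg
    obtain ⟨z, hz, hz0⟩ := hpre.intermediate_value hy hx hcont ⟨not_lt.1 hneg, hpos.le⟩
    exact M.det_jac_ne_zero K hz hz0
  · push Not at h
    exact ⟨-1, by simp, fun y hy => by rw [abs_of_nonpos (h y hy)]; ring⟩

/-- The differential of `map K` as an equivalence. -/
theorem exists_equiv {x : R3} (hx : x ∈ M.shape.body) : ∃ e : R3 ≃L[ℝ] R3,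
    HasStrictFDerivAt (M.map K) (e : R3 →L[ℝ] R3) x ∧
      (e : R3 →L[ℝ] R3) = fderiv ℝ (M.map K) x ∧ ∀ v, e.symm v = (M.jac K x)⁻¹ *ᵥ v := by
  refine ⟨(fderiv ℝ (M.map K) x).toContinuousLinearEquivOfDetNeZero (M.map_jac K x hx), ?_, ?_, ?_⟩
  · rw [ContinuousLinearMap.coe_toContinuousLinearEquivOfDetNeZero]
    exact (M.contDiff_map K (m := 1)).contDiffAt.hasStrictFDerivAt one_ne_zero
  · exact ContinuousLinearMap.coe_toContinuousLinearEquivOfDetNeZero _ _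
  · intro v
    rw [ContinuousLinearEquiv.symm_apply_eq,
      ContinuousLinearMap.toContinuousLinearEquivOfDetNeZero_apply, ← jac_mulVec, Matrix.mulVec_mulVec,
      Matrix.mul_nonsing_inv _ (IsUnit.mk0 _ (M.det_jac_ne_zero K hx)), Matrix.one_mulVec]

/-- By the inverse function theorem `map K` sends neighbourhoods of interior reference points to
neighbourhoods. Openness lets discrete functions be differentiated inside the element. -/
theorem isOpen_elem : IsOpen (M.elem K) := by
  rw [isOpen_iff_mem_nhds]
  rintro _ ⟨x, hx, rfl⟩
  obtain ⟨e, he, -⟩ := M.exists_equiv K (interior_subset hx)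
  rw [← he.map_nhds_eq_of_equiv]
  exact image_mem_map (isOpen_interior.mem_nhds hx)

theorem measurableSet_elem : MeasurableSet (M.elem K) := (M.isOpen_elem K).measurableSet

theorem elem_subset_image : M.elem K ⊆ M.map K '' M.shape.body := image_mono interior_subset

theorem image_subset_closure : M.map K '' M.shape.body ⊆ closure Ω :=
  M.cover ▸ subset_iUnion (fun K => M.map K '' M.shape.body) K

/-- Change of variables on the open reference element. Its boundary is a null set by convexity, so
the integral may be taken over the closed one. -/
theorem setIntegral_elem (f : R3 → ℝ) :
    ∫ x in M.elem K, f x = ∫ x in M.shape.body, |(M.jac K x).det| * f (M.map K x) := by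
  rw [elem, integral_image_eq_integral_abs_det_fderiv_smul volume isOpen_interior.measurableSet
    (fun x _ => (M.hasFDerivAt_map K x).hasFDerivWithinAt)
    ((M.map_inj K).mono interior_subset), setIntegral_congr_set M.shape.interior_body_ae_eq]
  simp [det_jac]

theorem integrableOn_elem_iff (f : R3 → ℝ) : IntegrableOn f (M.elem K) ↔
    IntegrableOn (fun x => |(M.jac K x).det| * f (M.map K x)) M.shape.body := by
  rw [elem, integrableOn_image_iff_integrableOn_abs_det_fderiv_smul volume
    isOpen_interior.measurableSet (fun x _ => (M.hasFDerivAt_map K x).hasFDerivWithinAt)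
    ((M.map_inj K).mono interior_subset), integrableOn_congr_set_ae M.shape.interior_body_ae_eq]
  simp [det_jac]

theorem volume_elem_lt_top : volume (M.elem K) < ⊤ :=
  (measure_mono (M.elem_subset_image K)).trans_lt
    (M.shape.isCompact_body.image (M.contDiff_map K (m := 1)).continuous).measure_lt_top

/-! #### Normals -/

/-- The transported normal, not normalized. -/
theorem conormal_ne_zero {x : R3} (hx : x ∈ M.shape.body) (i : M.shape.Idx) :
    ((M.jac K x)⁻¹)ᵀ *ᵥ M.shape.refNormal i ≠ 0 := by
  intro h
  have h1 : (M.jac K x)ᵀ *ᵥ (((M.jac K x)⁻¹)ᵀ *ᵥ M.shape.refNormal i) = M.shape.refNormal i := by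
    rw [Matrix.mulVec_mulVec, ← Matrix.transpose_mul,
      Matrix.nonsing_inv_mul _ (IsUnit.mk0 _ (M.det_jac_ne_zero K hx)), Matrix.transpose_one,
      Matrix.one_mulVec]
  rw [h, Matrix.mulVec_zero] at h1
  exact M.shape.refNormal_ne_zero i h1.symm

theorem normal_dotProduct_self {i : M.shape.Idx} {ξ : R2} (hξ : ξ ∈ M.shape.face) :
    M.normal K i ξ ⬝ᵥ M.normal K i ξ = 1 :=
  unit_dotProduct_unit (M.conormal_ne_zero K (M.shape.emb_mem_body i hξ) i)

theorem contDiff_bmap (i : M.shape.Idx) {m : WithTop ℕ∞} : ContDiff ℝ m (M.bmap K i) :=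
  (M.contDiff_map K).comp (M.shape.contDiff_emb i)

theorem adjugate_eq {x : R3} (hx : x ∈ M.shape.body) :
    (M.jac K x).adjugate = (M.jac K x).det • (M.jac K x)⁻¹ := by
  rw [Matrix.inv_def, smul_smul, Ring.mul_inverse_cancel _ (IsUnit.mk0 _ (M.det_jac_ne_zero K hx)),
    one_smul]

theorem paramNormal_bmap_eq (i : M.shape.Idx) (ξ : R2) : paramNormal (M.bmap K i) ξ =
    (M.jac K (M.shape.emb i ξ)).adjugateᵀ *ᵥ
      ((M.shape.embMat i *ᵥ Pi.single 0 1) ⨯₃ (M.shape.embMat i *ᵥ Pi.single 1 1)) := by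
  have hd : HasFDerivAt (M.bmap K i) ((fderiv ℝ (M.map K) (M.shape.emb i ξ)).comp
      (LinearMap.toContinuousLinearMap (Matrix.toLin' (M.shape.embMat i)))) ξ :=
    (M.hasFDerivAt_map K _).comp ξ (M.shape.hasFDerivAt_emb i ξ)
  rw [← mulVec_cross_mulVec, jac_mulVec, jac_mulVec, paramNormal, hd.fderiv]
  simp

/-- The cross product of the tangent vectors is the cofactor image of a reference normal, that is
`det J · J⁻ᵀ n_ref` up to the orientation of the parametrization. That orientation and the sign of
`det J` are both constant, so a single sign `c` serves the whole face. The second identity is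
Nanson's formula for the oriented area element. -/
theorem exists_sign_paramNormal (i : M.shape.Idx) : ∃ c : ℝ, |c| = 1 ∧ ∀ ξ ∈ M.shape.face,
    paramNormal (M.bmap K i) ξ = (c * (areaElem (M.bmap K i) ξ)) • M.normal K i ξ ∧
    areaElem (M.bmap K i) ξ • M.normal K i ξ = |(M.jac K (M.shape.emb i ξ)).det| •
      (((M.jac K (M.shape.emb i ξ))⁻¹)ᵀ *ᵥ M.shape.refNormal i) ∧ 0 < areaElem (M.bmap K i) ξ := by
  obtain ⟨κ, hκ, hcross⟩ := M.shape.exists_sign_cross_embMat i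
  obtain ⟨c, hc, hdet⟩ := M.exists_sign_det K
  have hκκ : κ * κ = 1 := by rw [← abs_mul_abs_self, hκ, one_mul]
  have hcc : c * c = 1 := by rw [← abs_mul_abs_self, hc, one_mul]
  refine ⟨c * κ, by rw [abs_mul, hc, hκ, one_mul], fun ξ hξ => ?_⟩
  have hx := M.shape.emb_mem_body i hξ
  set ν := ((M.jac K (M.shape.emb i ξ))⁻¹)ᵀ *ᵥ M.shape.refNormal i with hν
  have hν0 : ν ≠ 0 := M.conormal_ne_zero K hx i
  set δ := (M.jac K (M.shape.emb i ξ)).det with hδ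
  have hδ0 : δ ≠ 0 := M.det_jac_ne_zero K hx
  have h1 : paramNormal (M.bmap K i) ξ = (κ * δ) • ν := by
    rw [paramNormal_bmap_eq, hcross, M.adjugate_eq K hx, Matrix.transpose_smul, Matrix.mulVec_smul,
      Matrix.smul_mulVec, smul_smul]
  have h2 : areaElem (M.bmap K i) ξ = |δ| * Real.sqrt (ν ⬝ᵥ ν) := by
    rw [areaElem, h1, sqrt_dotProduct_self_smul, abs_mul, hκ, one_mul]
  have h3 : areaElem (M.bmap K i) ξ • M.normal K i ξ = |δ| • ν := by
    rw [h2, mul_smul, normal, ← hν, sqrt_smul_unit]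
  refine ⟨?_, h3, ?_⟩
  · rw [mul_smul, h3, h1, hdet _ hx, smul_smul]
    congr 1
    linear_combination (-κ * δ) * hcc
  · rw [h2]
    exact mul_pos (abs_pos.2 hδ0) (sqrt_dotProduct_self_pos hν0)

theorem areaElem_pos {i : M.shape.Idx} {ξ : R2} (hξ : ξ ∈ M.shape.face) :
    0 < areaElem (M.bmap K i) ξ := by
  obtain ⟨c, -, h⟩ := M.exists_sign_paramNormal K i
  exact (h ξ hξ).2.2

theorem continuous_paramNormal_of_contDiff {γ : R2 → R3} (hγ : ContDiff ℝ 1 γ) :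
    Continuous (paramNormal γ) := by
  have h : ∀ b : Fin 2, Continuous fun ξ => fderiv ℝ γ ξ (Pi.single b 1) := fun b =>
    (hγ.continuous_fderiv one_ne_zero).clm_apply continuous_const
  have h' : ∀ b l, Continuous fun ξ => fderiv ℝ γ ξ (Pi.single b 1) l := fun b l =>
    (continuous_apply l).comp (h b)
  refine continuous_pi fun l => ?_
  fin_cases l <;> simp only [paramNormal, cross_apply] <;>
    exact ((h' _ _).mul (h' _ _)).sub ((h' _ _).mul (h' _ _))

theorem continuous_areaElem (i : M.shape.Idx) : Continuous (areaElem (M.bmap K i)) := by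
  have := continuous_paramNormal_of_contDiff (M.contDiff_bmap K i)
  exact Real.continuous_sqrt.comp (this.dotProduct this)

theorem continuousOn_normal (i : M.shape.Idx) : ContinuousOn (M.normal K i) M.shape.face := by
  obtain ⟨c, hc, h⟩ := M.exists_sign_paramNormal K i
  have hcc : c * c = 1 := by rw [← abs_mul_abs_self, hc, one_mul]
  have : ∀ ξ ∈ M.shape.face,
      M.normal K i ξ = (c * (areaElem (M.bmap K i) ξ)⁻¹) • paramNormal (M.bmap K i) ξ := by
    intro ξ hξ
    obtain ⟨h1, -, h3⟩ := h ξ hξ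
    rw [h1, smul_smul]
    have : c * (areaElem (M.bmap K i) ξ)⁻¹ * (c * areaElem (M.bmap K i) ξ) = 1 := by
      field_simp; linear_combination hcc
    rw [this, one_smul]
  refine ContinuousOn.congr ?_ this
  exact (continuousOn_const.mul ((M.continuous_areaElem K i).continuousOn.inv₀
    fun ξ hξ => (M.areaElem_pos K hξ).ne')).smul
    (continuous_paramNormal_of_contDiff (M.contDiff_bmap K i)).continuousOn

end Mesh

/-! ### Product rules -/

theorem hasFDerivAt_coord {n : ℕ} {E : Type*} [NormedAddCommGroup E] [NormedSpace ℝ E]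
    {a : E → Fin n → ℝ} {x : E} (ha : DifferentiableAt ℝ a x) (i : Fin n) :
    HasFDerivAt (fun y => a y i)
      ((ContinuousLinearMap.proj (R := ℝ) (φ := fun _ : Fin n => ℝ) i).comp (fderiv ℝ a x)) x :=
  (hasFDerivAt_pi'.1 ha.hasFDerivAt) i

theorem fderiv_triple {a b G : R3 → R3} {x : R3} (ha : DifferentiableAt ℝ a x)
    (hb : DifferentiableAt ℝ b x) (hG : DifferentiableAt ℝ G x) (v : R3) :
    fderiv ℝ (fun y => (a y ⨯₃ b y) ⬝ᵥ G y) x v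
      = ((fderiv ℝ a x v) ⨯₃ b x + a x ⨯₃ (fderiv ℝ b x v)) ⬝ᵥ G x
        + (a x ⨯₃ b x) ⬝ᵥ fderiv ℝ G x v := by
  have ha' := hasFDerivAt_coord ha
  have hb' := hasFDerivAt_coord hb
  have hG' := hasFDerivAt_coord hG
  have h : ∀ i j l, HasFDerivAt (fun y => (a y i * b y j - a y j * b y i) * G y l) _ x :=
    fun i j l => (((ha' i).mul (hb' j)).sub ((ha' j).mul (hb' i))).mul (hG' l)
  have := (((h 1 2 0).add (h 2 0 1)).add (h 0 1 2)).fderiv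
  have e : (fun y => (a y ⨯₃ b y) ⬝ᵥ G y) = (((fun y => (a y 1 * b y 2 - a y 2 * b y 1) * G y 0) +
      fun y => (a y 2 * b y 0 - a y 0 * b y 2) * G y 1) +
      fun y => (a y 0 * b y 1 - a y 1 * b y 0) * G y 2) := by
    ext y; simp [cross_apply, dotProduct, Fin.sum_univ_three]
  rw [e, this]
  simp [cross_apply, dotProduct, Fin.sum_univ_three]
  ring

theorem differentiableAt_cross {a b : R3 → R3} {x : R3} (ha : DifferentiableAt ℝ a x)
    (hb : DifferentiableAt ℝ b x) : DifferentiableAt ℝ (fun y => a y ⨯₃ b y) x := by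
  have ha' := differentiableAt_pi.1 ha
  have hb' := differentiableAt_pi.1 hb
  rw [differentiableAt_pi]
  intro i
  fin_cases i <;> simp only [cross_apply] <;>
    exact ((ha' _).mul (hb' _)).sub ((ha' _).mul (hb' _))

theorem div_cross {a b : R3 → R3} {x : R3} (ha : DifferentiableAt ℝ a x)
    (hb : DifferentiableAt ℝ b x) :
    div (fun y => a y ⨯₃ b y) x = curl a x ⬝ᵥ b x - a x ⬝ᵥ curl b x := by
  have h : ∀ i, pd (fun y => a y ⨯₃ b y) x i i
      = ((fderiv ℝ a x (Pi.single i 1)) ⨯₃ b x + a x ⨯₃ (fderiv ℝ b x (Pi.single i 1))) i := by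
    intro i
    have h1 := fderiv_triple ha hb (differentiableAt_const (c := (Pi.single i 1 : R3)))
      (Pi.single i 1)
    have h2 : pd (fun y => a y ⨯₃ b y) x i i
        = fderiv ℝ (fun y => (a y ⨯₃ b y) ⬝ᵥ (Pi.single i 1 : R3)) x (Pi.single i 1) := by
      simp only [dotProduct_single, mul_one]
      rw [(hasFDerivAt_coord (differentiableAt_cross ha hb) i).fderiv]
      rfl
    rw [h2, h1]
    simp
  have hs : div (fun y => a y ⨯₃ b y) x = ∑ i, _ := Finset.sum_congr rfl fun i _ => h i
  rw [hs]
  simp only [curl, Fin.sum_univ_three, dotProduct, pd, cross_apply]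
  simp
  ring

theorem div_smul {f : R3 → ℝ} {v : R3 → R3} {x : R3} (hf : DifferentiableAt ℝ f x)
    (hv : DifferentiableAt ℝ v x) :
    div (fun y => f y • v y) x = grad f x ⬝ᵥ v x + f x * div v x := by
  simp only [div, pd, grad, fderiv_fun_smul hf hv, Fin.sum_univ_three, dotProduct]
  simp
  ring

/-! ### Functions that are regular up to the boundary of an element -/

namespace Mesh

variable {Ω : Set R3} {p : ℕ} (M : Mesh Ω p) (K : M.Elem)
variable {E : Type*} [NormedAddCommGroup E] [NormedSpace ℝ E]

/-- In reference coordinates `f` is continuously differentiable up to the boundary of `K`. -/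
def C1On (f : R3 → E) : Prop :=
  ∃ V, IsOpen V ∧ M.shape.body ⊆ V ∧ ∃ G : R3 → E, ContDiffOn ℝ 1 G V ∧
    ∀ x ∈ M.shape.body, f (M.map K x) = G x

/-- In reference coordinates `f` extends continuously to the boundary of `K`. -/
def ElemCont (f : R3 → ℝ) : Prop :=
  ∃ H : R3 → ℝ, ContinuousOn H M.shape.body ∧ ∀ x ∈ interior M.shape.body, f (M.map K x) = H x

variable {M K}

theorem C1On.of_contDiffOn {f : R3 → E} {U : Set R3} (hU : IsOpen U) (hΩ : closure Ω ⊆ U)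
    (hf : ContDiffOn ℝ 1 f U) : M.C1On K f :=
  ⟨M.map K ⁻¹' U, hU.preimage (M.contDiff_map K (m := 1)).continuous,
    fun _ hx => hΩ (M.image_subset_closure K (mem_image_of_mem _ hx)), fun x => f (M.map K x),
    hf.comp (M.contDiff_map K).contDiffOn (fun _ hx => hx), fun _ _ => rfl⟩

theorem C1On.comp₂ {E₁ E₂ : Type*} [NormedAddCommGroup E₁] [NormedSpace ℝ E₁]
    [NormedAddCommGroup E₂] [NormedSpace ℝ E₂] {f : R3 → E₁} {g : R3 → E₂} (hf : M.C1On K f)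
    (hg : M.C1On K g) {op : E₁ × E₂ → E} (hop : ContDiff ℝ 1 op) :
    M.C1On K fun x => op (f x, g x) := by
  obtain ⟨V, hV, hb, G, hG, he⟩ := hf
  obtain ⟨V', hV', hb', G', hG', he'⟩ := hg
  exact ⟨V ∩ V', hV.inter hV', subset_inter hb hb', fun x => op (G x, G' x),
    hop.comp_contDiffOn ((hG.mono inter_subset_left).prodMk (hG'.mono inter_subset_right)),
    fun x hx => by simp only [he x hx, he' x hx]⟩

theorem C1On.continuousOn_comp {f : R3 → E} (hf : M.C1On K f) :
    ContinuousOn (fun x => f (M.map K x)) M.shape.body := by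
  obtain ⟨V, hV, hb, G, hG, he⟩ := hf
  exact (hG.continuousOn.mono hb).congr he

theorem C1On.continuousOn_bmap {f : R3 → E} (hf : M.C1On K f) (i : M.shape.Idx) :
    ContinuousOn (fun ξ => f (M.bmap K i ξ)) M.shape.face :=
  hf.continuousOn_comp.comp (M.shape.contDiff_emb i (n := 1)).continuous.continuousOn
    fun _ hξ => M.shape.emb_mem_body i hξ

/-- Near an interior image point `f` is `G` composed with a local inverse of `map K`, and the chain
rule applies. At the boundary no such statement is available, because `f` is unrestricted outside
the closed element. -/
theorem C1On.hasFDerivAt {f : R3 → E} {G : R3 → E} {V : Set R3} (hV : IsOpen V)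
    (hb : M.shape.body ⊆ V) (hG : ContDiffOn ℝ 1 G V)
    (he : ∀ x ∈ M.shape.body, f (M.map K x) = G x) {x : R3} (hx : x ∈ interior M.shape.body) :
    DifferentiableAt ℝ f (M.map K x) ∧
      (∀ v, fderiv ℝ f (M.map K x) (fderiv ℝ (M.map K) x v) = fderiv ℝ G x v) ∧
      ∀ v, fderiv ℝ f (M.map K x) v = fderiv ℝ G x ((M.jac K x)⁻¹ *ᵥ v) := by
  have hxb := interior_subset hx
  obtain ⟨e, hes, heq, hesymm⟩ := M.exists_equiv K hxb
  have hGx : HasFDerivAt G (fderiv ℝ G x) x :=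
    ((hG.differentiableOn one_ne_zero).differentiableAt (hV.mem_nhds (hb hxb))).hasFDerivAt
  set g := hes.localInverse (M.map K) e x with hg
  have hgx : g (M.map K x) = x := hes.localInverse_apply_image
  have hgd : HasFDerivAt g (e.symm : R3 →L[ℝ] R3) (M.map K x) := hes.to_localInverse.hasFDerivAt
  have hcomp : HasFDerivAt (G ∘ g) ((fderiv ℝ G x).comp (e.symm : R3 →L[ℝ] R3)) (M.map K x) :=
    HasFDerivAt.comp _ (by rw [hgx]; exact hGx) hgd
  have hev : f =ᶠ[𝓝 (M.map K x)] G ∘ g := by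
    have h1 : ∀ᶠ y in 𝓝 (M.map K x), g y ∈ interior M.shape.body :=
      hgd.continuousAt.eventually_mem (by rw [hgx]; exact isOpen_interior.mem_nhds hx)
    filter_upwards [h1, hes.eventually_right_inverse] with y hy hy'
    rw [Function.comp_apply, ← he _ (interior_subset hy), hy']
  have hf := hcomp.congr_of_eventuallyEq hev
  refine ⟨hf.differentiableAt, fun v => ?_, fun v => ?_⟩
  · rw [hf.fderiv, ← heq]; simp
  · rw [hf.fderiv, ← hesymm]; simp

theorem C1On.differentiableAt {f : R3 → E} (hf : M.C1On K f) {y : R3} (hy : y ∈ M.elem K) :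
    DifferentiableAt ℝ f y := by
  obtain ⟨V, hV, hb, G, hG, he⟩ := hf
  obtain ⟨x, hx, rfl⟩ := hy
  exact (C1On.hasFDerivAt hV hb hG he hx).1

theorem ElemCont.const (c : ℝ) : M.ElemCont K fun _ => c := ⟨_, continuousOn_const, fun _ _ => rfl⟩

theorem ElemCont.add {f g : R3 → ℝ} (hf : M.ElemCont K f) (hg : M.ElemCont K g) :
    M.ElemCont K fun x => f x + g x := by
  obtain ⟨H, hH, he⟩ := hf
  obtain ⟨H', hH', he'⟩ := hg
  exact ⟨_, hH.add hH', fun x hx => by simp [he x hx, he' x hx]⟩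

theorem ElemCont.mul {f g : R3 → ℝ} (hf : M.ElemCont K f) (hg : M.ElemCont K g) :
    M.ElemCont K fun x => f x * g x := by
  obtain ⟨H, hH, he⟩ := hf
  obtain ⟨H', hH', he'⟩ := hg
  exact ⟨_, hH.mul hH', fun x hx => by simp [he x hx, he' x hx]⟩

theorem ElemCont.sub {f g : R3 → ℝ} (hf : M.ElemCont K f) (hg : M.ElemCont K g) :
    M.ElemCont K fun x => f x - g x := by
  obtain ⟨H, hH, he⟩ := hf
  obtain ⟨H', hH', he'⟩ := hg
  exact ⟨_, hH.sub hH', fun x hx => by simp [he x hx, he' x hx]⟩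

theorem ElemCont.dotProduct {f g : R3 → R3} (hf : ∀ i, M.ElemCont K fun x => f x i)
    (hg : ∀ i, M.ElemCont K fun x => g x i) : M.ElemCont K fun x => f x ⬝ᵥ g x := by
  simp only [_root_.dotProduct, Fin.sum_univ_three]
  exact (((hf 0).mul (hg 0)).add ((hf 1).mul (hg 1))).add ((hf 2).mul (hg 2))

theorem C1On.elemCont {f : R3 → ℝ} (hf : M.C1On K f) : M.ElemCont K f :=
  ⟨_, hf.continuousOn_comp, fun _ _ => rfl⟩

theorem C1On.coord {f : R3 → R3} (hf : M.C1On K f) (i : Fin 3) : M.C1On K fun x => f x i :=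
  (hf.comp₂ hf (op := fun q => q.1 i) (by fun_prop) :)

theorem C1On.pi {f : R3 → R3} (hf : ∀ i, M.C1On K fun x => f x i) : M.C1On K f := by
  choose V hV hb G hG he using hf
  refine ⟨⋂ i, V i, isOpen_iInter_of_finite hV, subset_iInter hb, fun x i => G i x,
    contDiffOn_pi.2 fun i => (hG i).mono (iInter_subset _ i), fun x hx => ?_⟩
  ext i
  exact he i x hx

/-- In reference coordinates the derivative is `DG (J⁻¹ v)`, which is continuous up to the boundary
because the Jacobian determinant does not vanish on the closed reference element. This yields
integrability of curls, divergences and gradients. -/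
theorem C1On.elemCont_fderiv {f : R3 → ℝ} (hf : M.C1On K f) (v : R3) :
    M.ElemCont K fun y => fderiv ℝ f y v := by
  obtain ⟨V, hV, hb, G, hG, he⟩ := hf
  refine ⟨fun x => fderiv ℝ G x ((M.jac K x)⁻¹ *ᵥ v), ?_, fun x hx =>
    (C1On.hasFDerivAt hV hb hG he hx).2.2 v⟩
  refine ((hG.continuousOn_fderiv_of_isOpen hV le_rfl).mono hb).clm_apply ?_
  have hinv : ContinuousOn (fun x => (M.jac K x)⁻¹) M.shape.body := by
    simp only [Matrix.inv_def, Ring.inverse_eq_inv']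
    exact ((M.continuous_det_jac K).continuousOn.inv₀ fun x hx => M.det_jac_ne_zero K hx).smul
      (M.continuous_jac K).matrix_adjugate.continuousOn
  refine continuousOn_pi.2 fun i => ?_
  simp only [Matrix.mulVec, _root_.dotProduct]
  refine continuousOn_finsetSum _ fun l _ => ContinuousOn.mul ?_ continuousOn_const
  exact ((continuous_id.matrix_elem i l).comp_continuousOn hinv :)

theorem C1On.elemCont_pd {f : R3 → R3} (hf : M.C1On K f) (i j : Fin 3) :
    M.ElemCont K fun y => pd f y i j := by
  obtain ⟨H, hH, he⟩ := (hf.coord j).elemCont_fderiv (Pi.single i 1)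
  refine ⟨H, hH, fun x hx => ?_⟩
  refine Eq.trans ?_ (he x hx)
  simp only
  rw [(hasFDerivAt_coord (hf.differentiableAt (mem_image_of_mem _ hx)) j).fderiv]
  rfl

theorem C1On.elemCont_curl {f : R3 → R3} (hf : M.C1On K f) (i : Fin 3) :
    M.ElemCont K fun y => curl f y i := by
  fin_cases i
  · exact (hf.elemCont_pd 1 2).sub (hf.elemCont_pd 2 1)
  · exact (hf.elemCont_pd 2 0).sub (hf.elemCont_pd 0 2)
  · exact (hf.elemCont_pd 0 1).sub (hf.elemCont_pd 1 0)

theorem C1On.elemCont_div {f : R3 → R3} (hf : M.C1On K f) : M.ElemCont K fun y => div f y := by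
  simp only [div, Fin.sum_univ_three]
  exact ((hf.elemCont_pd 0 0).add (hf.elemCont_pd 1 1)).add (hf.elemCont_pd 2 2)

theorem C1On.elemCont_grad {f : R3 → ℝ} (hf : M.C1On K f) (i : Fin 3) :
    M.ElemCont K fun y => grad f y i :=
  hf.elemCont_fderiv _

theorem ElemCont.integrableOn {f : R3 → ℝ} (hf : M.ElemCont K f) : IntegrableOn f (M.elem K) := by
  obtain ⟨H, hH, he⟩ := hf
  rw [integrableOn_elem_iff, ← integrableOn_congr_set_ae M.shape.interior_body_ae_eq]
  have h1 : IntegrableOn (fun x => |(M.jac K x).det| * H x) M.shape.body :=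
    ((M.continuous_det_jac K).abs.continuousOn.mul hH).integrableOn_compact M.shape.isCompact_body
  exact (h1.mono_set interior_subset).congr_fun (fun x hx => by simp [he x hx])
    isOpen_interior.measurableSet

theorem ElemCont.exists_bound {f : R3 → ℝ} (hf : M.ElemCont K f) :
    ∃ c, ∀ x ∈ M.elem K, |f x| ≤ c := by
  obtain ⟨H, hH, he⟩ := hf
  obtain ⟨c, hc⟩ := M.shape.isCompact_body.exists_bound_of_continuousOn hH
  refine ⟨c, ?_⟩
  rintro _ ⟨x, hx, rfl⟩
  rw [he x hx]
  exact hc x (interior_subset hx)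

theorem ElemCont.integrableOn_mul {f g : R3 → ℝ} (hf : M.ElemCont K f)
    (hg : IntegrableOn g (M.elem K)) : IntegrableOn (fun x => g x * f x) (M.elem K) := by
  obtain ⟨c, hc⟩ := hf.exists_bound
  refine Integrable.mul_bdd (c := c) hg hf.integrableOn.aestronglyMeasurable ?_
  exact (ae_restrict_iff' (M.measurableSet_elem K)).2 (Eventually.of_forall fun x hx => hc x hx)

theorem ElemCont.integrableOn_dotProduct {f g : R3 → R3} (hf : ∀ i, M.ElemCont K fun x => f x i)
    (hg : IntegrableOn g (M.elem K)) : IntegrableOn (fun x => g x ⬝ᵥ f x) (M.elem K) := by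
  simp only [_root_.dotProduct]
  exact integrable_finsetSum _ fun i _ => (hf i).integrableOn_mul (hg.eval i)

/-! ### The divergence theorem on an element -/

/-- The Piola transformation: the divergence in reference coordinates. -/
theorem sum_fderiv_adjugate_mulVec {u G : R3 → R3} {V : Set R3} (hV : IsOpen V)
    (hb : M.shape.body ⊆ V) (hG : ContDiffOn ℝ 1 G V)
    (he : ∀ x ∈ M.shape.body, u (M.map K x) = G x) {x : R3} (hx : x ∈ interior M.shape.body) :
    ∑ i, fderiv ℝ (fun y => (M.jac K y).adjugate *ᵥ G y) x (Pi.single i 1) i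
      = (M.jac K x).det * div u (M.map K x) := by
  have hxb := interior_subset hx
  obtain ⟨-, hGu, -⟩ := C1On.hasFDerivAt hV hb hG he hx
  have hGd : DifferentiableAt ℝ G x :=
    (hG.differentiableOn one_ne_zero).differentiableAt (hV.mem_nhds (hb hxb))
  set c : Fin 3 → R3 → R3 := fun b y => fderiv ℝ (M.map K) y (Pi.single b 1) with hc
  have hfd : DifferentiableAt ℝ (fderiv ℝ (M.map K)) x :=
    ((M.contDiff_map K (m := 2)).fderiv_right (m := 1) (by norm_num)).differentiable one_ne_zero x
  have hcd : ∀ b, DifferentiableAt ℝ (c b) x := fun b => hfd.clm_apply (differentiableAt_const _)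
  have hjac : ∀ y a b, M.jac K y a b = c b y a := fun y a b => by
    rw [hc]; simp only; rw [← jac_mulVec]; simp
  -- The columns of the Jacobian are partial derivatives of one map, so their derivatives are
  -- symmetric in the two indices.
  have hsymm : ∀ a b, fderiv ℝ (c a) x (Pi.single b 1) = fderiv ℝ (c b) x (Pi.single a 1) := by
    have h1 : ∀ a v, fderiv ℝ (c a) x v = fderiv ℝ (fderiv ℝ (M.map K)) x v (Pi.single a 1) :=
      fun a v => by
        rw [hc]
        simp only
        rw [fderiv_clm_apply hfd (differentiableAt_const _)]
        simp
    intro a b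
    rw [h1, h1]
    exact ((M.contDiff_map K (m := 2)).contDiffAt.isSymmSndFDerivAt (by simp)) _ _
  -- Each row of the adjugate is the cross product of two columns of the Jacobian, which makes the
  -- components of the Piola transform triple products.
  have hP : ∀ y, (M.jac K y).adjugate *ᵥ G y = ![(c 1 y ⨯₃ c 2 y) ⬝ᵥ G y, (c 2 y ⨯₃ c 0 y) ⬝ᵥ G y,
      (c 0 y ⨯₃ c 1 y) ⬝ᵥ G y] := fun y => by
    ext i
    fin_cases i <;>
      simp [Matrix.adjugate_fin_three, Matrix.mulVec, _root_.dotProduct, Fin.sum_univ_three,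
        cross_apply, hjac] <;> ring
  have hPd : DifferentiableAt ℝ (fun y => (M.jac K y).adjugate *ᵥ G y) x := by
    simp only [hP]
    have ht : ∀ a b, DifferentiableAt ℝ (fun y => (c a y ⨯₃ c b y) ⬝ᵥ G y) x := fun a b => by
      have h1 := differentiableAt_pi.1 (differentiableAt_cross (hcd a) (hcd b))
      have h2 := differentiableAt_pi.1 hGd
      simp only [_root_.dotProduct]
      exact DifferentiableAt.fun_sum fun i _ => (h1 i).mul (h2 i)
    rw [differentiableAt_pi]
    intro i
    fin_cases i
    · exact ht 1 2
    · exact ht 2 0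
    · exact ht 0 1
  have hPi : ∀ i v, fderiv ℝ (fun y => (M.jac K y).adjugate *ᵥ G y) x v i
      = fderiv ℝ (fun y => ((M.jac K y).adjugate *ᵥ G y) i) x v := fun i v => by
    rw [(hasFDerivAt_coord hPd i).fderiv]; rfl
  simp only [hPi, Fin.sum_univ_three]
  have e0 : (fun y => ((M.jac K y).adjugate *ᵥ G y) 0) = fun y => (c 1 y ⨯₃ c 2 y) ⬝ᵥ G y := by
    ext1 y; rw [hP]; rfl
  have e1 : (fun y => ((M.jac K y).adjugate *ᵥ G y) 1) = fun y => (c 2 y ⨯₃ c 0 y) ⬝ᵥ G y := by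
    ext1 y; rw [hP]; rfl
  have e2 : (fun y => ((M.jac K y).adjugate *ᵥ G y) 2) = fun y => (c 0 y ⨯₃ c 1 y) ⬝ᵥ G y := by
    ext1 y; rw [hP]; rfl
  -- After the mixed derivatives are matched by `hsymm`, the terms that differentiate columns cancel
  -- in pairs. The remaining ones form the trace of `adj(J) Du J`, which is `det J · div u`.
  rw [e0, e1, e2, fderiv_triple (hcd 1) (hcd 2) hGd, fderiv_triple (hcd 2) (hcd 0) hGd,
    fderiv_triple (hcd 0) (hcd 1) hGd, hsymm 1 0, hsymm 2 0, hsymm 2 1, ← hGu, ← hGu, ← hGu]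
  have hD : ∀ v l, fderiv ℝ u (M.map K x) v l = ∑ i, v i * pd u (M.map K x) i l := fun v l => by
    conv_lhs => rw [pi_eq_sum_univ' v]
    simp [map_sum, pd, Finset.sum_apply]
  have hcx : ∀ b, fderiv ℝ (M.map K) x (Pi.single b 1) = c b x := fun b => rfl
  rw [hcx, hcx, hcx, Matrix.det_fin_three, div]
  simp only [hjac]
  simp [cross_apply, _root_.dotProduct, Fin.sum_univ_three, hD]
  ring

/-- The Piola transformation carries the integral to the reference element, the divergence theorem
holds there, and Nanson's formula carries the boundary terms back. The sign `c` of `det J` is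
constant and can be taken out of the integrals. The pointwise identity is needed only in the
interior, since the boundary is null. -/
theorem integral_div_elem {u : R3 → R3} (hu : M.C1On K u) :
    ∫ x in M.elem K, div u x
      = M.bdInt K fun i ξ => u (M.bmap K i ξ) ⬝ᵥ M.normal K i ξ := by
  obtain ⟨V, hV, hb, G, hG, he⟩ := hu
  obtain ⟨c, -, hdet⟩ := M.exists_sign_det K
  set P : R3 → R3 := fun y => (M.jac K y).adjugate *ᵥ G y with hP
  have hjac : ∀ a b, ContDiff ℝ 1 fun y => M.jac K y a b := fun a b => by
    have : ∀ y, M.jac K y a b = fderiv ℝ (M.map K) y (Pi.single b 1) a := fun y => by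
      rw [← jac_mulVec]; simp
    simp only [this]
    exact contDiff_pi.1 (((M.contDiff_map K (m := 2)).fderiv_right (m := 1) (by norm_num)).clm_apply
      contDiff_const) a
  have hPc : ContDiffOn ℝ 1 P V := by
    rw [contDiffOn_pi]
    intro i
    simp only [hP, Matrix.mulVec, _root_.dotProduct]
    refine ContDiffOn.sum fun l _ => ContDiffOn.mul ?_ ((contDiffOn_pi.1 hG) l)
    refine ContDiff.contDiffOn ?_
    fin_cases i <;> fin_cases l <;> simp [Matrix.adjugate_fin_three] <;> fun_prop
  have h1 : ∫ x in M.elem K, div u x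
      = c * ∫ x in M.shape.body, ∑ i, fderiv ℝ P x (Pi.single i 1) i := by
    rw [setIntegral_elem, ← integral_const_mul,
      ← setIntegral_congr_set M.shape.interior_body_ae_eq,
      ← setIntegral_congr_set M.shape.interior_body_ae_eq]
    refine setIntegral_congr_fun isOpen_interior.measurableSet fun x hx => ?_
    rw [sum_fderiv_adjugate_mulVec hV hb hG he hx, hdet x (interior_subset hx)]
    ring
  rw [h1, M.shape.setIntegral_div_body hV hb hPc, bdInt, Finset.mul_sum]
  refine Finset.sum_congr rfl fun i _ => ?_
  rw [faceInt, ← integral_const_mul]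
  refine setIntegral_congr_fun M.shape.measurableSet_face fun ξ hξ => ?_
  obtain ⟨_, -, hn⟩ := M.exists_sign_paramNormal K i
  obtain ⟨-, h2, -⟩ := hn ξ hξ
  have hxb := M.shape.emb_mem_body i hξ
  rw [mul_comm (_ ⬝ᵥ _), ← smul_eq_mul (areaElem _ _), ← dotProduct_smul, h2, hdet _ hxb, bmap,
    he _ hxb, hP]
  simp only
  rw [Matrix.dotProduct_mulVec, ← Matrix.mulVec_transpose, M.adjugate_eq K hxb,
    Matrix.transpose_smul, Matrix.smul_mulVec, dotProduct_smul, smul_dotProduct,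
    dotProduct_comm (G _)]
  simp [mul_assoc]

end Mesh

/-! ### Identities for cross products and tangential parts -/

theorem dotProduct_cross_eq (a b n : R3) : (a ⨯₃ b) ⬝ᵥ n = a ⬝ᵥ (b ⨯₃ n) := by
  rw [triple_product_permutation, triple_product_permutation, dotProduct_comm]

theorem tang_dotProduct_cross {n : R3} (hn : n ⬝ᵥ n = 1) (a v : R3) :
    tang n a ⬝ᵥ (v ⨯₃ n) = a ⬝ᵥ (v ⨯₃ n) := by
  rw [tang_eq, hn, one_smul, sub_dotProduct, smul_dotProduct, dot_cross_self, smul_zero, sub_zero]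

theorem sub_tang_cross {n : R3} (hn : n ⬝ᵥ n = 1) (a : R3) : (a - tang n a) ⨯₃ n = 0 := by
  rw [tang_eq, hn, one_smul, sub_sub_cancel, map_smul, LinearMap.smul_apply, cross_self, smul_zero]

theorem cross_tang {n : R3} (hn : n ⬝ᵥ n = 1) (a : R3) : n ⨯₃ tang n a = n ⨯₃ a := by
  rw [tang_eq, hn, one_smul, map_sub, map_smul, cross_self, smul_zero, sub_zero]

namespace Mesh

variable {Ω : Set R3} {p : ℕ} {M : Mesh Ω p} {K : M.Elem}

/-! ### Integration by parts on an element -/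

theorem InW.c1On {k : ℕ} {f : R3 → ℝ} (hf : M.InW k K f) : M.C1On K f := by
  obtain ⟨q, hq, he⟩ := hf
  refine ⟨univ, isOpen_univ, subset_univ _, fun x => MvPolynomial.eval x q, ?_, he⟩
  exact (IsPolyOn.contDiff ⟨q, hq, fun _ _ => rfl⟩).contDiffOn

theorem InV.c1On {k : ℕ} {v : R3 → R3} (hv : M.InV k K v) : M.C1On K v :=
  C1On.pi fun i => (hv i).c1On

theorem C1On.cross {a b : R3 → R3} (ha : M.C1On K a) (hb : M.C1On K b) :
    M.C1On K fun x => a x ⨯₃ b x := by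
  refine ha.comp₂ hb (op := fun q => q.1 ⨯₃ q.2) (contDiff_pi.2 fun i => ?_)
  fin_cases i <;> simp only [cross_apply] <;> simp <;> fun_prop

theorem C1On.smul {f : R3 → ℝ} {v : R3 → R3} (hf : M.C1On K f) (hv : M.C1On K v) :
    M.C1On K fun x => f x • v x :=
  hf.comp₂ hv (op := fun q => q.1 • q.2) (by fun_prop)

theorem faceInt_congr {i : M.shape.Idx} {f g : R2 → ℝ} (h : ∀ ξ ∈ M.shape.face, f ξ = g ξ) :
    M.faceInt K i f = M.faceInt K i g :=
  setIntegral_congr_fun M.shape.measurableSet_face fun ξ hξ => by simp only [h ξ hξ]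

theorem faceInt_congr_interior {i : M.shape.Idx} {f g : R2 → ℝ}
    (h : ∀ ξ ∈ interior M.shape.face, f ξ = g ξ) : M.faceInt K i f = M.faceInt K i g := by
  rw [faceInt, faceInt, ← setIntegral_congr_set M.shape.interior_face_ae_eq,
    ← setIntegral_congr_set M.shape.interior_face_ae_eq]
  exact setIntegral_congr_fun isOpen_interior.measurableSet fun ξ hξ => by simp only [h ξ hξ]

theorem bdInt_congr {f g : M.shape.Idx → R2 → ℝ} (h : ∀ i, ∀ ξ ∈ M.shape.face, f i ξ = g i ξ) :
    M.bdInt K f = M.bdInt K g :=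
  Finset.sum_congr rfl fun i _ => faceInt_congr (h i)

theorem faceInt_zero (i : M.shape.Idx) : M.faceInt K i (fun _ => 0) = 0 := by simp [faceInt]

theorem bdInt_zero : M.bdInt K (fun _ _ => 0) = 0 := by simp [bdInt, faceInt_zero]

/-- The divergence theorem for `a × b`. -/
theorem integral_curl_sub {a b : R3 → R3} (ha : M.C1On K a) (hb : M.C1On K b) :
    (∫ x in M.elem K, curl a x ⬝ᵥ b x) - ∫ x in M.elem K, a x ⬝ᵥ curl b x
      = M.bdInt K fun i ξ => a (M.bmap K i ξ) ⬝ᵥ (b (M.bmap K i ξ) ⨯₃ M.normal K i ξ) := by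
  have h1 := integral_div_elem (ha.cross hb)
  rw [setIntegral_congr_fun (M.measurableSet_elem K) fun x hx =>
    div_cross (ha.differentiableAt hx) (hb.differentiableAt hx), integral_sub] at h1
  · rw [h1]
    exact bdInt_congr fun i ξ _ => dotProduct_cross_eq _ _ _
  · exact (ElemCont.dotProduct ha.elemCont_curl fun i => (hb.coord i).elemCont).integrableOn
  · exact (ElemCont.dotProduct (fun i => (ha.coord i).elemCont) hb.elemCont_curl).integrableOn

/-- The divergence theorem for `f v`. -/
theorem integral_grad_add {f : R3 → ℝ} {v : R3 → R3} (hf : M.C1On K f) (hv : M.C1On K v) :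
    (∫ x in M.elem K, grad f x ⬝ᵥ v x) + ∫ x in M.elem K, f x * div v x
      = M.bdInt K fun i ξ => (f (M.bmap K i ξ) • v (M.bmap K i ξ)) ⬝ᵥ M.normal K i ξ := by
  rw [← integral_div_elem (hf.smul hv), setIntegral_congr_fun (M.measurableSet_elem K) fun x hx =>
    div_smul (hf.differentiableAt hx) (hv.differentiableAt hx), integral_add]
  · exact (ElemCont.dotProduct hf.elemCont_grad fun i => (hv.coord i).elemCont).integrableOn
  · exact (hf.elemCont.mul hv.elemCont_div).integrableOn

/-! ### Faces -/

/-- An open set does not meet its frontier, so the two alternatives of `Mesh.conform` exclude each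
other. A face known to lie on `∂Ω` therefore belongs to exactly one element. -/
theorem not_isBdry_of_image_subset (hΩ : IsOpen Ω) {F : M.Face}
    (h : M.faceMap F '' interior M.shape.face ⊆ Ω) : ¬M.IsBdry F := by
  intro hb
  obtain ⟨ξ, hξ⟩ := M.shape.interior_face_nonempty
  have h1 := h (mem_image_of_mem _ hξ)
  have h2 := hb (mem_image_of_mem _ (interior_subset hξ))
  exact (hΩ.inter_frontier_eq ▸ ⟨h1, h2⟩ : M.faceMap F ξ ∈ (∅ : Set R3))

/-- The cross product of two combinations of the tangent vectors is the determinant of the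
combination times their cross product. -/
theorem paramNormal_comp_affine {γ : R2 → R3} (hγ : Differentiable ℝ γ) (σ : R2 ≃ᵃ[ℝ] R2)
    (ξ : R2) : paramNormal (fun ξ => γ (σ ξ)) ξ
      = (LinearMap.toContinuousLinearMap (σ.linear : R2 →ₗ[ℝ] R2)).det • paramNormal γ (σ ξ) := by
  set A := LinearMap.toContinuousLinearMap (σ.linear : R2 →ₗ[ℝ] R2) with hA
  have hd : HasFDerivAt (fun ξ => γ (σ ξ)) ((fderiv ℝ γ (σ ξ)).comp A) ξ :=
    (hγ (σ ξ)).hasFDerivAt.comp ξ (AffineEquiv.hasFDerivAt_plane σ ξ)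
  have hdet : A.det = A (Pi.single 0 1) 0 * A (Pi.single 1 1) 1
      - A (Pi.single 1 1) 0 * A (Pi.single 0 1) 1 := by
    rw [ContinuousLinearMap.det, ← LinearMap.det_toMatrix', Matrix.det_fin_two]
    simp [LinearMap.toMatrix'_apply]
  have he : ∀ w : R2, fderiv ℝ γ (σ ξ) w
      = w 0 • fderiv ℝ γ (σ ξ) (Pi.single 0 1) + w 1 • fderiv ℝ γ (σ ξ) (Pi.single 1 1) := fun w => by
    conv_lhs => rw [pi_eq_sum_univ' w]
    simp [Fin.sum_univ_two]
  rw [paramNormal, hd.fderiv, ContinuousLinearMap.comp_apply, ContinuousLinearMap.comp_apply,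
    he (A (Pi.single 0 1)), he (A (Pi.single 1 1)), hdet, paramNormal]
  ext l
  fin_cases l <;> simp [cross_apply] <;> ring

/-- On a face of an element the normal is, up to a constant sign, the unit normal of the
parametrization of the face. -/
theorem exists_faceSign (K : M.Elem) (i : M.shape.Idx) : ∃ σ : R2 ≃ᵃ[ℝ] R2,
    σ '' M.shape.face = M.shape.face ∧
    (∀ ξ ∈ M.shape.face, M.bmap K i ξ = M.faceMap (M.faceOf K i) (σ ξ)) ∧
    (∀ ξ ∈ M.shape.face, areaElem (M.bmap K i) ξ = areaElem (M.faceMap (M.faceOf K i)) (σ ξ)) ∧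
    ∃ s : ℝ, |s| = 1 ∧ ∀ ξ ∈ M.shape.face,
      M.normal K i ξ = s • unit (paramNormal (M.faceMap (M.faceOf K i)) (σ ξ)) := by
  obtain ⟨σ, hσ, he⟩ := M.compat K i
  set F := M.faceOf K i
  set δ := (LinearMap.toContinuousLinearMap (σ.linear : R2 →ₗ[ℝ] R2)).det with hδ
  have hδ1 : |δ| = 1 := AffineEquiv.abs_det_eq_one hσ
  have hFd : ContDiff ℝ 1 (M.faceMap F) := M.contDiff_faceMap F
  have hσc : Continuous σ :=
    continuous_iff_continuousAt.2 fun ξ => (AffineEquiv.hasFDerivAt_plane σ ξ).continuousAt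
  have hint : ∀ ξ ∈ interior M.shape.face,
      paramNormal (M.bmap K i) ξ = δ • paramNormal (M.faceMap F) (σ ξ) := by
    intro ξ hξ
    rw [← paramNormal_comp_affine (hFd.differentiable one_ne_zero)]
    have : M.bmap K i =ᶠ[𝓝 ξ] fun ξ => M.faceMap F (σ ξ) := by
      filter_upwards [isOpen_interior.mem_nhds hξ] with η hη using he η (interior_subset hη)
    rw [paramNormal, paramNormal, this.fderiv_eq]
  -- The two parametrizations agree on the closed face only, which determines derivatives in its
  -- interior. Continuity extends the identity of the normals to the edges.
  have hN : ∀ ξ ∈ M.shape.face,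
      paramNormal (M.bmap K i) ξ = δ • paramNormal (M.faceMap F) (σ ξ) := by
    have hcl : IsClosed {ξ | paramNormal (M.bmap K i) ξ = δ • paramNormal (M.faceMap F) (σ ξ)} :=
      isClosed_eq (continuous_paramNormal_of_contDiff (M.contDiff_bmap K i))
        (((continuous_paramNormal_of_contDiff hFd).comp hσc).const_smul δ)
    exact fun ξ hξ => closure_minimal hint hcl (M.shape.subset_closure_interior_face hξ)
  have hA : ∀ ξ ∈ M.shape.face,
      areaElem (M.bmap K i) ξ = areaElem (M.faceMap F) (σ ξ) := fun ξ hξ => by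
    rw [areaElem, hN ξ hξ, sqrt_dotProduct_self_smul, hδ1, one_mul, areaElem]
  obtain ⟨c, hc, hcn⟩ := M.exists_sign_paramNormal K i
  have hcc : c * c = 1 := by rw [← abs_mul_abs_self, hc, one_mul]
  refine ⟨σ, hσ, he, hA, c * δ, by rw [abs_mul, hc, hδ1, one_mul], fun ξ hξ => ?_⟩
  obtain ⟨h1, -, h3⟩ := hcn ξ hξ
  have h4 : Real.sqrt (paramNormal (M.faceMap F) (σ ξ) ⬝ᵥ paramNormal (M.faceMap F) (σ ξ))
      = areaElem (M.bmap K i) ξ := (hA ξ hξ).symm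
  rw [unit, h4, smul_smul]
  have h5 : (c * δ) • paramNormal (M.faceMap F) (σ ξ)
      = (c * c * areaElem (M.bmap K i) ξ) • M.normal K i ξ := by
    rw [mul_smul, ← hN ξ hξ, h1, smul_smul, mul_assoc]
  rw [mul_comm, mul_smul, h5, smul_smul, hcc, one_mul, one_div, inv_mul_cancel₀ h3.ne', one_smul]

/-- The points behind a face, seen in the direction of the outward normal, lie in the element. -/
theorem eventually_sub_smul_normal_mem_elem (K : M.Elem) (i : M.shape.Idx) {ξ : R2}
    (hξ : ξ ∈ interior M.shape.face) :
    ∀ᶠ r in 𝓝[>] (0 : ℝ), M.bmap K i ξ - r • M.normal K i ξ ∈ M.elem K := by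
  have hξf := interior_subset hξ
  have hxb := M.shape.emb_mem_body i hξf
  obtain ⟨e, hes, -, hesymm⟩ := M.exists_equiv K hxb
  set x₀ := M.shape.emb i ξ with hx₀
  set n := M.normal K i ξ with hn
  set g := hes.localInverse (M.map K) e x₀ with hg
  have hgx : g (M.bmap K i ξ) = x₀ := hes.localInverse_apply_image
  have hgd : HasFDerivAt g (e.symm : R3 →L[ℝ] R3) (M.bmap K i ξ) := hes.to_localInverse.hasFDerivAt
  have hline : HasDerivAt (fun r : ℝ => M.bmap K i ξ - r • n) (-n) 0 := by
    simpa using ((hasDerivAt_id' (0 : ℝ)).smul_const n).const_sub (M.bmap K i ξ)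
  have h0 : M.bmap K i ξ - (0 : ℝ) • n = M.bmap K i ξ := by simp
  have hx : HasDerivAt (fun r : ℝ => g (M.bmap K i ξ - r • n)) (e.symm (-n)) 0 := by
    have : HasFDerivAt g (e.symm : R3 →L[ℝ] R3) (M.bmap K i ξ - (0 : ℝ) • n) := by rwa [h0]
    exact this.comp_hasDerivAt 0 hline
  -- Pulling `-n` back and pairing it with the reference normal amounts to pairing `-n` with `J⁻ᵀ
  -- n_ref`, of which `n` is a positive multiple.
  have hneg : M.shape.refNormal i ⬝ᵥ e.symm (-n) < 0 := by
    set ν := ((M.jac K x₀)⁻¹)ᵀ *ᵥ M.shape.refNormal i with hν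
    have hν0 : ν ≠ 0 := M.conormal_ne_zero K hxb i
    have h1 : M.shape.refNormal i ⬝ᵥ ((M.jac K x₀)⁻¹ *ᵥ n) = ν ⬝ᵥ n := by
      rw [Matrix.dotProduct_mulVec, hν, Matrix.mulVec_transpose]
    have h2 : n = unit ν := rfl
    have h3 : 0 < ν ⬝ᵥ n := by
      rw [h2, unit, dotProduct_smul, smul_eq_mul]
      exact mul_pos (one_div_pos.2 (sqrt_dotProduct_self_pos hν0)) (dotProduct_self_pos hν0)
    rw [map_neg, dotProduct_neg, hesymm, h1]
    linarith
  have hin := M.shape.eventually_mem_interior_body i hξ hx (by rw [h0]; exact hgx) hneg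
  have hright : ∀ᶠ r in 𝓝[>] (0 : ℝ),
      M.map K (g (M.bmap K i ξ - r • n)) = M.bmap K i ξ - r • n := by
    have h1 := hes.eventually_right_inverse
    have h2 : Tendsto (fun r : ℝ => M.bmap K i ξ - r • n) (𝓝[>] 0) (𝓝 (M.map K x₀)) := by
      have := hline.continuousAt.tendsto
      rw [h0] at this
      exact this.mono_left nhdsWithin_le_nhds
    exact h2.eventually h1
  filter_upwards [hin, hright] with r h1 h2
  exact ⟨_, h1, h2⟩

/-- The outward normals of two different elements on a common face are opposite. -/
theorem normal_eq_neg {K K' : M.Elem} (hK : K ≠ K') {i i' : M.shape.Idx} {ξ ξ' : R2}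
    (hξ : ξ ∈ interior M.shape.face) (hξ' : ξ' ∈ interior M.shape.face)
    (he : M.bmap K i ξ = M.bmap K' i' ξ') {s s' : ℝ} (hs : |s| = 1) (hs' : |s'| = 1) {u : R3}
    (hn : M.normal K i ξ = s • u) (hn' : M.normal K' i' ξ' = s' • u) : s' = -s := by
  by_contra hne
  have hss : s' = s := by
    rcases (abs_eq zero_le_one).1 hs with h | h <;> rcases (abs_eq zero_le_one).1 hs' with h' | h' <;>
      simp_all
  -- If the normals agreed, the same points just behind the face would lie in both elements, which
  -- are disjoint.
  have h1 := eventually_sub_smul_normal_mem_elem K i hξ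
  have h2 := eventually_sub_smul_normal_mem_elem K' i' hξ'
  rw [hn', hss, ← hn, ← he] at h2
  obtain ⟨r, h3, h4⟩ := (h1.and h2).exists
  exact (M.disjoint K K' hK).le_bot ⟨h3, h4⟩

/-- Surface integrals from the two sides of a face become comparable once both are written in the
parametrization that belongs to the face. -/
theorem faceInt_eq_of_comp {K : M.Elem} {i : M.shape.Idx} {σ : R2 ≃ᵃ[ℝ] R2}
    (hσ : σ '' M.shape.face = M.shape.face)
    (hA : ∀ ξ ∈ M.shape.face, areaElem (M.bmap K i) ξ = areaElem (M.faceMap (M.faceOf K i)) (σ ξ))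
    {f g : R2 → ℝ} (hfg : ∀ ξ ∈ M.shape.face, f ξ = g (σ ξ)) :
    M.faceInt K i f = ∫ η in M.shape.face, g η * areaElem (M.faceMap (M.faceOf K i)) η := by
  rw [← AffineEquiv.setIntegral_comp_face hσ]
  exact setIntegral_congr_fun M.shape.measurableSet_face fun ξ hξ => by
    simp only [hfg ξ hξ, hA ξ hξ]

open Classical in
/-- Surface integrals of a quantity that is odd in the normal cancel over the interior faces. -/
theorem sum_interior_eq_zero (f : R3 → M.Face → R3 → ℝ)
    (hodd : ∀ n F x, f (-n) F x = -f n F x) :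
    (∑ K, ∑ i, if M.IsBdry (M.faceOf K i) then 0 else
      M.faceInt K i fun ξ => f (M.normal K i ξ) (M.faceOf K i) (M.bmap K i ξ)) = 0 := by
  -- The sum over elements and their faces is regrouped by mesh faces. Each interior face then
  -- carries exactly two terms.
  rw [← Fintype.sum_prod_type' (f := fun K i => if M.IsBdry (M.faceOf K i) then (0 : ℝ) else
      M.faceInt K i fun ξ => f (M.normal K i ξ) (M.faceOf K i) (M.bmap K i ξ)),
    ← Finset.sum_fiberwise (s := Finset.univ) (g := fun s : M.Elem × M.shape.Idx => M.faceOf s.1 s.2)]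
  refine Finset.sum_eq_zero fun F _ => ?_
  by_cases hF : M.IsBdry F
  · refine Finset.sum_eq_zero fun r hr => ?_
    rw [(Finset.mem_filter.1 hr).2, if_pos hF]
  · obtain ⟨hb, -⟩ | ⟨-, ⟨K, i⟩, ⟨K', i'⟩, hne, hr⟩ := M.conform F
    · exact absurd hb hF
    · have hfil : (Finset.univ.filter fun r : M.Elem × M.shape.Idx => M.faceOf r.1 r.2 = F)
          = {(K, i), (K', i')} := by
        ext r; simp [hr r]
      have hss : (K, i) ≠ (K', i') := fun h => hne (congrArg Prod.fst h)
      rw [hfil, Finset.sum_pair hss]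
      have e1 : M.faceOf K i = F := (hr (K, i)).2 (Or.inl rfl)
      have e2 : M.faceOf K' i' = F := (hr (K', i')).2 (Or.inr rfl)
      simp only [e1, e2, if_neg hF]
      obtain ⟨σ, hσ, hb, hA, s, hs, hn⟩ := exists_faceSign K i
      obtain ⟨σ', hσ', hb', hA', s', hs', hn'⟩ := exists_faceSign K' i'
      rw [faceInt_eq_of_comp hσ hA (g := fun η => f (s • unit (paramNormal (M.faceMap F) η)) F
          (M.faceMap F η)) (fun ξ hξ => by rw [hn ξ hξ, hb ξ hξ, e1]),
        faceInt_eq_of_comp hσ' hA' (g := fun η => f (s' • unit (paramNormal (M.faceMap F) η)) F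
          (M.faceMap F η)) (fun ξ hξ => by rw [hn' ξ hξ, hb' ξ hξ, e2]), e1, e2]
      -- Both signs are constant on the face, so it suffices to compare the normals at one interior
      -- point, with its parameters `ξ` and `ξ'` seen from the two elements.
      have hopp : s' = -s := by
        obtain ⟨ξ, hξ⟩ := M.shape.interior_face_nonempty
        have hhom : ∀ τ : R2 ≃ᵃ[ℝ] R2, τ '' M.shape.face = M.shape.face → ∀ η,
            η ∈ interior M.shape.face → τ η ∈ interior M.shape.face := fun τ hτ η hη => by
          have hopen : IsOpenMap τ := (AffineEquiv.toContinuousAffineEquiv τ).toHomeomorph.isOpenMap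
          have := hopen.image_interior_subset M.shape.face
          rw [hτ] at this
          exact this (mem_image_of_mem τ hη)
        have hsymm : σ'.symm '' M.shape.face = M.shape.face := by
          conv_lhs => rw [← hσ']
          rw [← image_comp]
          simp
        set ξ' := σ'.symm (σ ξ) with hξ'
        have hξ'i : ξ' ∈ interior M.shape.face := hhom _ hsymm _ (hhom _ hσ _ hξ)
        have hσσ : σ' ξ' = σ ξ := σ'.apply_symm_apply _
        refine normal_eq_neg (i' := i') hne hξ hξ'i ?_ hs hs' (hn ξ (interior_subset hξ)) ?_
        · rw [hb ξ (interior_subset hξ), hb' ξ' (interior_subset hξ'i), hσσ, e1, e2]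
        · rw [hn' ξ' (interior_subset hξ'i), hσσ, e1, e2]
      rw [add_eq_zero_iff_eq_neg, ← integral_neg]
      refine setIntegral_congr_fun M.shape.measurableSet_face fun η _ => ?_
      simp only [hopp, neg_smul, hodd, neg_mul, neg_neg]

end Mesh

/-! ### Consistency -/

variable {Ω : Set R3} {p : ℕ} {M : Mesh Ω p} (C : Coeff M)

namespace Mesh

theorem mem_closure_of_bmap {K : M.Elem} {i : M.shape.Idx} {ξ : R2} (hξ : ξ ∈ M.shape.face) :
    M.bmap K i ξ ∈ M.map K '' M.shape.body :=
  mem_image_of_mem _ (M.shape.emb_mem_body i hξ)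

theorem exists_faceMap_eq {K : M.Elem} {i : M.shape.Idx} {ξ : R2} (hξ : ξ ∈ M.shape.face) :
    ∃ η ∈ M.shape.face, M.bmap K i ξ = M.faceMap (M.faceOf K i) η := by
  obtain ⟨σ, hσ, he⟩ := M.compat K i
  exact ⟨σ ξ, hσ ▸ mem_image_of_mem σ hξ, he ξ hξ⟩

theorem integrableOn_elem_of_memLp {E : Type*} [NormedAddCommGroup E] {f : R3 → E}
    (hf : MemLp f 2 (volume.restrict Ω)) (K : M.Elem) : IntegrableOn f (M.elem K) := by
  have h1 : MemLp f 2 (volume.restrict (M.elem K)) :=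
    hf.mono_measure (Measure.restrict_mono (M.subset K) le_rfl)
  have : IsFiniteMeasure (volume.restrict (M.elem K)) :=
    ⟨by simpa using M.volume_elem_lt_top K⟩
  exact h1.integrable (by norm_num)

end Mesh

theorem hHat_eq_tang {K : M.Elem} {e h : R3 → R3} {eh : M.Face → R3 → R3}
    {i : M.shape.Idx} {ξ : R2} (hξ : ξ ∈ M.shape.face)
    (heh : eh (M.faceOf K i) (M.bmap K i ξ) = tang (M.normal K i ξ) (e (M.bmap K i ξ))) :
    hHat C K e h eh i ξ = tang (M.normal K i ξ) (h (M.bmap K i ξ)) := by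
  rw [hHat, heh, sub_tang_cross (M.normal_dotProduct_self K hξ), smul_zero, sub_zero]

theorem C1Closure.c1On {E : Type*} [NormedAddCommGroup E] [NormedSpace ℝ E] {f : R3 → E}
    (hf : C1Closure Ω f) (K : M.Elem) : M.C1On K f := by
  obtain ⟨U, hU, hΩ, h⟩ := hf
  exact Mesh.C1On.of_contDiffOn hU hΩ h

/-- Each equation is multiplied by the test function and integrated by parts. The boundary term of
the gradient and the `α₃` term contain `φ` and vanish. Since `ê` is the tangential part of `e`, the
trace `ĥ` reduces to the tangential part of `h`, and tangential parts are all that products with `v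
× n` see. -/
theorem localEqs_of_exact {k : ℕ} {K : M.Elem} {e h : R3 → R3} {φ : R3 → ℝ} {et ht : R3 → R3}
    {φt : R3 → ℝ} {eh : M.Face → R3 → R3} {j : R3 → R3} {ρ : R3 → ℝ} (he : M.C1On K e)
    (hh : M.C1On K h) (hφ : M.C1On K φ) (hj : IntegrableOn j (M.elem K))
    (hρ : IntegrableOn ρ (M.elem K))
    (h1 : ∀ x ∈ M.elem K, C.ε x • et x - curl h x + grad φ x = - j x)
    (h2 : ∀ x ∈ M.elem K, C.μ x • ht x + curl e x = 0)
    (h3 : ∀ x ∈ M.elem K,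
      1 / C.α₁ ^ 2 * φt x + 1 / C.α₂ ^ 2 * φ x + div e x = ρ x / C.ε₀)
    (hφ0 : ∀ i, ∀ ξ ∈ M.shape.face, φ (M.bmap K i ξ) = 0)
    (heh : ∀ i, ∀ ξ ∈ M.shape.face,
      eh (M.faceOf K i) (M.bmap K i ξ) = tang (M.normal K i ξ) (e (M.bmap K i ξ))) :
    LocalEqs C k K e h φ et ht φt eh j ρ := by
  have hmeas := M.measurableSet_elem K
  refine ⟨fun v hv => ?_, fun w hw => ?_, fun ψ hψ => ?_⟩
  · have hv1 := hv.c1On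
    have hvc : ∀ i, M.ElemCont K fun x => v x i := fun i => (hv1.coord i).elemCont
    have i1 := (Mesh.ElemCont.dotProduct hh.elemCont_curl hvc).integrableOn
    have i2 := (Mesh.ElemCont.dotProduct hφ.elemCont_grad hvc).integrableOn
    have i3 := Mesh.ElemCont.integrableOn_dotProduct hvc hj
    -- The time derivative is replaced through the equation by integrable terms, so nothing about
    -- its regularity in space is needed.
    have e1 : ∫ x in M.elem K, C.ε x * (et x ⬝ᵥ v x) = (∫ x in M.elem K, curl h x ⬝ᵥ v x)
        - (∫ x in M.elem K, grad φ x ⬝ᵥ v x) - ∫ x in M.elem K, j x ⬝ᵥ v x := by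
      have i12 : IntegrableOn (fun x => curl h x ⬝ᵥ v x - grad φ x ⬝ᵥ v x) (M.elem K) := i1.sub i2
      rw [← integral_sub i1 i2, ← integral_sub i12 i3]
      refine setIntegral_congr_fun hmeas fun x hx => ?_
      have : C.ε x • et x = curl h x - grad φ x - j x := by
        rw [sub_eq_add_neg _ (j x), ← h1 x hx]; abel
      rw [← smul_eq_mul, ← smul_dotProduct, this, sub_dotProduct, sub_dotProduct]
    have e2 := Mesh.integral_curl_sub hh hv1
    have e3 := Mesh.integral_grad_add hφ hv1
    have e4 : M.bdInt K (fun i ξ => (φ (M.bmap K i ξ) • v (M.bmap K i ξ)) ⬝ᵥ M.normal K i ξ) = 0 := by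
      rw [← Mesh.bdInt_zero (K := K)]
      exact Mesh.bdInt_congr fun i ξ hξ => by rw [hφ0 i ξ hξ, zero_smul, zero_dotProduct]
    have e5 : M.bdInt K (fun i ξ => hHat C K e h eh i ξ ⬝ᵥ (v (M.bmap K i ξ) ⨯₃ M.normal K i ξ))
        = M.bdInt K fun i ξ => h (M.bmap K i ξ) ⬝ᵥ (v (M.bmap K i ξ) ⨯₃ M.normal K i ξ) :=
      Mesh.bdInt_congr fun i ξ hξ => by
        rw [hHat_eq_tang C hξ (heh i ξ hξ),
          tang_dotProduct_cross (M.normal_dotProduct_self K hξ)]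
    rw [e1, e5]
    linarith
  · have hw1 := hw.c1On
    have e1 : ∫ x in M.elem K, C.μ x * (ht x ⬝ᵥ w x) = - ∫ x in M.elem K, curl e x ⬝ᵥ w x := by
      rw [← integral_neg]
      refine setIntegral_congr_fun hmeas fun x hx => ?_
      rw [← smul_eq_mul, ← smul_dotProduct, eq_neg_of_add_eq_zero_left (h2 x hx), neg_dotProduct]
    have e2 := Mesh.integral_curl_sub he hw1
    have e3 : M.bdInt K (fun i ξ => eh (M.faceOf K i) (M.bmap K i ξ) ⬝ᵥ
          (w (M.bmap K i ξ) ⨯₃ M.normal K i ξ))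
        = M.bdInt K fun i ξ => e (M.bmap K i ξ) ⬝ᵥ (w (M.bmap K i ξ) ⨯₃ M.normal K i ξ) :=
      Mesh.bdInt_congr fun i ξ hξ => by
        rw [heh i ξ hξ, tang_dotProduct_cross (M.normal_dotProduct_self K hξ)]
    rw [e1, e3]
    linarith
  · have hψ1 := hψ.c1On
    have i1 := (hφ.elemCont.mul hψ1.elemCont).integrableOn
    have i2 := (he.elemCont_div.mul hψ1.elemCont).integrableOn
    have i3 := hψ1.elemCont.integrableOn_mul (hρ.div_const C.ε₀)
    have e1 : 1 / C.α₁ ^ 2 * ∫ x in M.elem K, φt x * ψ x = (∫ x in M.elem K, ρ x / C.ε₀ * ψ x)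
        - 1 / C.α₂ ^ 2 * (∫ x in M.elem K, φ x * ψ x) - ∫ x in M.elem K, div e x * ψ x := by
      have i31 : IntegrableOn (fun x => ρ x / C.ε₀ * ψ x - 1 / C.α₂ ^ 2 * (φ x * ψ x))
        (M.elem K) := i3.sub (i1.const_mul _)
      rw [← integral_const_mul, ← integral_const_mul, ← integral_sub i3 (i1.const_mul _),
        ← integral_sub i31 i2]
      refine setIntegral_congr_fun hmeas fun x hx => ?_
      rw [← h3 x hx]
      ring
    have e2 : M.bdInt K (fun i ξ => φ (M.bmap K i ξ) * ψ (M.bmap K i ξ)) = 0 := by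
      rw [← Mesh.bdInt_zero (K := K)]
      exact Mesh.bdInt_congr fun i ξ hξ => by rw [hφ0 i ξ hξ, zero_mul]
    rw [e1, e2]
    ring

/-- On interior faces `n × ĥ = n × h` with a single-valued `h`, which is odd in the normal, so the
two sides cancel. On boundary faces the boundary condition makes the integrand vanish in the
relative interior, up to a null set. -/
theorem traceEq_of_exact {k : ℕ} {e h : R3 → R3} {eh : M.Face → R3 → R3} {einc : R3 → R3}
    (heh : ∀ K i, ∀ ξ ∈ M.shape.face,
      eh (M.faceOf K i) (M.bmap K i ξ) = tang (M.normal K i ξ) (e (M.bmap K i ξ)))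
    (hbc : ∀ K i, M.IsBdry (M.faceOf K i) → ∀ ξ ∈ interior M.shape.face,
      tang (M.normal K i ξ) (e (M.bmap K i ξ)) = - tang (M.normal K i ξ) (einc (M.bmap K i ξ))) :
    TraceEq C k (fun _ => e) (fun _ => h) eh einc := by
  intro m _
  classical
  have e1 : (∑ K, ∑ i, if M.IsBdry (M.faceOf K i) then 0 else
        M.faceInt K i fun ξ => (M.normal K i ξ ⨯₃ hHat C K e h eh i ξ) ⬝ᵥ
          m (M.faceOf K i) (M.bmap K i ξ)) = 0 := by
    refine Eq.trans ?_ (Mesh.sum_interior_eq_zero (M := M) (fun n F x => (n ⨯₃ h x) ⬝ᵥ m F x)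
      (fun n F x => by rw [map_neg, LinearMap.neg_apply, neg_dotProduct]))
    refine Finset.sum_congr rfl fun K _ => Finset.sum_congr rfl fun i _ => ?_
    split_ifs with hb
    · rfl
    · refine Mesh.faceInt_congr fun ξ hξ => ?_
      rw [hHat_eq_tang C hξ (heh K i ξ hξ), cross_tang (M.normal_dotProduct_self K hξ)]
  have e2 : (∑ K, ∑ i, if M.IsBdry (M.faceOf K i) then
        M.faceInt K i fun ξ => (eh (M.faceOf K i) (M.bmap K i ξ) +
          tang (M.normal K i ξ) (einc (M.bmap K i ξ))) ⬝ᵥ m (M.faceOf K i) (M.bmap K i ξ)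
        else 0) = 0 := by
    refine Finset.sum_eq_zero fun K _ => Finset.sum_eq_zero fun i _ => ?_
    split_ifs with hb
    · rw [← Mesh.faceInt_zero (K := K) i]
      refine Mesh.faceInt_congr_interior fun ξ hξ => ?_
      rw [heh K i ξ (interior_subset hξ), hbc K i hb ξ hξ, neg_add_cancel, zero_dotProduct]
    · rfl
  exact (congrArg₂ (· + ·) e1 e2).trans (add_zero 0)

theorem scheme_of_isExact {k : ℕ} {T : ℝ} {j : ℝ → R3 → R3} {ρ : ℝ → R3 → ℝ}
    {einc : ℝ → R3 → R3} (hj : ContInL2 (volume.restrict Ω) T j)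
    (hρ : ContInL2 (volume.restrict Ω) T ρ) {e h : ℝ → R3 → R3} {φ : ℝ → R3 → ℝ}
    (hex : IsExact C T j ρ einc e h φ)
    (hφ : ∀ t ∈ Ioo 0 T, ∀ F, ∀ ξ ∈ M.shape.face, φ t (M.faceMap F ξ) = 0)
    {eh : ℝ → M.Face → R3 → R3}
    (heh : ∀ t ∈ Ioo 0 T, ∀ K i, ∀ ξ ∈ M.shape.face,
      eh t (M.faceOf K i) (M.bmap K i ξ) = tang (M.normal K i ξ) (e t (M.bmap K i ξ)))
    {t : ℝ} (ht : t ∈ Ioo 0 T) :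
    Scheme C k (fun _ => e t) (fun _ => h t) (fun _ => φ t)
      (fun _ x => deriv (fun s => e s x) t) (fun _ x => deriv (fun s => h s x) t)
      (fun _ x => deriv (fun s => φ s x) t) (eh t) (j t) (ρ t) (einc t) := by
  have htc := Ioo_subset_Icc_self ht
  refine ⟨fun K => ?_, traceEq_of_exact C (heh t ht) (hex.bc_e t ht)⟩
  refine localEqs_of_exact C ((hex.smooth_e t ht).c1On K) ((hex.smooth_h t ht).c1On K)
    ((hex.smooth_φ t ht).c1On K) (Mesh.integrableOn_elem_of_memLp (hj.1 t htc) K)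
    (Mesh.integrableOn_elem_of_memLp (hρ.1 t htc) K)
    (fun x hx => hex.ampere t ht x (M.subset K hx)) (fun x hx => hex.faraday t ht x (M.subset K hx))
    (fun x hx => hex.gauss t ht x (M.subset K hx)) (fun i ξ hξ => ?_) (heh t ht K)
  obtain ⟨η, hη, he⟩ := Mesh.exists_faceMap_eq (K := K) (i := i) hξ
  rw [he]
  exact hφ t ht _ η hη

/-! ### Polynomial functions -/

/-- Substituting polynomials of degree at most one does not raise the total degree. Hence traces of
element polynomials, and reparametrizations by affine symmetries, keep degree `k`. -/
theorem IsPolyOn.comp_affine {m n k : ℕ} {D : Set (Fin n → ℝ)} {D' : Set (Fin m → ℝ)}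
    {f : (Fin n → ℝ) → ℝ} (hf : IsPolyOn k D f) {A : (Fin m → ℝ) → Fin n → ℝ}
    (hA : ∀ i, IsPolyOn 1 univ fun x => A x i) (hm : MapsTo A D' D) :
    IsPolyOn k D' fun x => f (A x) := by
  obtain ⟨q, hq, he⟩ := hf
  choose a ha hae using hA
  refine ⟨MvPolynomial.bind₁ a q, ?_, fun x hx => ?_⟩
  · refine le_trans ?_ hq
    rw [MvPolynomial.bind₁, MvPolynomial.aeval_def, MvPolynomial.eval₂_eq]
    refine MvPolynomial.totalDegree_finsetSum_le fun d hd => ?_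
    refine (MvPolynomial.totalDegree_mul _ _).trans ?_
    rw [MvPolynomial.algebraMap_eq, MvPolynomial.totalDegree_C, zero_add]
    refine (MvPolynomial.totalDegree_finsetProd _ _).trans ?_
    refine le_trans ?_ (MvPolynomial.le_totalDegree hd)
    refine Finset.sum_le_sum fun i _ => (MvPolynomial.totalDegree_pow _ _).trans ?_
    exact (Nat.mul_le_mul_left _ (ha i)).trans (by simp)
  · have hx' : A x = fun i => MvPolynomial.eval x (a i) := funext fun i => hae i x trivial
    refine (he _ (hm hx)).trans ?_
    rw [hx']
    exact (MvPolynomial.eval₂Hom_bind₁ _ _ _ _).symm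

theorem IsPolyOn.add {n k : ℕ} {D : Set (Fin n → ℝ)} {f g : (Fin n → ℝ) → ℝ}
    (hf : IsPolyOn k D f) (hg : IsPolyOn k D g) : IsPolyOn k D fun x => f x + g x := by
  obtain ⟨q, hq, he⟩ := hf
  obtain ⟨r, hr, he'⟩ := hg
  exact ⟨q + r, (MvPolynomial.totalDegree_add _ _).trans (max_le hq hr),
    fun x hx => by simp only [map_add, he x hx, he' x hx]⟩

theorem IsPolyOn.const_mul {n k : ℕ} {D : Set (Fin n → ℝ)} {f : (Fin n → ℝ) → ℝ}
    (hf : IsPolyOn k D f) (c : ℝ) : IsPolyOn k D fun x => c * f x := by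
  obtain ⟨q, hq, he⟩ := hf
  exact ⟨c • q, (MvPolynomial.totalDegree_smul_le _ _).trans hq,
    fun x hx => by simp only [MvPolynomial.smul_eval, he x hx]⟩

theorem IsPolyOn.congr {n k : ℕ} {D : Set (Fin n → ℝ)} {f g : (Fin n → ℝ) → ℝ}
    (hf : IsPolyOn k D f) (h : ∀ x ∈ D, g x = f x) : IsPolyOn k D g := by
  obtain ⟨q, hq, he⟩ := hf
  exact ⟨q, hq, fun x hx => (h x hx).trans (he x hx)⟩

theorem isPolyOn_zero {n k : ℕ} {D : Set (Fin n → ℝ)} : IsPolyOn k D fun _ => 0 :=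
  ⟨0, by simp, by simp⟩

theorem isPolyOn_one_linear {m n : ℕ} (A : (Fin m → ℝ) →ₗ[ℝ] (Fin n → ℝ)) (b : Fin n → ℝ)
    (i : Fin n) : IsPolyOn 1 univ fun x => (A x + b) i := by
  refine ⟨∑ l, MvPolynomial.C (A (Pi.single l 1) i) * MvPolynomial.X l + MvPolynomial.C (b i), ?_,
    fun x _ => ?_⟩
  · refine (MvPolynomial.totalDegree_add _ _).trans (max_le ?_ (by simp))
    refine MvPolynomial.totalDegree_finsetSum_le fun l _ => ?_
    refine (MvPolynomial.totalDegree_mul _ _).trans ?_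
    simp
  · conv_lhs => rw [pi_eq_sum_univ' x]
    simp [Finset.sum_apply, mul_comm]

/-- A linear combination of the components of a polynomial vector field is polynomial. -/
theorem IsPolyOn.linear {n k : ℕ} {D : Set (Fin n → ℝ)} {v : (Fin n → ℝ) → R3}
    (hv : ∀ i, IsPolyOn k D fun x => v x i) (A : R3 →ₗ[ℝ] R3) (i : Fin 3) :
    IsPolyOn k D fun x => A (v x) i := by
  have h := (((hv 0).const_mul (A (Pi.single 0 1) i)).add
    ((hv 1).const_mul (A (Pi.single 1 1) i))).add ((hv 2).const_mul (A (Pi.single 2 1) i))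
  refine h.congr fun x _ => ?_
  conv_lhs => rw [pi_eq_sum_univ' (v x)]
  simp [Fin.sum_univ_three, mul_comm]

theorem isPolyOn_affineEquiv (σ : R2 ≃ᵃ[ℝ] R2) (i : Fin 2) : IsPolyOn 1 univ fun ξ => σ ξ i := by
  refine (isPolyOn_one_linear (σ.linear : R2 →ₗ[ℝ] R2) (σ 0) i).congr fun ξ _ => ?_
  have := σ.map_vadd 0 ξ
  simp only [vadd_eq_add, add_zero] at this
  rw [this]
  rfl

theorem AffineEquiv.mapsTo_symm {D : Set R2} {σ : R2 ≃ᵃ[ℝ] R2} (hσ : σ '' D = D) :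
    MapsTo σ.symm D D := by
  intro η hη
  rw [← hσ] at hη
  obtain ⟨ξ, hξ, rfl⟩ := hη
  simpa using hξ

namespace Mesh

variable {Ω : Set R3} {p : ℕ} {M : Mesh Ω p} {K : M.Elem}

theorem InW.isPolyOn_bmap {k : ℕ} {f : R3 → ℝ} (hf : M.InW k K f) (i : M.shape.Idx) :
    IsPolyOn k M.shape.face fun ξ => f (M.bmap K i ξ) := by
  refine IsPolyOn.comp_affine (A := M.shape.emb i) hf (fun l => ?_) fun ξ hξ =>
    M.shape.emb_mem_body i hξ
  refine (isPolyOn_one_linear (Matrix.toLin' (M.shape.embMat i)) (M.shape.emb i 0) l).congr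
    fun ξ _ => ?_
  rw [M.shape.emb_eq i ξ]
  simp

/-- Polynomials on a face in the parametrization from the element and in that of the face. -/
theorem isPolyOn_face_iff {k : ℕ} (K : M.Elem) (i : M.shape.Idx) (f : R3 → ℝ) :
    IsPolyOn k M.shape.face (fun ξ => f (M.bmap K i ξ)) ↔
      IsPolyOn k M.shape.face fun ξ => f (M.faceMap (M.faceOf K i) ξ) := by
  obtain ⟨σ, hσ, he⟩ := M.compat K i
  constructor
  · intro h
    refine (IsPolyOn.comp_affine (D' := M.shape.face) h (isPolyOn_affineEquiv σ.symm)
      (AffineEquiv.mapsTo_symm hσ)).congr fun η hη => ?_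
    rw [bmap, he _ (AffineEquiv.mapsTo_symm hσ hη), σ.apply_symm_apply]
  · intro h
    refine (IsPolyOn.comp_affine (D' := M.shape.face) h (isPolyOn_affineEquiv σ)
      (fun ξ hξ => hσ ▸ mem_image_of_mem σ hξ)).congr fun ξ hξ => ?_
    rw [bmap, he _ hξ]

theorem _root_.GLMHDG.IsPolyOn.continuousOn {n k : ℕ} {D : Set (Fin n → ℝ)}
    {f : (Fin n → ℝ) → ℝ} (hf : IsPolyOn k D f) : ContinuousOn f D := by
  obtain ⟨q, -, he⟩ := hf
  exact (MvPolynomial.continuous_eval q).continuousOn.congr he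

theorem InS.continuousOn_bmap {k : ℕ} {m : M.Face → R3 → R3} (hm : M.InS k m) (K : M.Elem)
    (i : M.shape.Idx) : ContinuousOn (fun ξ => m (M.faceOf K i) (M.bmap K i ξ)) M.shape.face :=
  continuousOn_pi.2 fun l =>
    ((isPolyOn_face_iff K i fun x => m (M.faceOf K i) x l).2 ((hm (M.faceOf K i)).1 l)).continuousOn

theorem InS.dotProduct_normal {k : ℕ} {m : M.Face → R3 → R3} (hm : M.InS k m) {K : M.Elem}
    {i : M.shape.Idx} {ξ : R2} (hξ : ξ ∈ M.shape.face) :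
    m (M.faceOf K i) (M.bmap K i ξ) ⬝ᵥ M.normal K i ξ = 0 := by
  obtain ⟨σ, hσ, hb, -, s, -, hn⟩ := exists_faceSign K i
  rw [hn ξ hξ, hb ξ hξ, unit, dotProduct_smul, dotProduct_smul,
    (hm (M.faceOf K i)).2 (σ ξ) (hσ ▸ mem_image_of_mem σ hξ)]
  simp

/-- The space `S_h` imposes no continuity between faces, so a field on one face extended by zero is
a legitimate test function. Its polynomial degree and its tangency may be checked in the
parametrization coming from the element. -/
theorem InS.of_dotProduct_normal {k : ℕ} {K : M.Elem} {i : M.shape.Idx} {m : R3 → R3}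
    (hp : ∀ l, IsPolyOn k M.shape.face fun ξ => m (M.bmap K i ξ) l)
    (hn : ∀ ξ ∈ M.shape.face, m (M.bmap K i ξ) ⬝ᵥ M.normal K i ξ = 0) [DecidableEq M.Face] :
    M.InS k (Function.update (fun _ _ => 0) (M.faceOf K i) m) := by
  intro F
  rcases eq_or_ne F (M.faceOf K i) with rfl | hF
  · simp only [Function.update_self]
    refine ⟨fun l => (isPolyOn_face_iff K i fun x => m x l).1 (hp l), fun η hη => ?_⟩
    obtain ⟨σ, hσ, hb, -, s, hs, hnn⟩ := exists_faceSign K i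
    obtain ⟨ξ, hξ, rfl⟩ : η ∈ σ '' M.shape.face := by rwa [hσ]
    set N := paramNormal (M.faceMap (M.faceOf K i)) (σ ξ)
    have hN : N = (Real.sqrt (N ⬝ᵥ N) * s) • M.normal K i ξ := by
      rw [hnn ξ hξ, smul_smul, mul_assoc, ← abs_mul_abs_self s, hs, mul_one, mul_one, sqrt_smul_unit]
    rw [← hb ξ hξ, hN, dotProduct_smul, hn ξ hξ, smul_zero]
  · simp only [Function.update_of_ne hF]
    exact ⟨fun l => isPolyOn_zero, fun ξ _ => zero_dotProduct _⟩

/-! ### Linearity of surface integrals -/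

theorem integrableOn_mul_areaElem {i : M.shape.Idx} {f : R2 → ℝ} (hf : IntegrableOn f M.shape.face) :
    IntegrableOn (fun ξ => f ξ * areaElem (M.bmap K i) ξ) M.shape.face :=
  hf.mul_continuousOn (M.continuous_areaElem K i).continuousOn M.shape.isCompact_face

theorem faceInt_add {i : M.shape.Idx} {f g : R2 → ℝ} (hf : IntegrableOn f M.shape.face)
    (hg : IntegrableOn g M.shape.face) :
    M.faceInt K i (fun ξ => f ξ + g ξ) = M.faceInt K i f + M.faceInt K i g := by
  simp only [faceInt, add_mul]
  exact integral_add (integrableOn_mul_areaElem hf) (integrableOn_mul_areaElem hg)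

theorem faceInt_const_mul {i : M.shape.Idx} (c : ℝ) (f : R2 → ℝ) :
    M.faceInt K i (fun ξ => c * f ξ) = c * M.faceInt K i f := by
  simp only [faceInt, mul_assoc, integral_const_mul]

theorem faceInt_sub {i : M.shape.Idx} {f g : R2 → ℝ} (hf : IntegrableOn f M.shape.face)
    (hg : IntegrableOn g M.shape.face) :
    M.faceInt K i (fun ξ => f ξ - g ξ) = M.faceInt K i f - M.faceInt K i g := by
  simp only [faceInt, sub_mul]
  exact integral_sub (integrableOn_mul_areaElem hf) (integrableOn_mul_areaElem hg)

end Mesh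

/-! ### Continuity of vector products -/

theorem continuousOn_dotProduct {α : Type*} [TopologicalSpace α] {D : Set α} {a b : α → R3}
    (ha : ContinuousOn a D) (hb : ContinuousOn b D) : ContinuousOn (fun x => a x ⬝ᵥ b x) D := by
  simp only [dotProduct]
  exact continuousOn_finsetSum _ fun i _ =>
    ((continuous_apply i).comp_continuousOn ha).mul ((continuous_apply i).comp_continuousOn hb)

theorem continuousOn_cross {α : Type*} [TopologicalSpace α] {D : Set α} {a b : α → R3}
    (ha : ContinuousOn a D) (hb : ContinuousOn b D) : ContinuousOn (fun x => a x ⨯₃ b x) D := by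
  have ha' : ∀ i, ContinuousOn (fun x => a x i) D := fun i =>
    (continuous_apply i).comp_continuousOn ha
  have hb' : ∀ i, ContinuousOn (fun x => b x i) D := fun i =>
    (continuous_apply i).comp_continuousOn hb
  refine continuousOn_pi.2 fun i => ?_
  fin_cases i <;> simp only [cross_apply] <;> exact ((ha' _).mul (hb' _)).sub ((ha' _).mul (hb' _))

theorem continuousOn_tang {α : Type*} [TopologicalSpace α] {D : Set α} {n a : α → R3}
    (hn : ContinuousOn n D) (ha : ContinuousOn a D) : ContinuousOn (fun x => tang (n x) (a x)) D :=
  continuousOn_cross (continuousOn_cross hn ha) hn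

/-! ### Energy balance at one instant -/

variable {Ω : Set R3} {p : ℕ} {M : Mesh Ω p} (C : Coeff M)

namespace Mesh

variable {K : M.Elem}

theorem bdInt_sub {f g : M.shape.Idx → R2 → ℝ} (hf : ∀ i, ContinuousOn (f i) M.shape.face)
    (hg : ∀ i, ContinuousOn (g i) M.shape.face) :
    M.bdInt K (fun i ξ => f i ξ - g i ξ) = M.bdInt K f - M.bdInt K g := by
  simp only [bdInt, ← Finset.sum_sub_distrib]
  exact Finset.sum_congr rfl fun i _ => faceInt_sub
    ((hf i).integrableOn_compact M.shape.isCompact_face)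
    ((hg i).integrableOn_compact M.shape.isCompact_face)

end Mesh

theorem continuousOn_hHat {K : M.Elem} {e h : R3 → R3} {eh : M.Face → R3 → R3} {i : M.shape.Idx}
    (he : ContinuousOn (fun ξ => e (M.bmap K i ξ)) M.shape.face)
    (hh : ContinuousOn (fun ξ => h (M.bmap K i ξ)) M.shape.face)
    (heh : ContinuousOn (fun ξ => eh (M.faceOf K i) (M.bmap K i ξ)) M.shape.face) :
    ContinuousOn (hHat C K e h eh i) M.shape.face :=
  (continuousOn_tang (M.continuousOn_normal K i) hh).fun_sub
    (continuousOn_const.fun_smul (continuousOn_cross (he.fun_sub heh) (M.continuousOn_normal K i)))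

/-- The rate of change of the energy in `K`. -/
def localRate (K : M.Elem) (et ht : R3 → R3) (φt : R3 → ℝ) (e h : R3 → R3) (φ : R3 → ℝ) : ℝ :=
  (∫ x in M.elem K, C.ε x * (et x ⬝ᵥ e x)) + (∫ x in M.elem K, C.μ x * (ht x ⬝ᵥ h x))
    + 1 / C.α₁ ^ 2 * ∫ x in M.elem K, φt x * φ x

variable {C}

/-- The equations are tested with the solution and added. The two terms with `(φ, div e)` cancel,
and `(e, curl h)` and `(h, curl e)` differ by a boundary integral, the last term on the right. -/
theorem LocalEqs.rate_add {k : ℕ} {K : M.Elem} {e h : R3 → R3} {φ : R3 → ℝ} {et ht : R3 → R3}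
    {φt : R3 → ℝ} {eh : M.Face → R3 → R3} {j : R3 → R3} {ρ : R3 → ℝ}
    (hL : LocalEqs C k K e h φ et ht φt eh j ρ) (he : M.InV k K e) (hh : M.InV k K h)
    (hφ : M.InW k K φ)
    (heh : ∀ i, ContinuousOn (fun ξ => eh (M.faceOf K i) (M.bmap K i ξ)) M.shape.face) :
    localRate C K et ht φt e h φ + phiDissip C K φ
      = - (∫ x in M.elem K, j x ⬝ᵥ e x) + (∫ x in M.elem K, ρ x / C.ε₀ * φ x)
        + M.bdInt K fun i ξ => hHat C K e h eh i ξ ⬝ᵥ (e (M.bmap K i ξ) ⨯₃ M.normal K i ξ)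
          - eh (M.faceOf K i) (M.bmap K i ξ) ⬝ᵥ (h (M.bmap K i ξ) ⨯₃ M.normal K i ξ)
          - h (M.bmap K i ξ) ⬝ᵥ (e (M.bmap K i ξ) ⨯₃ M.normal K i ξ) := by
  have e1 := hL.1 e he
  have e2 := hL.2.1 h hh
  have e3 := hL.2.2 φ hφ
  have e4 := Mesh.integral_curl_sub hh.c1On he.c1On
  have hec := he.c1On.continuousOn_bmap
  have hhc := hh.c1On.continuousOn_bmap
  have hn := M.continuousOn_normal K
  have c1 := fun i => continuousOn_dotProduct (continuousOn_hHat C (hec i) (hhc i) (heh i))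
    (continuousOn_cross (hec i) (hn i))
  have c2 := fun i => continuousOn_dotProduct (heh i) (continuousOn_cross (hhc i) (hn i))
  have c3 := fun i => continuousOn_dotProduct (hhc i) (continuousOn_cross (hec i) (hn i))
  have e5 : ∫ x in M.elem K, e x ⬝ᵥ curl h x = ∫ x in M.elem K, curl h x ⬝ᵥ e x :=
    integral_congr_ae (Eventually.of_forall fun x => dotProduct_comm _ _)
  have e6 : ∫ x in M.elem K, div e x * φ x = ∫ x in M.elem K, φ x * div e x :=
    integral_congr_ae (Eventually.of_forall fun x => mul_comm _ _)
  rw [Mesh.bdInt_sub (fun i => (c1 i).fun_sub (c2 i)) c3, Mesh.bdInt_sub c1 c2, localRate, phiDissip]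
  rw [e5] at e2
  rw [e6] at e3
  linarith

/-- On the boundary `(ĥ - h) · (e × n) = -τ ((e - ê) × n) · (e × n)`. The part with `e` is
dissipation and the part with `ê` is moved to the source. -/
theorem LocalEqs.local_energy {k : ℕ} {K : M.Elem} {e h : R3 → R3} {φ : R3 → ℝ} {et ht : R3 → R3}
    {φt : R3 → ℝ} {eh : M.Face → R3 → R3} {j : R3 → R3} {ρ : R3 → ℝ}
    (hL : LocalEqs C k K e h φ et ht φt eh j ρ) (he : M.InV k K e) (hh : M.InV k K h)
    (hφ : M.InW k K φ)
    (heh : ∀ i, ContinuousOn (fun ξ => eh (M.faceOf K i) (M.bmap K i ξ)) M.shape.face) :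
    localRate C K et ht φt e h φ + localDissip C K e φ = localSource C K e h φ eh j ρ := by
  have h1 := hL.rate_add he hh hφ heh
  have hec := he.c1On.continuousOn_bmap
  have hhc := hh.c1On.continuousOn_bmap
  have hn := M.continuousOn_normal K
  have c1 := fun i => (continuousOn_dotProduct (continuousOn_cross (heh i) (hn i))
    (continuousOn_cross (hec i) (hn i))).const_mul (C.τ K i)
  have c2 := fun i => continuousOn_dotProduct (heh i) (continuousOn_cross (hhc i) (hn i))
  have c3 := fun i => (continuousOn_dotProduct (continuousOn_cross (hec i) (hn i))
    (continuousOn_cross (hec i) (hn i))).const_mul (C.τ K i)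
  have h2 := Mesh.bdInt_sub (K := K) (fun i => (c1 i).fun_sub (c2 i)) c3
  rw [Mesh.bdInt_sub c1 c2] at h2
  rw [localDissip, localSource, tauForm, tauForm, ← add_assoc, h1,
    Mesh.bdInt_congr (g := fun i ξ => C.τ K i *
      ((eh (M.faceOf K i) (M.bmap K i ξ) ⨯₃ M.normal K i ξ) ⬝ᵥ (e (M.bmap K i ξ) ⨯₃ M.normal K i ξ))
      - eh (M.faceOf K i) (M.bmap K i ξ) ⬝ᵥ (h (M.bmap K i ξ) ⨯₃ M.normal K i ξ)
      - C.τ K i * ((e (M.bmap K i ξ) ⨯₃ M.normal K i ξ) ⬝ᵥ (e (M.bmap K i ξ) ⨯₃ M.normal K i ξ))),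
    h2]
  · ring
  · intro i ξ hξ
    rw [hHat, sub_dotProduct, tang_dotProduct_cross (M.normal_dotProduct_self K hξ),
      smul_dotProduct, map_sub, LinearMap.sub_apply, sub_dotProduct, smul_eq_mul]
    ring

/-- The same boundary integrand, now with the square of `(e - ê) × n` completed. What remains is
exactly `(n × ĥ) · ê`, the quantity that the trace equation controls. -/
theorem LocalEqs.trace_energy {k : ℕ} {K : M.Elem} {e h : R3 → R3} {φ : R3 → ℝ} {et ht : R3 → R3}
    {φt : R3 → ℝ} {eh : M.Face → R3 → R3} {j : R3 → R3} {ρ : R3 → ℝ}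
    (hL : LocalEqs C k K e h φ et ht φt eh j ρ) (he : M.InV k K e) (hh : M.InV k K h)
    (hφ : M.InW k K φ)
    (heh : ∀ i, ContinuousOn (fun ξ => eh (M.faceOf K i) (M.bmap K i ξ)) M.shape.face) :
    localRate C K et ht φt e h φ + (phiDissip C K φ +
        tauForm C K (fun i ξ => e (M.bmap K i ξ) - eh (M.faceOf K i) (M.bmap K i ξ))
          (fun i ξ => e (M.bmap K i ξ) - eh (M.faceOf K i) (M.bmap K i ξ)))
      = - (∫ x in M.elem K, j x ⬝ᵥ e x) + (∫ x in M.elem K, ρ x / C.ε₀ * φ x)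
        + M.bdInt K fun i ξ => (M.normal K i ξ ⨯₃ hHat C K e h eh i ξ) ⬝ᵥ
            eh (M.faceOf K i) (M.bmap K i ξ) := by
  have h1 := hL.rate_add he hh hφ heh
  have hec := he.c1On.continuousOn_bmap
  have hhc := hh.c1On.continuousOn_bmap
  have hn := M.continuousOn_normal K
  have c1 := fun i => continuousOn_dotProduct
    (continuousOn_cross (hn i) (continuousOn_hHat C (hec i) (hhc i) (heh i))) (heh i)
  have hd := fun i => continuousOn_cross ((hec i).fun_sub (heh i)) (hn i)
  have c2 := fun i => (continuousOn_dotProduct (hd i) (hd i)).const_mul (C.τ K i)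
  have h2 := Mesh.bdInt_sub (K := K) c1 c2
  rw [tauForm, ← add_assoc, h1,
    Mesh.bdInt_congr (g := fun i ξ => (M.normal K i ξ ⨯₃ hHat C K e h eh i ξ) ⬝ᵥ
        eh (M.faceOf K i) (M.bmap K i ξ)
      - C.τ K i * (((e (M.bmap K i ξ) - eh (M.faceOf K i) (M.bmap K i ξ)) ⨯₃ M.normal K i ξ) ⬝ᵥ
        ((e (M.bmap K i ξ) - eh (M.faceOf K i) (M.bmap K i ξ)) ⨯₃ M.normal K i ξ)))]
  · rw [h2]
    ring
  · intro i ξ hξ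
    have hnn := M.normal_dotProduct_self K (i := i) hξ
    set n := M.normal K i ξ
    set a := e (M.bmap K i ξ)
    set b := eh (M.faceOf K i) (M.bmap K i ξ)
    set c := h (M.bmap K i ξ)
    have t1 : (n ⨯₃ hHat C K e h eh i ξ) ⬝ᵥ b
        = - (b ⬝ᵥ (c ⨯₃ n)) - C.τ K i * (((a - b) ⨯₃ n) ⬝ᵥ (b ⨯₃ n)) := by
      have : ∀ w : R3, (n ⨯₃ w) ⬝ᵥ b = w ⬝ᵥ (b ⨯₃ n) := fun w => by
        rw [dotProduct_comm, triple_product_permutation, triple_product_permutation]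
      have h3 : c ⬝ᵥ (b ⨯₃ n) = - (b ⬝ᵥ (c ⨯₃ n)) := by
        rw [triple_product_permutation, ← cross_anticomm, dotProduct_neg]
      rw [this, hHat, sub_dotProduct, tang_dotProduct_cross hnn, smul_dotProduct, smul_eq_mul, h3]
    have t2 : hHat C K e h eh i ξ ⬝ᵥ (a ⨯₃ n)
        = c ⬝ᵥ (a ⨯₃ n) - C.τ K i * (((a - b) ⨯₃ n) ⬝ᵥ (a ⨯₃ n)) := by
      rw [hHat, sub_dotProduct, tang_dotProduct_cross hnn, smul_dotProduct, smul_eq_mul]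
    have t3 : ((a - b) ⨯₃ n) ⬝ᵥ ((a - b) ⨯₃ n)
        = ((a - b) ⨯₃ n) ⬝ᵥ (a ⨯₃ n) - ((a - b) ⨯₃ n) ⬝ᵥ (b ⨯₃ n) := by
      conv_lhs => rw [map_sub, LinearMap.sub_apply, dotProduct_sub]
      rw [map_sub, LinearMap.sub_apply]
    rw [t1, t2, t3]
    ring

/-! ### The trace equation -/

open Classical in
-- A boundary face belongs to exactly one element, so a test function supported on it reduces the
-- whole trace equation to a single surface integral.
theorem TraceEq.faceInt_bdry (hΩ : IsOpen Ω) {k : ℕ} {e h : M.Elem → R3 → R3}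
    {eh : M.Face → R3 → R3} {einc : R3 → R3} (hT : TraceEq C k e h eh einc) {K : M.Elem}
    {i : M.shape.Idx} (hb : M.IsBdry (M.faceOf K i)) {m : R3 → R3}
    (hm : M.InS k (Function.update (fun _ _ => 0) (M.faceOf K i) m)) :
    M.faceInt K i (fun ξ => (eh (M.faceOf K i) (M.bmap K i ξ) +
      tang (M.normal K i ξ) (einc (M.bmap K i ξ))) ⬝ᵥ m (M.bmap K i ξ)) = 0 := by
  have h1 := hT _ hm
  obtain ⟨-, r, hr, huniq⟩ | ⟨hin, -⟩ := M.conform (M.faceOf K i)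
  swap
  · exact absurd hb (Mesh.not_isBdry_of_image_subset hΩ hin)
  have hKi : ∀ K' i', M.faceOf K' i' = M.faceOf K i → K' = K ∧ i' = i := fun K' i' h' => by
    have a := huniq (K', i') h'
    have b := huniq (K, i) rfl
    have := a.trans b.symm
    exact ⟨congrArg Prod.fst this, congrArg Prod.snd this⟩
  have hzero : ∀ K' i', M.faceOf K' i' ≠ M.faceOf K i →
      Function.update (fun (_ : M.Face) (_ : R3) => (0 : R3)) (M.faceOf K i) m (M.faceOf K' i')
        = fun _ => 0 := fun K' i' h' => Function.update_of_ne h' _ _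
  have e1 : (∑ K', ∑ i', if M.IsBdry (M.faceOf K' i') then 0 else
        M.faceInt K' i' fun ξ => (M.normal K' i' ξ ⨯₃ hHat C K' (e K') (h K') eh i' ξ) ⬝ᵥ
          Function.update (fun _ _ => 0) (M.faceOf K i) m (M.faceOf K' i') (M.bmap K' i' ξ)) = 0 := by
    refine Finset.sum_eq_zero fun K' _ => Finset.sum_eq_zero fun i' _ => ?_
    split_ifs with hb'
    · rfl
    · rw [hzero K' i' fun h' => hb' (h' ▸ hb)]
      simp [Mesh.faceInt_zero]
  rw [e1, zero_add, Finset.sum_eq_single K, Finset.sum_eq_single i, if_pos hb] at h1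
  · simpa using h1
  · intro i' _ hi'
    rw [hzero K i' fun h' => hi' (hKi K i' h').2]
    simp [Mesh.faceInt_zero]
  · simp
  · intro K' _ hK'
    refine Finset.sum_eq_zero fun i' _ => ?_
    rw [hzero K' i' fun h' => hK' (hKi K' i' h').1]
    simp [Mesh.faceInt_zero]
  · simp

open Classical in
/-- The interior part of the trace equation, tested with the numerical trace itself. -/
theorem TraceEq.sum_interior {k : ℕ} {e h : M.Elem → R3 → R3} {eh : M.Face → R3 → R3}
    {einc : R3 → R3} (hT : TraceEq C k e h eh einc) (heh : M.InS k eh) :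
    (∑ K, ∑ i, if M.IsBdry (M.faceOf K i) then 0 else
        M.faceInt K i fun ξ => (M.normal K i ξ ⨯₃ hHat C K (e K) (h K) eh i ξ) ⬝ᵥ
          eh (M.faceOf K i) (M.bmap K i ξ)) = 0 := by
  set m : M.Face → R3 → R3 := fun F => if M.IsBdry F then fun _ => 0 else eh F with hm
  have hmS : M.InS k m := fun F => by
    simp only [hm]
    split_ifs
    · exact ⟨fun i => isPolyOn_zero, fun ξ _ => zero_dotProduct _⟩
    · exact heh F
  have h1 := hT m hmS
  have e2 : (∑ K, ∑ i, if M.IsBdry (M.faceOf K i) then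
        M.faceInt K i fun ξ => (eh (M.faceOf K i) (M.bmap K i ξ) +
          tang (M.normal K i ξ) (einc (M.bmap K i ξ))) ⬝ᵥ m (M.faceOf K i) (M.bmap K i ξ)
        else 0) = 0 := by
    refine Finset.sum_eq_zero fun K _ => Finset.sum_eq_zero fun i _ => ?_
    split_ifs with hb
    · simp [hm, hb, Mesh.faceInt_zero]
    · rfl
  rw [e2, add_zero] at h1
  refine Eq.trans ?_ h1
  refine Finset.sum_congr rfl fun K _ => Finset.sum_congr rfl fun i _ => ?_
  by_cases hb : M.IsBdry (M.faceOf K i)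
  · simp only [if_pos hb]
  · simp only [if_neg hb, hm]

/-! ### The energy rate -/

namespace Mesh

variable {Ω : Set R3} {p : ℕ} {M : Mesh Ω p} {K : M.Elem} {i : M.shape.Idx}

/-- The unit normal of a planar face is constant. -/
theorem exists_normal_eq_const (hF : M.IsPlanar (M.faceOf K i)) :
    ∃ n₀ : R3, ∀ ξ ∈ M.shape.face, M.normal K i ξ = n₀ := by
  obtain ⟨c, d, hc, hcd⟩ := hF
  have hcd' : ∀ ξ ∈ M.shape.face, c ⬝ᵥ M.bmap K i ξ = d := fun ξ hξ => by
    obtain ⟨η, hη, he⟩ := exists_faceMap_eq (K := K) (i := i) hξ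
    rw [he, hcd η hη]
  have hsm : ContDiff ℝ 1 (M.bmap K i) := M.contDiff_bmap K i
  let ℓ : R3 →L[ℝ] ℝ := LinearMap.toContinuousLinearMap (dotProductBilin ℝ ℝ c)
  have hℓ : ∀ x, ℓ x = c ⬝ᵥ x := fun x => rfl
  have hder : ∀ v, ∀ ξ ∈ M.shape.face, c ⬝ᵥ fderiv ℝ (M.bmap K i) ξ v = 0 := by
    intro v
    have hcl : IsClosed {ξ | c ⬝ᵥ fderiv ℝ (M.bmap K i) ξ v = 0} := by
      refine isClosed_eq ?_ continuous_const
      exact ℓ.continuous.comp ((hsm.continuous_fderiv one_ne_zero).clm_apply continuous_const)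
    have hin : ∀ ξ ∈ interior M.shape.face, c ⬝ᵥ fderiv ℝ (M.bmap K i) ξ v = 0 := by
      intro ξ hξ
      have h1 : HasFDerivAt (fun η => ℓ (M.bmap K i η)) (ℓ.comp (fderiv ℝ (M.bmap K i) ξ)) ξ :=
        ℓ.hasFDerivAt.comp ξ (hsm.differentiable one_ne_zero ξ).hasFDerivAt
      have h2 : (fun η => ℓ (M.bmap K i η)) =ᶠ[𝓝 ξ] fun _ => d := by
        filter_upwards [isOpen_interior.mem_nhds hξ] with η hη using hcd' η (interior_subset hη)
      have h3 := h1.unique ((hasFDerivAt_const d ξ).congr_of_eventuallyEq h2)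
      exact congrArg (fun L : R2 →L[ℝ] ℝ => L v) h3
    exact fun ξ hξ => closure_minimal hin hcl (M.shape.subset_closure_interior_face hξ)
  -- The tangent vectors are orthogonal to `c`, hence `c × n = 0`, and expanding `c × (c × n)` shows
  -- that `n` is parallel to `c`.
  have hcn : ∀ ξ ∈ M.shape.face, (c ⬝ᵥ c) • M.normal K i ξ = (c ⬝ᵥ M.normal K i ξ) • c := by
    intro ξ hξ
    obtain ⟨s, hs, h⟩ := M.exists_sign_paramNormal K i
    obtain ⟨h1, -, h3⟩ := h ξ hξ
    have hs0 : s ≠ 0 := by rintro rfl; simp at hs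
    have h4 : c ⨯₃ paramNormal (M.bmap K i) ξ = 0 := by
      rw [paramNormal, cross_cross_eq_smul_sub_smul', dotProduct_comm _ c, hder _ ξ hξ, hder _ ξ hξ,
        zero_smul, zero_smul, sub_zero]
    have h5 := cross_cross_eq_smul_sub_smul' c c (M.normal K i ξ)
    have h6 : c ⨯₃ M.normal K i ξ = 0 := by
      rw [h1, map_smul] at h4
      exact (smul_eq_zero.1 h4).resolve_left (mul_ne_zero hs0 h3.ne')
    rw [h6, map_zero] at h5
    exact (sub_eq_zero.1 h5.symm).symm
  have hcc := dotProduct_self_pos hc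
  have hsq : ∀ ξ ∈ M.shape.face, (c ⬝ᵥ M.normal K i ξ) ^ 2 = Real.sqrt (c ⬝ᵥ c) ^ 2 := by
    intro ξ hξ
    have h1 := congrArg (fun a => a ⬝ᵥ M.normal K i ξ) (hcn ξ hξ)
    simp only [smul_dotProduct, M.normal_dotProduct_self K hξ, smul_eq_mul] at h1
    rw [Real.sq_sqrt hcc.le, sq]
    linarith
  have hcont : ContinuousOn (fun ξ => c ⬝ᵥ M.normal K i ξ) M.shape.face :=
    ℓ.continuous.comp_continuousOn (M.continuousOn_normal K i)
  have hn : ∀ ξ ∈ M.shape.face, M.normal K i ξ = ((c ⬝ᵥ M.normal K i ξ) / (c ⬝ᵥ c)) • c := by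
    intro ξ hξ
    rw [div_eq_inv_mul, mul_smul, ← hcn ξ hξ, smul_smul, inv_mul_cancel₀ hcc.ne', one_smul]
  -- The function `c · n` is continuous with constant nonzero square, so it cannot change sign on
  -- the connected face.
  rcases M.shape.convex_face.isPreconnected.eq_or_eq_neg_of_sq_eq hcont
    (g := fun _ => Real.sqrt (c ⬝ᵥ c)) continuousOn_const hsq
    (fun _ => (Real.sqrt_pos.2 hcc).ne') with h | h
  · exact ⟨_, fun ξ hξ => (hn ξ hξ).trans (congrArg (fun r => (r / (c ⬝ᵥ c)) • c) (h hξ))⟩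
  · exact ⟨_, fun ξ hξ => (hn ξ hξ).trans (congrArg (fun r => (r / (c ⬝ᵥ c)) • c) (h hξ))⟩

end Mesh

variable {Ω : Set R3} {p : ℕ} {M : Mesh Ω p} {C : Coeff M}

/-- With a constant normal `n₀`, the field `n × ĥ` is a constant linear combination of the
components of `e`, `h` and `ê`. It is therefore polynomial of degree `k` and tangential, and may be
used as test function. On a curved face the varying normal destroys this argument. -/
theorem TraceEq.faceInt_of_planar (hΩ : IsOpen Ω) {k : ℕ} {e h : M.Elem → R3 → R3}
    {eh : M.Face → R3 → R3} {einc : R3 → R3} (hT : TraceEq C k e h eh einc) {K : M.Elem}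
    {i : M.shape.Idx} (hb : M.IsBdry (M.faceOf K i)) (he : M.InV k K (e K)) (hh : M.InV k K (h K))
    (heh : M.InS k eh) (hp : M.IsPlanar (M.faceOf K i)) :
    M.faceInt K i (fun ξ => (eh (M.faceOf K i) (M.bmap K i ξ) +
      tang (M.normal K i ξ) (einc (M.bmap K i ξ))) ⬝ᵥ
        (M.normal K i ξ ⨯₃ hHat C K (e K) (h K) eh i ξ)) = 0 := by
  classical
  obtain ⟨n₀, hn₀⟩ := Mesh.exists_normal_eq_const hp
  let L := crossProduct n₀
  let m : R3 → R3 := fun x => n₀ ⨯₃ (tang n₀ (h K x) -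
    C.τ K i • ((e K x - eh (M.faceOf K i) x) ⨯₃ n₀))
  have hm : ∀ ξ ∈ M.shape.face,
      m (M.bmap K i ξ) = M.normal K i ξ ⨯₃ hHat C K (e K) (h K) eh i ξ := fun ξ hξ => by
    simp only [m, hHat, hn₀ ξ hξ]
  have hhp := fun l => (hh l).isPolyOn_bmap i
  have hep := fun l => (he l).isPolyOn_bmap i
  have hsp := fun l => (Mesh.isPolyOn_face_iff K i fun x => eh (M.faceOf K i) x l).2
    ((heh (M.faceOf K i)).1 l)
  have hS : M.InS k (Function.update (fun _ _ => 0) (M.faceOf K i) m) := by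
    refine Mesh.InS.of_dotProduct_normal (fun l => ?_) fun ξ hξ => ?_
    · let X : R3 →ₗ[ℝ] R3 := crossProduct n₀
      have h1 := IsPolyOn.linear (v := fun ξ => h K (M.bmap K i ξ)) hhp
        (X ∘ₗ (-X) ∘ₗ X) l
      have h2 := IsPolyOn.linear (v := fun ξ => e K (M.bmap K i ξ)) hep (X ∘ₗ X) l
      have h3 := IsPolyOn.linear (v := fun ξ => eh (M.faceOf K i) (M.bmap K i ξ)) hsp (X ∘ₗ X) l
      refine ((h1.add (h2.const_mul (C.τ K i))).add (h3.const_mul (-C.τ K i))).congr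
        fun ξ _ => ?_
      have t1 : tang n₀ (h K (M.bmap K i ξ)) = - X (X (h K (M.bmap K i ξ))) := by
        rw [tang, ← cross_anticomm]
      have t2 : ∀ a : R3, a ⨯₃ n₀ = - X a := fun a => by rw [← cross_anticomm]
      simp only [m, t1, t2]
      change X _ l = _
      simp only [map_sub, map_smul, map_neg, LinearMap.comp_apply, LinearMap.neg_apply,
        Pi.sub_apply, Pi.smul_apply, Pi.neg_apply, smul_eq_mul]
      ring
    · rw [hm ξ hξ, dotProduct_comm, dot_self_cross]
  rw [← hT.faceInt_bdry hΩ hb hS]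
  exact Mesh.faceInt_congr fun ξ hξ => by rw [hm ξ hξ]

/-- Here `ê + n × e^inc × n` is itself a discrete tangential field on the face. Tested with itself
it vanishes almost everywhere, and then its product with any `g` integrates to zero. -/
theorem TraceEq.faceInt_of_mem (hΩ : IsOpen Ω) {k : ℕ} {e h : M.Elem → R3 → R3}
    {eh : M.Face → R3 → R3} {einc : R3 → R3} (hT : TraceEq C k e h eh einc) {K : M.Elem}
    {i : M.shape.Idx} (hb : M.IsBdry (M.faceOf K i)) (heh : M.InS k eh) {m : M.Face → R3 → R3}
    (hm : M.InS k m) (hme : ∀ ξ ∈ M.shape.face,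
      tang (M.normal K i ξ) (einc (M.bmap K i ξ)) = m (M.faceOf K i) (M.bmap K i ξ))
    (g : R2 → R3) :
    M.faceInt K i (fun ξ => (eh (M.faceOf K i) (M.bmap K i ξ) +
      tang (M.normal K i ξ) (einc (M.bmap K i ξ))) ⬝ᵥ g ξ) = 0 := by
  classical
  let w : R3 → R3 := fun x => eh (M.faceOf K i) x + m (M.faceOf K i) x
  have hw : ∀ ξ ∈ M.shape.face, eh (M.faceOf K i) (M.bmap K i ξ) +
      tang (M.normal K i ξ) (einc (M.bmap K i ξ)) = w (M.bmap K i ξ) := fun ξ hξ => by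
    rw [hme ξ hξ]
  have hS : M.InS k (Function.update (fun _ _ => 0) (M.faceOf K i) w) := by
    refine Mesh.InS.of_dotProduct_normal (fun l => ?_) fun ξ hξ => ?_
    · exact ((Mesh.isPolyOn_face_iff K i fun x => eh (M.faceOf K i) x l).2
        ((heh (M.faceOf K i)).1 l)).add ((Mesh.isPolyOn_face_iff K i
          fun x => m (M.faceOf K i) x l).2 ((hm (M.faceOf K i)).1 l))
    · rw [add_dotProduct, heh.dotProduct_normal hξ, hm.dotProduct_normal hξ, add_zero]
  have h0 := hT.faceInt_bdry hΩ hb hS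
  rw [Mesh.faceInt_congr (g := fun ξ => w (M.bmap K i ξ) ⬝ᵥ w (M.bmap K i ξ))
    fun ξ hξ => by rw [hw ξ hξ], Mesh.faceInt] at h0
  have hwc : ContinuousOn (fun ξ => w (M.bmap K i ξ)) M.shape.face :=
    (heh.continuousOn_bmap K i).fun_add (hm.continuousOn_bmap K i)
  rw [setIntegral_eq_zero_iff_of_nonneg_ae] at h0
  · rw [← Mesh.faceInt_zero (K := K) i]
    refine integral_congr_ae ?_
    filter_upwards [h0, ae_restrict_mem M.shape.measurableSet_face] with ξ h1 hξ
    have h2 : w (M.bmap K i ξ) ⬝ᵥ w (M.bmap K i ξ) = 0 :=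
      (mul_eq_zero.1 h1).resolve_right (M.areaElem_pos K hξ).ne'
    rw [hw ξ hξ, dotProduct_self_eq_zero.1 h2, zero_dotProduct]
  · exact (ae_restrict_mem M.shape.measurableSet_face).mono fun ξ hξ =>
      mul_nonneg (dotProduct_self_star_nonneg _) (M.areaElem_pos K hξ).le
  · exact Mesh.integrableOn_mul_areaElem
      ((continuousOn_dotProduct hwc hwc).integrableOn_compact M.shape.isCompact_face)

theorem integrableOn_dotProduct_tang {K : M.Elem} {i : M.shape.Idx} {a g : R2 → R3}
    (ha : ContinuousOn a M.shape.face) (hg : IntegrableOn g M.shape.face) :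
    IntegrableOn (fun ξ => a ξ ⬝ᵥ tang (M.normal K i ξ) (g ξ)) M.shape.face := by
  -- The map `tang n` is symmetric. Moving it to the continuous factor leaves the merely integrable
  -- `g` untouched.
  have h1 : ∀ n a g : R3, a ⬝ᵥ tang n g = g ⬝ᵥ tang n a := fun n a g => by
    rw [tang_eq, tang_eq, dotProduct_sub, dotProduct_sub, dotProduct_smul, dotProduct_smul,
      dotProduct_smul, dotProduct_smul, dotProduct_comm a g, dotProduct_comm a n,
      dotProduct_comm g n]
    simp only [smul_eq_mul]
    ring
  rw [funext fun ξ => h1 (M.normal K i ξ) (a ξ) (g ξ)]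
  simp only [dotProduct]
  refine integrable_finsetSum _ fun l _ => ?_
  have h2 : ContinuousOn (fun ξ => tang (M.normal K i ξ) (a ξ) l) M.shape.face :=
    (continuous_apply l).comp_continuousOn (continuousOn_tang (M.continuousOn_normal K i) ha)
  have h3 : IntegrableOn (fun ξ => g ξ l) M.shape.face := Integrable.eval hg l
  exact h3.mul_continuousOn h2 M.shape.isCompact_face

/-- The sum over the elements of `LocalEqs.trace_energy`. Interior faces drop out by the trace
equation, and on boundary faces `ê` is exchanged for `-n × e^inc × n` by one of the two alternatives
in `hpl`. -/
theorem Scheme.energy_rate (hΩ : IsOpen Ω) {k : ℕ} {e h : M.Elem → R3 → R3} {φ : M.Elem → R3 → ℝ}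
    {et ht : M.Elem → R3 → R3} {φt : M.Elem → R3 → ℝ} {eh : M.Face → R3 → R3} {j : R3 → R3}
    {ρ : R3 → ℝ} {einc : R3 → R3} (hS : Scheme C k e h φ et ht φt eh j ρ einc)
    (he : ∀ K, M.InV k K (e K)) (hh : ∀ K, M.InV k K (h K)) (hφ : ∀ K, M.InW k K (φ K))
    (heh : M.InS k eh) (hinc : ∀ K i, M.IsBdry (M.faceOf K i) →
      IntegrableOn (fun ξ => einc (M.bmap K i ξ)) M.shape.face)
    (hpl : ∀ K i, M.IsBdry (M.faceOf K i) → M.IsPlanar (M.faceOf K i) ∨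
      ∃ m, M.InS k m ∧ ∀ ξ ∈ M.shape.face,
        tang (M.normal K i ξ) (einc (M.bmap K i ξ)) = m (M.faceOf K i) (M.bmap K i ξ)) :
    (∑ K, localRate C K (et K) (ht K) (φt K) (e K) (h K) (φ K)) + dissip C e φ eh
      = source C e h φ eh j ρ einc := by
  classical
  have h1 : ∀ K i, M.faceInt K i (fun ξ => (M.normal K i ξ ⨯₃ hHat C K (e K) (h K) eh i ξ) ⬝ᵥ
        eh (M.faceOf K i) (M.bmap K i ξ))
      = (if M.IsBdry (M.faceOf K i) then 0 else
          M.faceInt K i fun ξ => (M.normal K i ξ ⨯₃ hHat C K (e K) (h K) eh i ξ) ⬝ᵥ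
            eh (M.faceOf K i) (M.bmap K i ξ))
        - if M.IsBdry (M.faceOf K i) then
          M.faceInt K i fun ξ => (M.normal K i ξ ⨯₃ hHat C K (e K) (h K) eh i ξ) ⬝ᵥ
            tang (M.normal K i ξ) (einc (M.bmap K i ξ)) else 0 := by
    intro K i
    split_ifs with hb
    swap
    · rw [sub_zero]
    have hgc : ContinuousOn (fun ξ => M.normal K i ξ ⨯₃ hHat C K (e K) (h K) eh i ξ) M.shape.face :=
      continuousOn_cross (M.continuousOn_normal K i) (continuousOn_hHat C
        ((he K).c1On.continuousOn_bmap i) ((hh K).c1On.continuousOn_bmap i)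
        (heh.continuousOn_bmap K i))
    have h2 : M.faceInt K i (fun ξ => (eh (M.faceOf K i) (M.bmap K i ξ) +
        tang (M.normal K i ξ) (einc (M.bmap K i ξ))) ⬝ᵥ
          (M.normal K i ξ ⨯₃ hHat C K (e K) (h K) eh i ξ)) = 0 := by
      rcases hpl K i hb with hp | ⟨m, hm, hme⟩
      · exact hS.2.faceInt_of_planar hΩ hb (he K) (hh K) heh hp
      · exact hS.2.faceInt_of_mem hΩ hb heh hm hme _
    rw [Mesh.faceInt_congr (g := fun ξ => (M.normal K i ξ ⨯₃ hHat C K (e K) (h K) eh i ξ) ⬝ᵥ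
        eh (M.faceOf K i) (M.bmap K i ξ) + (M.normal K i ξ ⨯₃ hHat C K (e K) (h K) eh i ξ) ⬝ᵥ
          tang (M.normal K i ξ) (einc (M.bmap K i ξ))) (fun ξ _ => by
          rw [dotProduct_comm, dotProduct_add]), Mesh.faceInt_add] at h2
    · rw [zero_sub]
      exact eq_neg_of_add_eq_zero_left h2
    · exact (continuousOn_dotProduct hgc (heh.continuousOn_bmap K i)).integrableOn_compact
        M.shape.isCompact_face
    · exact integrableOn_dotProduct_tang hgc (hinc K i hb)
  have h3 := hS.2.sum_interior heh
  rw [dissip, ← Finset.sum_add_distrib,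
    Finset.sum_congr rfl fun K _ => (hS.1 K).trace_energy (he K) (hh K) (hφ K)
      (heh.continuousOn_bmap K), Finset.sum_add_distrib, source, sub_eq_add_neg]
  congr 1
  simp only [Mesh.bdInt]
  rw [Finset.sum_congr rfl fun K _ => Finset.sum_congr rfl fun i _ => h1 K i]
  simp only [Finset.sum_sub_distrib]
  rw [sub_eq_add_neg, add_eq_right]
  exact h3

/-! ### Curves in finite-dimensional spaces -/

section Separating

variable {E : Type*} [NormedAddCommGroup E] [NormedSpace ℝ E] [FiniteDimensional ℝ E]
  {ι : Type*} {L : ι → E →ₗ[ℝ] ℝ}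

/-- A functional on the dual space that kills all `L i` is evaluation at some `c`, by reflexivity,
and separation forces `c = 0`. -/
theorem span_range_eq_top_of_separating (hL : ∀ c, (∀ i, L i c = 0) → c = 0) :
    Submodule.span ℝ (range L) = ⊤ := by
  by_contra h
  obtain ⟨f, hf, hp⟩ := Submodule.exists_le_ker_of_lt_top _ (lt_top_iff_ne_top.2 h)
  obtain ⟨c, rfl⟩ := (Module.evalEquiv ℝ E).surjective f
  refine hf ?_
  rw [hL c fun i => ?_, map_zero]
  exact hp (Submodule.subset_span (mem_range_self i))

/-- The solution concept asks for differentiability in time at each point of space. Point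
evaluations separate polynomials, so they span the dual, and the coefficients inherit the
differentiability. -/
theorem differentiableOn_of_separating (hL : ∀ c, (∀ i, L i c = 0) → c = 0) {u : ℝ → E} {s : Set ℝ}
    (hu : ∀ i, DifferentiableOn ℝ (fun t => L i (u t)) s) : DifferentiableOn ℝ u s := by
  have h : ∀ f : E →ₗ[ℝ] ℝ, DifferentiableOn ℝ (fun t => f (u t)) s := fun f => by
    have hf : f ∈ Submodule.span ℝ (range L) := by
      rw [span_range_eq_top_of_separating hL]; trivial
    induction hf using Submodule.span_induction with
    | mem f hf => obtain ⟨i, rfl⟩ := hf; exact hu i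
    | zero => simp
    | add f g _ _ h1 h2 => exact h1.add h2
    | smul c f _ h1 => exact h1.const_mul c
  let b := Module.finBasis ℝ E
  have h2 : u = fun t => ∑ l, b.coord l (u t) • b l := funext fun t => (b.sum_repr (u t)).symm
  rw [h2]
  exact DifferentiableOn.fun_sum fun l _ => (h (b.coord l)).smul_const _

theorem continuousOn_of_separating (hL : ∀ c, (∀ i, L i c = 0) → c = 0) {u : ℝ → E} {s : Set ℝ}
    (hu : ∀ i, ContinuousOn (fun t => L i (u t)) s) : ContinuousOn u s := by
  have h : ∀ f : E →ₗ[ℝ] ℝ, ContinuousOn (fun t => f (u t)) s := fun f => by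
    have hf : f ∈ Submodule.span ℝ (range L) := by
      rw [span_range_eq_top_of_separating hL]; trivial
    induction hf using Submodule.span_induction with
    | mem f hf => obtain ⟨i, rfl⟩ := hf; exact hu i
    | zero => simpa using continuousOn_const
    | add f g _ _ h1 h2 => exact h1.add h2
    | smul c f _ h1 => exact continuousOn_const.mul h1
  let b := Module.finBasis ℝ E
  have h2 : u = fun t => ∑ l, b.coord l (u t) • b l := funext fun t => (b.sum_repr (u t)).symm
  rw [h2]
  exact continuousOn_finsetSum _ fun l _ => (h (b.coord l)).smul continuousOn_const

end Separating

/-! ### Coefficients of polynomials -/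

/-- Coefficient vectors of the polynomials of total degree at most `k` in `n` variables. -/
abbrev Coef (n k : ℕ) : Type :=
  Fin (Module.finrank ℝ (MvPolynomial.restrictTotalDegree (Fin n) ℝ k)) → ℝ

def coefEquiv (n k : ℕ) : MvPolynomial.restrictTotalDegree (Fin n) ℝ k ≃ₗ[ℝ] Coef n k :=
  (Module.finBasis ℝ _).equivFun

def polyEval (n k : ℕ) : Coef n k →ₗ[ℝ] ((Fin n → ℝ) → ℝ) :=
  LinearMap.pi fun x => (MvPolynomial.aeval x).toLinearMap ∘ₗ Submodule.subtype _ ∘ₗ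
    (coefEquiv n k).symm.toLinearMap

theorem polyEval_apply {n k : ℕ} (c : Coef n k) (x : Fin n → ℝ) :
    polyEval n k c x = MvPolynomial.eval x ((coefEquiv n k).symm c : MvPolynomial (Fin n) ℝ) := by
  simp only [polyEval, LinearMap.pi_apply, LinearMap.comp_apply, AlgHom.toLinearMap_apply]
  rw [MvPolynomial.aeval_eq_eval]
  rfl

theorem isPolyOn_polyEval {n k : ℕ} (D : Set (Fin n → ℝ)) (c : Coef n k) :
    IsPolyOn k D (polyEval n k c) :=
  ⟨_, (MvPolynomial.mem_restrictTotalDegree _ _ _).1 ((coefEquiv n k).symm c).2,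
    fun x _ => polyEval_apply c x⟩

theorem IsPolyOn.exists_coef {n k : ℕ} {D : Set (Fin n → ℝ)} {f : (Fin n → ℝ) → ℝ}
    (hf : IsPolyOn k D f) : ∃ c : Coef n k, ∀ x ∈ D, f x = polyEval n k c x := by
  obtain ⟨q, hq, he⟩ := hf
  refine ⟨coefEquiv n k ⟨q, (MvPolynomial.mem_restrictTotalDegree _ _ _).2 hq⟩, fun x hx => ?_⟩
  rw [polyEval_apply, LinearEquiv.symm_apply_apply, he x hx]

/-- An open set contains a product of intervals, and a polynomial vanishing on a product of infinite
sets is zero. -/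
theorem eq_zero_of_polyEval {n k : ℕ} {D : Set (Fin n → ℝ)} (hD : (interior D).Nonempty)
    {c : Coef n k} (h : ∀ x ∈ D, polyEval n k c x = 0) : c = 0 := by
  obtain ⟨x, hx⟩ := hD
  obtain ⟨r, hr, hb⟩ := Metric.isOpen_iff.1 isOpen_interior x hx
  have h0 : ((coefEquiv n k).symm c : MvPolynomial (Fin n) ℝ) = 0 := by
    refine MvPolynomial.funext_set (fun i => Metric.ball (x i) r) (fun i => ?_) fun y hy => ?_
    · rw [Real.ball_eq_Ioo]
      exact Ioo_infinite (by linarith)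
    · rw [map_zero, ← polyEval_apply]
      refine h y (interior_subset (hb ?_))
      rwa [ball_pi _ hr]
  have h1 : (coefEquiv n k).symm c = 0 := Subtype.ext h0
  simpa using h1

/-! ### Coefficients of the discrete fields -/

/-- Coefficients of a triple `(e, h, φ)` on one element. -/
abbrev ElemCoef (k : ℕ) : Type := (Fin 3 → Coef 3 k) × (Fin 3 → Coef 3 k) × Coef 3 k

namespace Mesh

variable {Ω : Set R3} {p : ℕ} (M : Mesh Ω p) {k : ℕ}

/-- The element of `W_h` on `K` with given coefficients. -/
def sField (k : ℕ) (K : M.Elem) : Coef 3 k →ₗ[ℝ] (R3 → ℝ) :=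
  LinearMap.pi fun y =>
    LinearMap.proj (Function.invFunOn (M.map K) M.shape.body y) ∘ₗ polyEval 3 k

/-- The element of `V_h` on `K` with given coefficients. -/
def vField (k : ℕ) (K : M.Elem) : (Fin 3 → Coef 3 k) →ₗ[ℝ] (R3 → R3) :=
  LinearMap.pi fun y => LinearMap.pi fun i =>
    LinearMap.proj y ∘ₗ M.sField k K ∘ₗ LinearMap.proj i

/-- Coefficients of the elements of `S_h`. -/
def traceCoef (k : ℕ) : Submodule ℝ (M.Face → Fin 3 → Coef 2 k) where
  carrier := {m | ∀ F, ∀ ξ ∈ M.shape.face,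
    (fun i => polyEval 2 k (m F i) ξ) ⬝ᵥ paramNormal (M.faceMap F) ξ = 0}
  add_mem' {a b} ha hb F ξ hξ := by
    have : (fun i => polyEval 2 k ((a + b) F i) ξ)
        = (fun i => polyEval 2 k (a F i) ξ) + fun i => polyEval 2 k (b F i) ξ :=
      funext fun i => by simp
    rw [this, add_dotProduct, ha F ξ hξ, hb F ξ hξ, add_zero]
  zero_mem' F ξ _ := by
    have : (fun i => polyEval 2 k ((0 : M.Face → Fin 3 → Coef 2 k) F i) ξ) = 0 :=
      funext fun i => by simp
    rw [this, zero_dotProduct]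
  smul_mem' c a ha F ξ hξ := by
    have : (fun i => polyEval 2 k ((c • a) F i) ξ) = c • fun i => polyEval 2 k (a F i) ξ :=
      funext fun i => by simp
    rw [this, smul_dotProduct, ha F ξ hξ, smul_zero]

/-- The element of `S_h` with given coefficients. -/
def tField (k : ℕ) : M.traceCoef k →ₗ[ℝ] (M.Face → R3 → R3) :=
  LinearMap.pi fun F => LinearMap.pi fun x => LinearMap.pi fun i =>
    LinearMap.proj (Function.invFunOn (M.faceMap F) M.shape.face x) ∘ₗ polyEval 2 k ∘ₗ
      LinearMap.proj i ∘ₗ LinearMap.proj F ∘ₗ Submodule.subtype _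

variable {M}

theorem sField_map (K : M.Elem) (c : Coef 3 k) {x : R3} (hx : x ∈ M.shape.body) :
    M.sField k K c (M.map K x) = polyEval 3 k c x := by
  have : Function.invFunOn (M.map K) M.shape.body (M.map K x) = x :=
    (M.map_inj K).leftInvOn_invFunOn hx
  simp [sField, this]

theorem inW_sField (K : M.Elem) (c : Coef 3 k) : M.InW k K (M.sField k K c) :=
  (isPolyOn_polyEval _ c).congr fun _ hx => sField_map K c hx

theorem inV_vField (K : M.Elem) (c : Fin 3 → Coef 3 k) : M.InV k K (M.vField k K c) :=
  fun i => inW_sField K (c i)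

theorem InW.exists_sField {K : M.Elem} {f : R3 → ℝ} (hf : M.InW k K f) :
    ∃ c, EqOn f (M.sField k K c) (M.map K '' M.shape.body) := by
  obtain ⟨c, hc⟩ := IsPolyOn.exists_coef hf
  refine ⟨c, ?_⟩
  rintro _ ⟨x, hx, rfl⟩
  rw [sField_map K c hx, hc x hx]

theorem InV.exists_vField {K : M.Elem} {v : R3 → R3} (hv : M.InV k K v) :
    ∃ c, EqOn v (M.vField k K c) (M.map K '' M.shape.body) := by
  choose c hc using fun i => (hv i).exists_sField
  exact ⟨c, fun x hx => funext fun i => hc i hx⟩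

theorem sField_eq_zero {K : M.Elem} {c : Coef 3 k} (h : ∀ x ∈ M.elem K, M.sField k K c x = 0) :
    c = 0 := by
  refine eq_zero_of_polyEval (D := interior M.shape.body) ?_ fun x hx => ?_
  · rw [interior_interior]; exact M.shape.interior_body_nonempty
  · rw [← sField_map K c (interior_subset hx)]
    exact h _ (mem_image_of_mem _ hx)

theorem vField_eq_zero {K : M.Elem} {c : Fin 3 → Coef 3 k}
    (h : ∀ x ∈ M.elem K, M.vField k K c x = 0) : c = 0 :=
  funext fun i => sField_eq_zero fun x hx => congrFun (h x hx) i

theorem exists_faceOf_eq (F : M.Face) : ∃ K i, M.faceOf K i = F := by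
  obtain ⟨-, r, hr, -⟩ | ⟨-, r, r', -, h⟩ := M.conform F
  · exact ⟨_, _, hr⟩
  · exact ⟨r.1, r.2, (h r).2 (Or.inl rfl)⟩

theorem _root_.GLMHDG.Shape.emb_injective (s : Shape) (i : s.Idx) :
    Function.Injective (s.emb i) := by
  intro ξ η h
  cases s with
  | tet =>
    rcases i with _ | i
    · have h1 := congrFun h 1
      have h2 := congrFun h 2
      funext l
      fin_cases l
      · exact h1
      · exact h2
    · exact Fin.insertNth_right_injective (α := fun _ => ℝ) (p := i) _ h
  | hex =>
    rcases i with ⟨i, _ | _⟩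
    · exact Fin.insertNth_right_injective (α := fun _ => ℝ) (p := i) _ h
    · exact Fin.insertNth_right_injective (α := fun _ => ℝ) (p := i) _ h

/-- Every face lies on some element, and injectivity is inherited from `map K` through the affine
symmetry. It makes fields on a face well defined by their values in the parameters. -/
theorem injOn_faceMap (F : M.Face) : InjOn (M.faceMap F) M.shape.face := by
  obtain ⟨K, i, rfl⟩ := exists_faceOf_eq F
  obtain ⟨σ, hσ, he⟩ := M.compat K i
  rw [← hσ]
  rintro _ ⟨ξ, hξ, rfl⟩ _ ⟨η, hη, rfl⟩ h
  rw [← he ξ hξ, ← he η hη] at h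
  rw [M.shape.emb_injective i
    (M.map_inj K (M.shape.emb_mem_body i hξ) (M.shape.emb_mem_body i hη) h)]

theorem tField_faceMap (m : M.traceCoef k) (F : M.Face) {ξ : R2} (hξ : ξ ∈ M.shape.face) :
    M.tField k m F (M.faceMap F ξ) = fun i => polyEval 2 k ((m : M.Face → Fin 3 → Coef 2 k) F i) ξ := by
  have : Function.invFunOn (M.faceMap F) M.shape.face (M.faceMap F ξ) = ξ :=
    (injOn_faceMap F).leftInvOn_invFunOn hξ
  funext i
  simp [tField, this]

theorem inS_tField (m : M.traceCoef k) : M.InS k (M.tField k m) := fun F =>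
  ⟨fun i => (isPolyOn_polyEval _ _).congr fun ξ hξ => congrFun (tField_faceMap m F hξ) i,
    fun ξ hξ => by rw [tField_faceMap m F hξ]; exact m.2 F ξ hξ⟩

theorem InS.exists_tField {m : M.Face → R3 → R3} (hm : M.InS k m) :
    ∃ c, ∀ F, EqOn (m F) (M.tField k c F) (M.faceMap F '' M.shape.face) := by
  choose c hc using fun F i => ((hm F).1 i).exists_coef
  have hc' : ∀ F, ∀ ξ ∈ M.shape.face, m F (M.faceMap F ξ) = fun i => polyEval 2 k (c F i) ξ :=
    fun F ξ hξ => funext fun i => hc F i ξ hξ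
  refine ⟨⟨c, fun F ξ hξ => ?_⟩, fun F => ?_⟩
  · rw [← hc' F ξ hξ]
    exact (hm F).2 ξ hξ
  · rintro _ ⟨ξ, hξ, rfl⟩
    rw [tField_faceMap _ F hξ, hc' F ξ hξ]

theorem tField_eq_zero {m : M.traceCoef k}
    (h : ∀ F, ∀ ξ ∈ M.shape.face, M.tField k m F (M.faceMap F ξ) = 0) : m = 0 := by
  refine Subtype.ext (funext fun F => funext fun i =>
    eq_zero_of_polyEval M.shape.interior_face_nonempty fun ξ hξ => ?_)
  have h1 := h F ξ hξ
  rw [tField_faceMap m F hξ] at h1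
  exact congrFun h1 i

end Mesh

/-! ### The forms of the method -/

variable {Ω : Set R3} {p : ℕ} {M : Mesh Ω p} (C : Coeff M)

/-- The part of the three element equations without time derivatives and data, added up. Since the
test functions are independent, one scalar equation replaces the three. -/
def stiff (K : M.Elem) (e h : R3 → R3) (φ : R3 → ℝ) (eh : M.Face → R3 → R3) (v w : R3 → R3)
    (ψ : R3 → ℝ) : ℝ :=
  (- (∫ x in M.elem K, h x ⬝ᵥ curl v x)
    - M.bdInt K (fun i ξ => hHat C K e h eh i ξ ⬝ᵥ (v (M.bmap K i ξ) ⨯₃ M.normal K i ξ))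
    - ∫ x in M.elem K, φ x * div v x) +
  ((∫ x in M.elem K, e x ⬝ᵥ curl w x)
    + M.bdInt K (fun i ξ => eh (M.faceOf K i) (M.bmap K i ξ) ⬝ᵥ
        (w (M.bmap K i ξ) ⨯₃ M.normal K i ξ))) +
  (1 / C.α₂ ^ 2 * (∫ x in M.elem K, φ x * ψ x)
    + 1 / C.α₃ ^ 2 * M.bdInt K (fun i ξ => φ (M.bmap K i ξ) * ψ (M.bmap K i ξ))
    + ∫ x in M.elem K, div e x * ψ x)

def load (K : M.Elem) (j : R3 → R3) (ρ : R3 → ℝ) (v : R3 → R3) (ψ : R3 → ℝ) : ℝ :=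
  - (∫ x in M.elem K, j x ⬝ᵥ v x) + ∫ x in M.elem K, ρ x / C.ε₀ * ψ x

open Classical in
-- The trace equation without the incident field: `ĥ` on interior faces and `ê` on boundary faces.
def traceForm (e h : M.Elem → R3 → R3) (eh m : M.Face → R3 → R3) : ℝ :=
  ∑ K, ∑ i, if M.IsBdry (M.faceOf K i) then
      M.faceInt K i fun ξ => eh (M.faceOf K i) (M.bmap K i ξ) ⬝ᵥ m (M.faceOf K i) (M.bmap K i ξ)
    else M.faceInt K i fun ξ => (M.normal K i ξ ⨯₃ hHat C K (e K) (h K) eh i ξ) ⬝ᵥ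
      m (M.faceOf K i) (M.bmap K i ξ)

open Classical in
variable (M) in
def traceLoad (einc : R3 → R3) (m : M.Face → R3 → R3) : ℝ :=
  - ∑ K, ∑ i, if M.IsBdry (M.faceOf K i) then
      M.faceInt K i fun ξ => tang (M.normal K i ξ) (einc (M.bmap K i ξ)) ⬝ᵥ
        m (M.faceOf K i) (M.bmap K i ξ)
    else 0

theorem pd_congr {v v' : R3 → R3} {x : R3} (h : v =ᶠ[𝓝 x] v') : pd v x = pd v' x := by
  funext i l
  simp only [pd, h.fderiv_eq]

theorem curl_congr {v v' : R3 → R3} {x : R3} (h : v =ᶠ[𝓝 x] v') : curl v x = curl v' x := by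
  simp only [curl, pd_congr h]

theorem div_congr {v v' : R3 → R3} {x : R3} (h : v =ᶠ[𝓝 x] v') : div v x = div v' x := by
  simp only [div, pd_congr h]

theorem curl_zero (x : R3) : curl (fun _ => 0) x = 0 := by
  ext i
  fin_cases i <;> simp [curl, pd]

theorem div_zero (x : R3) : div (fun _ => 0) x = 0 := by simp [div, pd]

variable {C} {K : M.Elem}

theorem localEqs_iff {k : ℕ} {e h : R3 → R3} {φ : R3 → ℝ} {et ht : R3 → R3} {φt : R3 → ℝ}
    {eh : M.Face → R3 → R3} {j : R3 → R3} {ρ : R3 → ℝ} :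
    LocalEqs C k K e h φ et ht φt eh j ρ ↔ ∀ v w ψ, M.InV k K v → M.InV k K w → M.InW k K ψ →
      localRate C K et ht φt v w ψ + stiff C K e h φ eh v w ψ = load C K j ρ v ψ := by
  have hV : M.InV k K fun _ => 0 := fun _ => isPolyOn_zero
  have hW : M.InW k K fun _ => 0 := isPolyOn_zero
  simp only [LocalEqs, localRate, stiff, load]
  constructor
  · rintro ⟨h1, h2, h3⟩ v w ψ hv hw hψ
    have e1 := h1 v hv
    have e2 := h2 w hw
    have e3 := h3 ψ hψ
    linarith
  · intro H
    refine ⟨fun v hv => ?_, fun w hw => ?_, fun ψ hψ => ?_⟩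
    · have := H v _ _ hv hV hW
      simp only [curl_zero, dotProduct_zero, mul_zero, integral_zero, map_zero,
        LinearMap.zero_apply, Mesh.bdInt_zero] at this
      linarith
    · have := H _ w _ hV hw hW
      simp only [curl_zero, div_zero, dotProduct_zero, mul_zero, integral_zero, map_zero,
        LinearMap.zero_apply, Mesh.bdInt_zero] at this
      linarith
    · have := H _ _ ψ hV hV hψ
      simp only [curl_zero, div_zero, dotProduct_zero, mul_zero, integral_zero, map_zero,
        LinearMap.zero_apply, Mesh.bdInt_zero] at this
      linarith

/-! ### The forms depend only on values on the closed elements and the faces -/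

section Congr

variable {e h e' h' v w v' w' : R3 → R3} {φ φ' ψ ψ' : R3 → ℝ} {eh eh' : M.Face → R3 → R3}

theorem elem_integral_congr {f g : R3 → ℝ} (H : ∀ x ∈ M.elem K, f x = g x) :
    ∫ x in M.elem K, f x = ∫ x in M.elem K, g x :=
  setIntegral_congr_fun (M.measurableSet_elem K) H

/-- Since elements are open, agreement on the closed element also gives agreement of the curls and
divergences inside it. -/
theorem eventuallyEq_of_eqOn {α : Type*} {f g : R3 → α} (H : EqOn f g (M.map K '' M.shape.body))
    {x : R3} (hx : x ∈ M.elem K) : f =ᶠ[𝓝 x] g :=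
  mem_of_superset ((M.isOpen_elem K).mem_nhds hx) fun _ hy => H (M.elem_subset_image K hy)

theorem localRate_congr (he : EqOn e e' (M.map K '' M.shape.body))
    (hh : EqOn h h' (M.map K '' M.shape.body)) (hφ : EqOn φ φ' (M.map K '' M.shape.body))
    (hv : EqOn v v' (M.map K '' M.shape.body)) (hw : EqOn w w' (M.map K '' M.shape.body))
    (hψ : EqOn ψ ψ' (M.map K '' M.shape.body)) :
    localRate C K e h φ v w ψ = localRate C K e' h' φ' v' w' ψ' := by
  have hs := M.elem_subset_image K
  exact congrArg₂ HAdd.hAdd (congrArg₂ HAdd.hAdd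
    (elem_integral_congr fun x hx => by rw [he (hs hx), hv (hs hx)])
    (elem_integral_congr fun x hx => by rw [hh (hs hx), hw (hs hx)]))
    (congrArg _ (elem_integral_congr fun x hx => by rw [hφ (hs hx), hψ (hs hx)]))

theorem hHat_congr (he : EqOn e e' (M.map K '' M.shape.body))
    (hh : EqOn h h' (M.map K '' M.shape.body)) {i : M.shape.Idx}
    (heh : ∀ ξ ∈ M.shape.face, eh (M.faceOf K i) (M.bmap K i ξ) = eh' (M.faceOf K i) (M.bmap K i ξ))
    {ξ : R2} (hξ : ξ ∈ M.shape.face) : hHat C K e h eh i ξ = hHat C K e' h' eh' i ξ := by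
  have hb := Mesh.mem_closure_of_bmap (M := M) (K := K) (i := i) hξ
  rw [hHat, hHat, he hb, hh hb, heh ξ hξ]

theorem stiff_congr (he : EqOn e e' (M.map K '' M.shape.body))
    (hh : EqOn h h' (M.map K '' M.shape.body)) (hφ : EqOn φ φ' (M.map K '' M.shape.body))
    (heh : ∀ i, ∀ ξ ∈ M.shape.face,
      eh (M.faceOf K i) (M.bmap K i ξ) = eh' (M.faceOf K i) (M.bmap K i ξ))
    (hv : EqOn v v' (M.map K '' M.shape.body)) (hw : EqOn w w' (M.map K '' M.shape.body))
    (hψ : EqOn ψ ψ' (M.map K '' M.shape.body)) :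
    stiff C K e h φ eh v w ψ = stiff C K e' h' φ' eh' v' w' ψ' := by
  have hs := M.elem_subset_image K
  have hb : ∀ i, ∀ ξ ∈ M.shape.face, M.bmap K i ξ ∈ M.map K '' M.shape.body := fun i ξ hξ =>
    Mesh.mem_closure_of_bmap hξ
  refine congrArg₂ HAdd.hAdd (congrArg₂ HAdd.hAdd (congrArg₂ HSub.hSub (congrArg₂ HSub.hSub
    (congrArg Neg.neg (elem_integral_congr fun x hx => ?_)) (Mesh.bdInt_congr fun i ξ hξ => ?_))
    (elem_integral_congr fun x hx => ?_)) (congrArg₂ HAdd.hAdd (elem_integral_congr fun x hx => ?_)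
    (Mesh.bdInt_congr fun i ξ hξ => ?_))) (congrArg₂ HAdd.hAdd (congrArg₂ HAdd.hAdd
    (congrArg _ (elem_integral_congr fun x hx => ?_))
    (congrArg _ (Mesh.bdInt_congr fun i ξ hξ => ?_))) (elem_integral_congr fun x hx => ?_))
  · rw [hh (hs hx), curl_congr (eventuallyEq_of_eqOn hv hx)]
  · rw [hHat_congr he hh (heh i) hξ, hv (hb i ξ hξ)]
  · rw [hφ (hs hx), div_congr (eventuallyEq_of_eqOn hv hx)]
  · rw [he (hs hx), curl_congr (eventuallyEq_of_eqOn hw hx)]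
  · rw [heh i ξ hξ, hw (hb i ξ hξ)]
  · rw [hφ (hs hx), hψ (hs hx)]
  · rw [hφ (hb i ξ hξ), hψ (hb i ξ hξ)]
  · rw [div_congr (eventuallyEq_of_eqOn he hx), hψ (hs hx)]

theorem load_congr {j : R3 → R3} {ρ : R3 → ℝ} (hv : EqOn v v' (M.map K '' M.shape.body))
    (hψ : EqOn ψ ψ' (M.map K '' M.shape.body)) : load C K j ρ v ψ = load C K j ρ v' ψ' := by
  have hs := M.elem_subset_image K
  exact congrArg₂ HAdd.hAdd
    (congrArg Neg.neg (elem_integral_congr fun x hx => by rw [hv (hs hx)]))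
    (elem_integral_congr fun x hx => by rw [hψ (hs hx)])

theorem phiDissip_congr (hφ : EqOn φ φ' (M.map K '' M.shape.body)) :
    phiDissip C K φ = phiDissip C K φ' := by
  have hs := M.elem_subset_image K
  exact congrArg₂ HAdd.hAdd (congrArg _ (elem_integral_congr fun x hx => by rw [hφ (hs hx)]))
    (congrArg _ (Mesh.bdInt_congr fun i ξ hξ => by rw [hφ (Mesh.mem_closure_of_bmap hξ)]))

theorem tauForm_congr {a b a' b' : M.shape.Idx → R2 → R3}
    (ha : ∀ i, ∀ ξ ∈ M.shape.face, a i ξ = a' i ξ) (hb : ∀ i, ∀ ξ ∈ M.shape.face, b i ξ = b' i ξ) :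
    tauForm C K a b = tauForm C K a' b' :=
  Mesh.bdInt_congr fun i ξ hξ => by rw [ha i ξ hξ, hb i ξ hξ]

theorem bmap_congr {m m' : M.Face → R3 → R3}
    (hm : ∀ F, EqOn (m F) (m' F) (M.faceMap F '' M.shape.face)) (K : M.Elem) (i : M.shape.Idx)
    {ξ : R2} (hξ : ξ ∈ M.shape.face) :
    m (M.faceOf K i) (M.bmap K i ξ) = m' (M.faceOf K i) (M.bmap K i ξ) := by
  obtain ⟨η, hη, he⟩ := Mesh.exists_faceMap_eq (K := K) (i := i) hξ
  rw [he]
  exact hm _ (mem_image_of_mem _ hη)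

theorem traceForm_congr {e h e' h' : M.Elem → R3 → R3} {m m' : M.Face → R3 → R3}
    (he : ∀ K, EqOn (e K) (e' K) (M.map K '' M.shape.body))
    (hh : ∀ K, EqOn (h K) (h' K) (M.map K '' M.shape.body))
    (heh : ∀ F, EqOn (eh F) (eh' F) (M.faceMap F '' M.shape.face))
    (hm : ∀ F, EqOn (m F) (m' F) (M.faceMap F '' M.shape.face)) :
    traceForm C e h eh m = traceForm C e' h' eh' m' := by
  classical
  refine Finset.sum_congr rfl fun K _ => Finset.sum_congr rfl fun i _ => ?_
  refine if_congr Iff.rfl (Mesh.faceInt_congr fun ξ hξ => ?_) (Mesh.faceInt_congr fun ξ hξ => ?_)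
  · rw [bmap_congr heh K i hξ, bmap_congr hm K i hξ]
  · rw [hHat_congr (he K) (hh K) (fun ξ hξ => bmap_congr heh K i hξ) hξ, bmap_congr hm K i hξ]

theorem traceLoad_congr {einc : R3 → R3} {m m' : M.Face → R3 → R3}
    (hm : ∀ F, EqOn (m F) (m' F) (M.faceMap F '' M.shape.face)) :
    traceLoad M einc m = traceLoad M einc m' := by
  classical
  refine congrArg Neg.neg (Finset.sum_congr rfl fun K _ => Finset.sum_congr rfl fun i _ => ?_)
  exact if_congr Iff.rfl (Mesh.faceInt_congr fun ξ hξ => by rw [bmap_congr hm K i hξ]) rfl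

end Congr

/-- Separating data from unknowns splits a boundary integral into a sum, which requires each part to
be integrable. This is where integrability of the incident field enters. -/
theorem traceEq_iff {k : ℕ} {e h : M.Elem → R3 → R3} {eh : M.Face → R3 → R3} {einc : R3 → R3}
    (heh : M.InS k eh) (hinc : ∀ K i, M.IsBdry (M.faceOf K i) →
      IntegrableOn (fun ξ => einc (M.bmap K i ξ)) M.shape.face) :
    TraceEq C k e h eh einc ↔
      ∀ m, M.InS k m → traceForm C e h eh m = traceLoad M einc m := by
  classical
  refine forall_congr' fun m => forall_congr' fun hm => ?_
  rw [traceLoad, ← add_eq_zero_iff_eq_neg, traceForm, ← Finset.sum_add_distrib,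
    ← Finset.sum_add_distrib]
  refine Eq.congr (Finset.sum_congr rfl fun K _ => ?_) rfl
  rw [← Finset.sum_add_distrib, ← Finset.sum_add_distrib]
  refine Finset.sum_congr rfl fun i _ => ?_
  split_ifs with hb
  · rw [zero_add, ← Mesh.faceInt_add]
    · exact Mesh.faceInt_congr fun ξ _ => add_dotProduct _ _ _
    · exact (continuousOn_dotProduct (heh.continuousOn_bmap K i)
        (hm.continuousOn_bmap K i)).integrableOn_compact M.shape.isCompact_face
    · simp only [dotProduct_comm _ (m _ _)]
      exact integrableOn_dotProduct_tang (hm.continuousOn_bmap K i) (hinc K i hb)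
  · rw [add_zero]

/-! ### Bilinear maps -/

section Bilinear

variable {U V U' V' : Type*} [AddCommGroup U] [Module ℝ U] [AddCommGroup V] [Module ℝ V]
  [AddCommGroup U'] [Module ℝ U'] [AddCommGroup V'] [Module ℝ V']

theorem isBilinearMap_add {F G : U → V → ℝ} (hF : IsBilinearMap ℝ F) (hG : IsBilinearMap ℝ G) :
    IsBilinearMap ℝ fun u v => F u v + G u v where
  add_left x y z := by rw [hF.add_left, hG.add_left]; ring
  smul_left c x y := by rw [hF.smul_left, hG.smul_left, smul_add]
  add_right x y z := by rw [hF.add_right, hG.add_right]; ring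
  smul_right c x y := by rw [hF.smul_right, hG.smul_right, smul_add]

theorem isBilinearMap_const_mul (c : ℝ) {F : U → V → ℝ} (hF : IsBilinearMap ℝ F) :
    IsBilinearMap ℝ fun u v => c * F u v where
  add_left x y z := by rw [hF.add_left, mul_add]
  smul_left a x y := by rw [hF.smul_left, smul_eq_mul, smul_eq_mul]; ring
  add_right x y z := by rw [hF.add_right, mul_add]
  smul_right a x y := by rw [hF.smul_right, smul_eq_mul, smul_eq_mul]; ring

theorem isBilinearMap_neg {F : U → V → ℝ} (hF : IsBilinearMap ℝ F) :
    IsBilinearMap ℝ fun u v => - F u v := by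
  simpa using isBilinearMap_const_mul (-1) hF

theorem isBilinearMap_sub {F G : U → V → ℝ} (hF : IsBilinearMap ℝ F) (hG : IsBilinearMap ℝ G) :
    IsBilinearMap ℝ fun u v => F u v - G u v := by
  simpa only [sub_eq_add_neg] using isBilinearMap_add hF (isBilinearMap_neg hG)

theorem isBilinearMap_sum {ι : Type*} {s : Finset ι} {F : ι → U → V → ℝ}
    (hF : ∀ i, IsBilinearMap ℝ (F i)) : IsBilinearMap ℝ fun u v => ∑ i ∈ s, F i u v where
  add_left x y z := by simp only [(hF _).add_left, Finset.sum_add_distrib]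
  smul_left c x y := by simp only [(hF _).smul_left, Finset.smul_sum]
  add_right x y z := by simp only [(hF _).add_right, Finset.sum_add_distrib]
  smul_right c x y := by simp only [(hF _).smul_right, Finset.smul_sum]

theorem isBilinearMap_comp {F : U → V → ℝ} (hF : IsBilinearMap ℝ F) (f : U' →ₗ[ℝ] U)
    (g : V' →ₗ[ℝ] V) : IsBilinearMap ℝ fun u v => F (f u) (g v) where
  add_left x y z := by rw [map_add, hF.add_left]
  smul_left c x y := by rw [map_smul, hF.smul_left]
  add_right x y z := by rw [map_add, hF.add_right]
  smul_right c x y := by rw [map_smul, hF.smul_right]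

theorem isBilinearMap_mul {f : U → ℝ} {g : V → ℝ} (hf : IsLinearMap ℝ f) (hg : IsLinearMap ℝ g) :
    IsBilinearMap ℝ fun u v => f u * g v where
  add_left x y z := by rw [hf.map_add, add_mul]
  smul_left c x y := by rw [hf.map_smul, smul_mul_assoc]
  add_right x y z := by rw [hg.map_add, mul_add]
  smul_right c x y := by rw [hg.map_smul, mul_smul_comm]

theorem isBilinearMap_dotProduct {f : U → R3} {g : V → R3} (hf : IsLinearMap ℝ f)
    (hg : IsLinearMap ℝ g) : IsBilinearMap ℝ fun u v => f u ⬝ᵥ g v where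
  add_left x y z := by rw [hf.map_add, add_dotProduct]
  smul_left c x y := by rw [hf.map_smul, smul_dotProduct]
  add_right x y z := by rw [hg.map_add, dotProduct_add]
  smul_right c x y := by rw [hg.map_smul, dotProduct_smul]

theorem isLinearMap_cross_const {f : U → R3} (hf : IsLinearMap ℝ f) (n : R3) :
    IsLinearMap ℝ fun u => f u ⨯₃ n where
  map_add x y := by rw [hf.map_add, map_add, LinearMap.add_apply]
  map_smul c x := by rw [hf.map_smul, map_smul, LinearMap.smul_apply]

theorem isLinearMap_const_cross {f : U → R3} (hf : IsLinearMap ℝ f) (n : R3) :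
    IsLinearMap ℝ fun u => n ⨯₃ f u where
  map_add x y := by rw [hf.map_add, map_add]
  map_smul c x := by rw [hf.map_smul, map_smul]

theorem isLinearMap_sub {W : Type*} [AddCommGroup W] [Module ℝ W] {f g : U → W}
    (hf : IsLinearMap ℝ f) (hg : IsLinearMap ℝ g) : IsLinearMap ℝ fun u => f u - g u where
  map_add x y := by rw [hf.map_add, hg.map_add]; abel
  map_smul c x := by rw [hf.map_smul, hg.map_smul, smul_sub]

theorem isLinearMap_smul {W : Type*} [AddCommGroup W] [Module ℝ W] {f : U → W}
    (hf : IsLinearMap ℝ f) (c : ℝ) : IsLinearMap ℝ fun u => c • f u where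
  map_add x y := by rw [hf.map_add, smul_add]
  map_smul a x := by rw [hf.map_smul, smul_comm]

theorem isBilinearMap_setIntegral {X : Type*} [MeasurableSpace X] {μ : Measure X} {s : Set X}
    (hs : MeasurableSet s) {F : U → V → X → ℝ}
    (hF : ∀ x ∈ s, IsBilinearMap ℝ fun u v => F u v x) (hi : ∀ u v, IntegrableOn (F u v) s μ) :
    IsBilinearMap ℝ fun u v => ∫ x in s, F u v x ∂μ where
  add_left x y z := by
    rw [← integral_add (hi _ _) (hi _ _)]
    exact setIntegral_congr_fun hs fun a ha => (hF a ha).add_left x y z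
  smul_left c x y := by
    rw [← integral_smul]
    exact setIntegral_congr_fun hs fun a ha => (hF a ha).smul_left c x y
  add_right x y z := by
    rw [← integral_add (hi _ _) (hi _ _)]
    exact setIntegral_congr_fun hs fun a ha => (hF a ha).add_right x y z
  smul_right c x y := by
    rw [← integral_smul]
    exact setIntegral_congr_fun hs fun a ha => (hF a ha).smul_right c x y

variable {Ω : Set R3} {p : ℕ} {M : Mesh Ω p} {K : M.Elem}

theorem isBilinearMap_faceInt {i : M.shape.Idx} {F : U → V → R2 → ℝ}
    (hF : ∀ ξ ∈ M.shape.face, IsBilinearMap ℝ fun u v => F u v ξ)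
    (hc : ∀ u v, ContinuousOn (F u v) M.shape.face) :
    IsBilinearMap ℝ fun u v => M.faceInt K i (F u v) := by
  refine isBilinearMap_setIntegral M.shape.measurableSet_face (fun ξ hξ => ?_) fun u v =>
    Mesh.integrableOn_mul_areaElem ((hc u v).integrableOn_compact M.shape.isCompact_face)
  simp only [mul_comm _ (areaElem _ _)]
  exact isBilinearMap_const_mul _ (hF ξ hξ)

theorem isBilinearMap_bdInt {F : U → V → M.shape.Idx → R2 → ℝ}
    (hF : ∀ i, ∀ ξ ∈ M.shape.face, IsBilinearMap ℝ fun u v => F u v i ξ)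
    (hc : ∀ u v i, ContinuousOn (F u v i) M.shape.face) :
    IsBilinearMap ℝ fun u v => M.bdInt K (F u v) :=
  isBilinearMap_sum fun i => isBilinearMap_faceInt (hF i) fun u v => hc u v i

end Bilinear

/-! ### The forms in terms of coefficients -/

variable {Ω : Set R3} {p : ℕ} {M : Mesh Ω p} {k : ℕ} {K : M.Elem}

theorem isLinearMap_curl {U : Type*} [AddCommGroup U] [Module ℝ U] (f : U →ₗ[ℝ] (R3 → R3)) {x : R3}
    (hf : ∀ u, DifferentiableAt ℝ (f u) x) :
    IsLinearMap ℝ (fun u => curl (f u) x) ∧ IsLinearMap ℝ fun u => div (f u) x := by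
  have h1 : ∀ u v, pd (f (u + v)) x = fun i l => pd (f u) x i l + pd (f v) x i l := fun u v => by
    funext i l
    simp only [pd, map_add]
    rw [fderiv_add (hf u) (hf v)]
    rfl
  have h2 : ∀ (c : ℝ) u, pd (f (c • u)) x = fun i l => c * pd (f u) x i l := fun c u => by
    funext i l
    simp only [pd, map_smul]
    rw [fderiv_const_smul (hf u)]
    rfl
  refine ⟨⟨fun u v => ?_, fun c u => ?_⟩, ⟨fun u v => ?_, fun c u => ?_⟩⟩
  · simp only [curl, h1]
    ext i
    fin_cases i <;> simp <;> ring
  · simp only [curl, h2]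
    ext i
    fin_cases i <;> simp <;> ring
  · simp only [div, h1, Finset.sum_add_distrib]
  · simp only [div, h2, smul_eq_mul, Finset.mul_sum]

variable (C : Coeff M)

def massC (K : M.Elem) (u q : ElemCoef k) : ℝ :=
  localRate C K (M.vField k K u.1) (M.vField k K u.2.1) (M.sField k K u.2.2)
    (M.vField k K q.1) (M.vField k K q.2.1) (M.sField k K q.2.2)

def stiffC (K : M.Elem) (u : ElemCoef k × M.traceCoef k) (q : ElemCoef k) : ℝ :=
  stiff C K (M.vField k K u.1.1) (M.vField k K u.1.2.1) (M.sField k K u.1.2.2) (M.tField k u.2)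
    (M.vField k K q.1) (M.vField k K q.2.1) (M.sField k K q.2.2)

def loadC (K : M.Elem) (j : R3 → R3) (ρ : R3 → ℝ) (q : ElemCoef k) : ℝ :=
  load C K j ρ (M.vField k K q.1) (M.sField k K q.2.2)

/-- The polarized form of the dissipation in the global energy identity. As a bilinear form it is
continuous along continuous coefficient curves. -/
def dissipC (K : M.Elem) (u q : ElemCoef k × M.traceCoef k) : ℝ :=
  (1 / C.α₂ ^ 2 * (∫ x in M.elem K, M.sField k K u.1.2.2 x * M.sField k K q.1.2.2 x)
    + 1 / C.α₃ ^ 2 * M.bdInt K (fun i ξ => M.sField k K u.1.2.2 (M.bmap K i ξ) *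
      M.sField k K q.1.2.2 (M.bmap K i ξ))) +
  tauForm C K
    (fun i ξ => M.vField k K u.1.1 (M.bmap K i ξ) - M.tField k u.2 (M.faceOf K i) (M.bmap K i ξ))
    (fun i ξ => M.vField k K q.1.1 (M.bmap K i ξ) - M.tField k q.2 (M.faceOf K i) (M.bmap K i ξ))

def traceC (u : (M.Elem → ElemCoef k) × M.traceCoef k) (m : M.traceCoef k) : ℝ :=
  traceForm C (fun K => M.vField k K (u.1 K).1) (fun K => M.vField k K (u.1 K).2.1)
    (M.tField k u.2) (M.tField k m)

variable {C}

theorem vField_elemCont (c : Fin 3 → Coef 3 k) (i : Fin 3) :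
    M.ElemCont K fun x => M.vField k K c x i :=
  ((Mesh.inV_vField K c).c1On.coord i).elemCont

theorem sField_elemCont (c : Coef 3 k) : M.ElemCont K fun x => M.sField k K c x :=
  (Mesh.inW_sField K c).c1On.elemCont

theorem integrableOn_of_le {f : R3 → ℝ} (hf : Measurable f)
    (hb : ∃ c B : ℝ, 0 < c ∧ ∀ x ∈ Ω, c ≤ f x ∧ f x ≤ B) (K : M.Elem) :
    IntegrableOn f (M.elem K) := by
  obtain ⟨c, B, hc, h⟩ := hb
  refine Measure.integrableOn_of_bounded (M := B) (M.volume_elem_lt_top K).ne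
    hf.aestronglyMeasurable ?_
  filter_upwards [ae_restrict_mem (M.measurableSet_elem K)] with x hx
  obtain ⟨h1, h2⟩ := h x (M.subset K hx)
  rw [Real.norm_eq_abs, abs_of_nonneg (hc.le.trans h1)]
  exact h2

theorem isLinearMap_vField {U : Type*} [AddCommGroup U] [Module ℝ U]
    (L : U →ₗ[ℝ] (Fin 3 → Coef 3 k)) (x : R3) : IsLinearMap ℝ fun u => M.vField k K (L u) x :=
  ⟨fun a b => by simp, fun c a => by simp⟩

theorem isLinearMap_sField {U : Type*} [AddCommGroup U] [Module ℝ U]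
    (L : U →ₗ[ℝ] Coef 3 k) (x : R3) : IsLinearMap ℝ fun u => M.sField k K (L u) x :=
  ⟨fun a b => by simp, fun c a => by simp⟩

theorem isLinearMap_tField {U : Type*} [AddCommGroup U] [Module ℝ U]
    (L : U →ₗ[ℝ] M.traceCoef k) (F : M.Face) (x : R3) :
    IsLinearMap ℝ fun u => M.tField k (L u) F x :=
  ⟨fun a b => by simp, fun c a => by simp⟩

theorem isLinearMap_curl_vField {U : Type*} [AddCommGroup U] [Module ℝ U]
    (L : U →ₗ[ℝ] (Fin 3 → Coef 3 k)) {x : R3} (hx : x ∈ M.elem K) :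
    IsLinearMap ℝ (fun u => curl (M.vField k K (L u)) x) ∧
      IsLinearMap ℝ fun u => div (M.vField k K (L u)) x :=
  isLinearMap_curl (M.vField k K ∘ₗ L) fun u => (Mesh.inV_vField K (L u)).c1On.differentiableAt hx

theorem isLinearMap_hHat {U : Type*} [AddCommGroup U] [Module ℝ U]
    (L H : U →ₗ[ℝ] (Fin 3 → Coef 3 k)) (S : U →ₗ[ℝ] M.traceCoef k) (i : M.shape.Idx) (ξ : R2) :
    IsLinearMap ℝ fun u => hHat C K (M.vField k K (L u)) (M.vField k K (H u)) (M.tField k (S u)) i ξ :=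
  isLinearMap_sub (isLinearMap_cross_const (isLinearMap_const_cross (isLinearMap_vField H _) _) _)
    (isLinearMap_smul (isLinearMap_cross_const
      (isLinearMap_sub (isLinearMap_vField L _) (isLinearMap_tField S _ _)) _) _)

theorem continuousOn_vField (c : Fin 3 → Coef 3 k) (i : M.shape.Idx) :
    ContinuousOn (fun ξ => M.vField k K c (M.bmap K i ξ)) M.shape.face :=
  (Mesh.inV_vField K c).c1On.continuousOn_bmap i

theorem continuousOn_sField (c : Coef 3 k) (i : M.shape.Idx) :
    ContinuousOn (fun ξ => M.sField k K c (M.bmap K i ξ)) M.shape.face :=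
  (Mesh.inW_sField K c).c1On.continuousOn_bmap i

theorem continuousOn_tField (c : M.traceCoef k) (i : M.shape.Idx) :
    ContinuousOn (fun ξ => M.tField k c (M.faceOf K i) (M.bmap K i ξ)) M.shape.face :=
  (Mesh.inS_tField c).continuousOn_bmap K i

theorem isBilinearMap_massC : IsBilinearMap ℝ (massC (k := k) C K) := by
  let l1 : ElemCoef k →ₗ[ℝ] (Fin 3 → Coef 3 k) := LinearMap.fst ℝ _ _
  let l2 : ElemCoef k →ₗ[ℝ] (Fin 3 → Coef 3 k) := LinearMap.fst ℝ _ _ ∘ₗ LinearMap.snd ℝ _ _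
  let l3 : ElemCoef k →ₗ[ℝ] Coef 3 k := LinearMap.snd ℝ _ _ ∘ₗ LinearMap.snd ℝ _ _
  unfold massC localRate
  have h : ∀ (f : R3 → ℝ), IntegrableOn f (M.elem K) → ∀ l : ElemCoef k →ₗ[ℝ] (Fin 3 → Coef 3 k),
      IsBilinearMap ℝ fun u q => ∫ x in M.elem K,
        f x * (M.vField k K (l u) x ⬝ᵥ M.vField k K (l q) x) := fun f hf l =>
    isBilinearMap_setIntegral (M.measurableSet_elem K)
      (fun x _ => isBilinearMap_const_mul _ (isBilinearMap_dotProduct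
        (isLinearMap_vField l x) (isLinearMap_vField l x)))
      fun u v => (Mesh.ElemCont.dotProduct (vField_elemCont _) (vField_elemCont _)).integrableOn_mul
        hf
  have h3 : IsBilinearMap ℝ fun u q => ∫ x in M.elem K, M.sField k K (l3 u) x * M.sField k K (l3 q) x :=
    isBilinearMap_setIntegral (M.measurableSet_elem K)
      (fun x _ => isBilinearMap_mul (isLinearMap_sField l3 x) (isLinearMap_sField l3 x))
      fun u v => ((sField_elemCont _).mul (sField_elemCont _)).integrableOn
  exact isBilinearMap_add (isBilinearMap_add (h _ (integrableOn_of_le C.ε_meas C.ε_bdd K) l1)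
    (h _ (integrableOn_of_le C.μ_meas C.μ_bdd K) l2)) (isBilinearMap_const_mul _ h3)

theorem isBilinearMap_stiffC : IsBilinearMap ℝ (stiffC (k := k) C K) := by
  let l1 : ElemCoef k × M.traceCoef k →ₗ[ℝ] (Fin 3 → Coef 3 k) :=
    LinearMap.fst ℝ _ _ ∘ₗ LinearMap.fst ℝ _ _
  let l2 : ElemCoef k × M.traceCoef k →ₗ[ℝ] (Fin 3 → Coef 3 k) :=
    LinearMap.fst ℝ _ _ ∘ₗ LinearMap.snd ℝ _ _ ∘ₗ LinearMap.fst ℝ _ _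
  let l3 : ElemCoef k × M.traceCoef k →ₗ[ℝ] Coef 3 k :=
    LinearMap.snd ℝ _ _ ∘ₗ LinearMap.snd ℝ _ _ ∘ₗ LinearMap.fst ℝ _ _
  let l4 : ElemCoef k × M.traceCoef k →ₗ[ℝ] M.traceCoef k := LinearMap.snd ℝ _ _
  let r1 : ElemCoef k →ₗ[ℝ] (Fin 3 → Coef 3 k) := LinearMap.fst ℝ _ _
  let r2 : ElemCoef k →ₗ[ℝ] (Fin 3 → Coef 3 k) := LinearMap.fst ℝ _ _ ∘ₗ LinearMap.snd ℝ _ _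
  let r3 : ElemCoef k →ₗ[ℝ] Coef 3 k := LinearMap.snd ℝ _ _ ∘ₗ LinearMap.snd ℝ _ _
  have hn := M.continuousOn_normal K
  have hcurl : ∀ (c : Fin 3 → Coef 3 k) i, M.ElemCont K fun x => curl (M.vField k K c) x i :=
    fun c i => (Mesh.inV_vField K c).c1On.elemCont_curl i
  have hdiv : ∀ c : Fin 3 → Coef 3 k, M.ElemCont K fun x => div (M.vField k K c) x :=
    fun c => (Mesh.inV_vField K c).c1On.elemCont_div
  refine isBilinearMap_add (isBilinearMap_add (isBilinearMap_sub (isBilinearMap_sub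
    (isBilinearMap_neg ?_) ?_) ?_) (isBilinearMap_add ?_ ?_)) (isBilinearMap_add (isBilinearMap_add
    (isBilinearMap_const_mul _ ?_) (isBilinearMap_const_mul _ ?_)) ?_)
  · exact isBilinearMap_setIntegral (M.measurableSet_elem K)
      (fun x hx => isBilinearMap_dotProduct (isLinearMap_vField l2 x)
        (isLinearMap_curl_vField r1 hx).1)
      fun u v => (Mesh.ElemCont.dotProduct (vField_elemCont _) (hcurl _)).integrableOn
  · exact isBilinearMap_bdInt (fun i ξ _ => isBilinearMap_dotProduct (isLinearMap_hHat l1 l2 l4 i ξ)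
      (isLinearMap_cross_const (isLinearMap_vField r1 _) _)) fun u v i =>
        continuousOn_dotProduct (continuousOn_hHat C (continuousOn_vField _ i)
          (continuousOn_vField _ i) (continuousOn_tField _ i))
          (continuousOn_cross (continuousOn_vField _ i) (hn i))
  · exact isBilinearMap_setIntegral (M.measurableSet_elem K)
      (fun x hx => isBilinearMap_mul (isLinearMap_sField l3 x) (isLinearMap_curl_vField r1 hx).2)
      fun u v => ((sField_elemCont _).mul (hdiv _)).integrableOn
  · exact isBilinearMap_setIntegral (M.measurableSet_elem K)
      (fun x hx => isBilinearMap_dotProduct (isLinearMap_vField l1 x)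
        (isLinearMap_curl_vField r2 hx).1)
      fun u v => (Mesh.ElemCont.dotProduct (vField_elemCont _) (hcurl _)).integrableOn
  · exact isBilinearMap_bdInt (fun i ξ _ => isBilinearMap_dotProduct (isLinearMap_tField l4 _ _)
      (isLinearMap_cross_const (isLinearMap_vField r2 _) _)) fun u v i =>
        continuousOn_dotProduct (continuousOn_tField _ i)
          (continuousOn_cross (continuousOn_vField _ i) (hn i))
  · exact isBilinearMap_setIntegral (M.measurableSet_elem K)
      (fun x hx => isBilinearMap_mul (isLinearMap_sField l3 x) (isLinearMap_sField r3 x))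
      fun u v => ((sField_elemCont _).mul (sField_elemCont _)).integrableOn
  · exact isBilinearMap_bdInt (fun i ξ _ => isBilinearMap_mul (isLinearMap_sField l3 _)
      (isLinearMap_sField r3 _)) fun u v i => (continuousOn_sField _ i).mul (continuousOn_sField _ i)
  · exact isBilinearMap_setIntegral (M.measurableSet_elem K)
      (fun x hx => isBilinearMap_mul (isLinearMap_curl_vField l1 hx).2 (isLinearMap_sField r3 x))
      fun u v => ((hdiv _).mul (sField_elemCont _)).integrableOn

theorem isBilinearMap_dissipC : IsBilinearMap ℝ (dissipC (k := k) C K) := by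
  let l1 : ElemCoef k × M.traceCoef k →ₗ[ℝ] (Fin 3 → Coef 3 k) :=
    LinearMap.fst ℝ _ _ ∘ₗ LinearMap.fst ℝ _ _
  let l3 : ElemCoef k × M.traceCoef k →ₗ[ℝ] Coef 3 k :=
    LinearMap.snd ℝ _ _ ∘ₗ LinearMap.snd ℝ _ _ ∘ₗ LinearMap.fst ℝ _ _
  let l4 : ElemCoef k × M.traceCoef k →ₗ[ℝ] M.traceCoef k := LinearMap.snd ℝ _ _
  have hn := M.continuousOn_normal K
  refine isBilinearMap_add (isBilinearMap_add (isBilinearMap_const_mul _ ?_)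
    (isBilinearMap_const_mul _ ?_)) ?_
  · exact isBilinearMap_setIntegral (M.measurableSet_elem K)
      (fun x hx => isBilinearMap_mul (isLinearMap_sField l3 x) (isLinearMap_sField l3 x))
      fun u v => ((sField_elemCont _).mul (sField_elemCont _)).integrableOn
  · exact isBilinearMap_bdInt (fun i ξ _ => isBilinearMap_mul (isLinearMap_sField l3 _)
      (isLinearMap_sField l3 _)) fun u v i => (continuousOn_sField _ i).mul (continuousOn_sField _ i)
  · have hl : ∀ i ξ, IsLinearMap ℝ fun u : ElemCoef k × M.traceCoef k =>
        (M.vField k K (l1 u) (M.bmap K i ξ) - M.tField k (l4 u) (M.faceOf K i) (M.bmap K i ξ)) ⨯₃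
          M.normal K i ξ := fun i ξ =>
      isLinearMap_cross_const (isLinearMap_sub (isLinearMap_vField _ _) (isLinearMap_tField _ _ _)) _
    have hc : ∀ (u : ElemCoef k × M.traceCoef k) i, ContinuousOn (fun ξ =>
        (M.vField k K (l1 u) (M.bmap K i ξ) - M.tField k (l4 u) (M.faceOf K i) (M.bmap K i ξ)) ⨯₃
          M.normal K i ξ) M.shape.face := fun u i =>
      continuousOn_cross ((continuousOn_vField _ i).fun_sub (continuousOn_tField _ i)) (hn i)
    exact isBilinearMap_bdInt (fun i ξ _ => isBilinearMap_const_mul _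
      (isBilinearMap_dotProduct (hl i ξ) (hl i ξ))) fun u v i =>
        continuousOn_const.mul (continuousOn_dotProduct (hc u i) (hc v i))

theorem isBilinearMap_traceC : IsBilinearMap ℝ (traceC (k := k) C) := by
  classical
  let l1 : M.Elem → (M.Elem → ElemCoef k) × M.traceCoef k →ₗ[ℝ] (Fin 3 → Coef 3 k) := fun K =>
    LinearMap.fst ℝ _ _ ∘ₗ LinearMap.proj K ∘ₗ LinearMap.fst ℝ _ _
  let l2 : M.Elem → (M.Elem → ElemCoef k) × M.traceCoef k →ₗ[ℝ] (Fin 3 → Coef 3 k) := fun K =>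
    LinearMap.fst ℝ _ _ ∘ₗ LinearMap.snd ℝ _ _ ∘ₗ LinearMap.proj K ∘ₗ LinearMap.fst ℝ _ _
  let l4 : (M.Elem → ElemCoef k) × M.traceCoef k →ₗ[ℝ] M.traceCoef k := LinearMap.snd ℝ _ _
  refine isBilinearMap_sum fun K => isBilinearMap_sum fun i => ?_
  by_cases hb : M.IsBdry (M.faceOf K i)
  · simp only [if_pos hb]
    exact isBilinearMap_faceInt (fun ξ _ => isBilinearMap_dotProduct (isLinearMap_tField l4 _ _)
      (isLinearMap_tField LinearMap.id _ _)) fun u v =>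
        continuousOn_dotProduct (continuousOn_tField _ i) (continuousOn_tField _ i)
  · simp only [if_neg hb]
    exact isBilinearMap_faceInt (fun ξ _ => isBilinearMap_dotProduct
      (isLinearMap_const_cross (isLinearMap_hHat (l1 K) (l2 K) l4 i ξ) _)
      (isLinearMap_tField LinearMap.id _ _)) fun u v =>
        continuousOn_dotProduct (continuousOn_cross (M.continuousOn_normal K i)
          (continuousOn_hHat C (continuousOn_vField _ i) (continuousOn_vField _ i)
            (continuousOn_tField _ i))) (continuousOn_tField _ i)

/-! ### Definiteness of the forms -/

variable {Ω : Set R3} {p : ℕ} {M : Mesh Ω p} {C : Coeff M} {k : ℕ} {K : M.Elem}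

theorem weighted_integral_nonneg {w g : R3 → ℝ} (hw : ∀ x ∈ M.elem K, 0 < w x)
    (hg : ∀ x, 0 ≤ g x) : 0 ≤ ∫ x in M.elem K, w x * g x :=
  setIntegral_nonneg (M.measurableSet_elem K) fun x hx => mul_nonneg (hw x hx).le (hg x)

/-- A nonnegative integrand with zero integral vanishes almost everywhere. The weight is positive
but only measurable, so it is divided out first, and then continuity of `g` gives the statement
everywhere on the open element. -/
theorem eq_zero_of_weighted_integral {w g : R3 → ℝ} (hw : ∀ x ∈ M.elem K, 0 < w x)
    (hwi : IntegrableOn w (M.elem K)) (hg : ∀ x, 0 ≤ g x) (hgc : M.ElemCont K g)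
    (hgd : ContinuousOn g (M.elem K)) (h : ∫ x in M.elem K, w x * g x = 0) :
    ∀ x ∈ M.elem K, g x = 0 := by
  rw [setIntegral_eq_zero_iff_of_nonneg_ae _ (hgc.integrableOn_mul hwi)] at h
  · refine Measure.eqOn_open_of_ae_eq (μ := volume) (g := fun _ => (0 : ℝ)) ?_ (M.isOpen_elem K) hgd
      continuousOn_const
    filter_upwards [h, ae_restrict_mem (M.measurableSet_elem K)] with x h1 hx
    exact (mul_eq_zero.1 h1).resolve_left (hw x hx).ne'
  · filter_upwards [ae_restrict_mem (M.measurableSet_elem K)] with x hx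
    exact mul_nonneg (hw x hx).le (hg x)

theorem pos_of_le {f : R3 → ℝ} (hb : ∃ c B : ℝ, 0 < c ∧ ∀ x ∈ Ω, c ≤ f x ∧ f x ≤ B) :
    ∀ x ∈ M.elem K, 0 < f x := by
  obtain ⟨c, B, hc, h⟩ := hb
  exact fun x hx => hc.trans_le (h x (M.subset K hx)).1

theorem dotProduct_self_nonneg' (a : R3) : 0 ≤ a ⬝ᵥ a := dotProduct_self_star_nonneg a

theorem continuousOn_elem_of_c1On {E : Type*} [NormedAddCommGroup E] [NormedSpace ℝ E] {f : R3 → E}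
    (hf : M.C1On K f) : ContinuousOn f (M.elem K) :=
  fun _ hx => (hf.differentiableAt hx).continuousAt.continuousWithinAt

theorem vField_weighted_nonneg {w : R3 → ℝ} (hw : ∀ x ∈ M.elem K, 0 < w x) (c : Fin 3 → Coef 3 k) :
    0 ≤ ∫ x in M.elem K, w x * (M.vField k K c x ⬝ᵥ M.vField k K c x) :=
  weighted_integral_nonneg hw fun _ => dotProduct_self_nonneg' _

theorem vField_weighted_eq_zero {w : R3 → ℝ} (hw : ∀ x ∈ M.elem K, 0 < w x)
    (hwi : IntegrableOn w (M.elem K)) {c : Fin 3 → Coef 3 k}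
    (h : ∫ x in M.elem K, w x * (M.vField k K c x ⬝ᵥ M.vField k K c x) = 0) : c = 0 := by
  have hc := continuousOn_elem_of_c1On (Mesh.inV_vField K c).c1On
  have := eq_zero_of_weighted_integral hw hwi (fun _ => dotProduct_self_nonneg' _)
    (Mesh.ElemCont.dotProduct (vField_elemCont c) (vField_elemCont c))
    (continuousOn_dotProduct hc hc) h
  exact Mesh.vField_eq_zero fun x hx => dotProduct_self_eq_zero.1 (this x hx)

theorem massC_nonneg (u : ElemCoef k) : 0 ≤ massC C K u u := by
  refine add_nonneg (add_nonneg (vField_weighted_nonneg (pos_of_le C.ε_bdd) _)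
    (vField_weighted_nonneg (pos_of_le C.μ_bdd) _)) (mul_nonneg (by positivity) ?_)
  exact setIntegral_nonneg (M.measurableSet_elem K) fun x _ => mul_self_nonneg _

/-- The form is a sum of three nonnegative terms, so each vanishes, and a polynomial that vanishes
on the open element has zero coefficients. -/
theorem massC_eq_zero {u : ElemCoef k} (h : massC C K u u = 0) : u = 0 := by
  have h1 := vField_weighted_nonneg (pos_of_le (K := K) C.ε_bdd) u.1
  have h2 := vField_weighted_nonneg (pos_of_le (K := K) C.μ_bdd) u.2.1
  have hα : 0 < 1 / C.α₁ ^ 2 := by have := C.α₁_pos; positivity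
  have h3 : 0 ≤ ∫ x in M.elem K, M.sField k K u.2.2 x * M.sField k K u.2.2 x :=
    setIntegral_nonneg (M.measurableSet_elem K) fun x _ => mul_self_nonneg _
  have h3' := mul_nonneg hα.le h3
  rw [massC, localRate] at h
  have e1 := vField_weighted_eq_zero (pos_of_le C.ε_bdd) (integrableOn_of_le C.ε_meas C.ε_bdd K)
    (c := u.1) (by linarith)
  have e2 := vField_weighted_eq_zero (pos_of_le C.μ_bdd) (integrableOn_of_le C.μ_meas C.μ_bdd K)
    (c := u.2.1) (by linarith)
  have e3 : ∫ x in M.elem K, M.sField k K u.2.2 x * M.sField k K u.2.2 x = 0 := by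
    have : 1 / C.α₁ ^ 2 * ∫ x in M.elem K, M.sField k K u.2.2 x * M.sField k K u.2.2 x = 0 := by
      linarith
    exact (mul_eq_zero.1 this).resolve_left hα.ne'
  have hc := continuousOn_elem_of_c1On (Mesh.inW_sField K u.2.2).c1On
  have e4 := eq_zero_of_weighted_integral (w := fun _ => 1) (fun _ _ => one_pos)
    (Mesh.ElemCont.const 1).integrableOn (fun _ => mul_self_nonneg _)
    ((sField_elemCont u.2.2).mul (sField_elemCont u.2.2)) (hc.mul hc) (by simpa using e3)
  have e5 := Mesh.sField_eq_zero (c := u.2.2) fun x hx => mul_self_eq_zero.1 (e4 x hx)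
  exact Prod.ext e1 (Prod.ext e2 e5)

theorem massC_pos {u : ElemCoef k} (hu : u ≠ 0) : 0 < massC C K u u :=
  lt_of_le_of_ne (massC_nonneg u) fun h => hu (massC_eq_zero h.symm)

theorem massC_sum_pos {u : M.Elem → ElemCoef k} (hu : u ≠ 0) :
    0 < ∑ K, massC C K (u K) (u K) := by
  obtain ⟨K, hK⟩ := Function.ne_iff.1 hu
  exact Finset.sum_pos' (fun K _ => massC_nonneg _) ⟨K, Finset.mem_univ K, massC_pos hK⟩

theorem massC_comm (u q : ElemCoef k) : massC C K u q = massC C K q u := by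
  simp only [massC, localRate]
  refine congrArg₂ HAdd.hAdd (congrArg₂ HAdd.hAdd (elem_integral_congr fun x _ => ?_)
    (elem_integral_congr fun x _ => ?_)) (congrArg _ (elem_integral_congr fun x _ => mul_comm _ _))
  · rw [dotProduct_comm]
  · rw [dotProduct_comm]

theorem traceC_zero_eq (s : M.traceCoef k) : ∃ c : M.Elem → M.shape.Idx → ℝ, (∀ K i, 0 < c K i) ∧
    traceC C (0, s) s = ∑ K, ∑ i, c K i * M.faceInt K i fun ξ =>
      M.tField k s (M.faceOf K i) (M.bmap K i ξ) ⬝ᵥ M.tField k s (M.faceOf K i) (M.bmap K i ξ) := by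
  classical
  -- On the boundary the trace form is the plain `L²` product. Inside it carries the factor `τ`,
  -- because `n × (ê × n) = ê` for tangential `ê`.
  refine ⟨fun K i => if M.IsBdry (M.faceOf K i) then 1 else C.τ K i, fun K i => ?_, ?_⟩
  · dsimp only
    split_ifs
    exacts [one_pos, C.τ_pos K i]
  · refine Finset.sum_congr rfl fun K _ => Finset.sum_congr rfl fun i _ => ?_
    by_cases hb : M.IsBdry (M.faceOf K i)
    · simp only [if_pos hb, one_mul]
    · simp only [if_neg hb]
      rw [← Mesh.faceInt_const_mul]
      refine Mesh.faceInt_congr fun ξ hξ => ?_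
      have h1 := (Mesh.inS_tField s).dotProduct_normal (K := K) (i := i) hξ
      have h2 := M.normal_dotProduct_self K (i := i) hξ
      set n := M.normal K i ξ
      set a := M.tField k s (M.faceOf K i) (M.bmap K i ξ) with ha
      have h3 : hHat C K (M.vField k K 0) (M.vField k K 0) (M.tField k s) i ξ
          = C.τ K i • (a ⨯₃ n) := by
        simp only [hHat, map_zero, Pi.zero_apply, zero_sub, tang, LinearMap.zero_apply, ← ha, map_neg,
          LinearMap.neg_apply, smul_neg, neg_neg]
        rfl
      have h4 : n ⨯₃ (a ⨯₃ n) = a := by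
        rw [cross_cross_eq_smul_sub_smul', h1, h2, one_smul, zero_smul, sub_zero]
      change (n ⨯₃ hHat C K (M.vField k K 0) (M.vField k K 0) (M.tField k s) i ξ) ⬝ᵥ a = _
      rw [h3, map_smul, h4, smul_dotProduct, smul_eq_mul]

/-- All weights are positive, so a vanishing form makes the trace zero almost everywhere on each
face, then everywhere by continuity. Every face is seen by some element, so the coefficients vanish.
Positivity of `τ` and the boundary equation for `ê` are both essential here. -/
theorem traceC_pos {s : M.traceCoef k} (hs : s ≠ 0) : 0 < traceC C (0, s) s := by
  obtain ⟨c, hc, h⟩ := traceC_zero_eq (C := C) s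
  have hf : ∀ K i, 0 ≤ M.faceInt K i fun ξ =>
      M.tField k s (M.faceOf K i) (M.bmap K i ξ) ⬝ᵥ M.tField k s (M.faceOf K i) (M.bmap K i ξ) :=
    fun K i => setIntegral_nonneg M.shape.measurableSet_face fun ξ hξ =>
      mul_nonneg (dotProduct_self_nonneg' _) (M.areaElem_pos K hξ).le
  have hn : ∀ K i, 0 ≤ c K i * M.faceInt K i fun ξ =>
      M.tField k s (M.faceOf K i) (M.bmap K i ξ) ⬝ᵥ M.tField k s (M.faceOf K i) (M.bmap K i ξ) :=
    fun K i => mul_nonneg (hc K i).le (hf K i)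
  rw [h]
  refine lt_of_le_of_ne (Finset.sum_nonneg fun K _ => Finset.sum_nonneg fun i _ => hn K i)
    fun h0 => hs ?_
  refine Mesh.tField_eq_zero fun F η hη => ?_
  obtain ⟨K, i, rfl⟩ := Mesh.exists_faceOf_eq F
  have h1 := (Finset.sum_eq_zero_iff_of_nonneg fun K _ => Finset.sum_nonneg fun i _ => hn K i).1
    h0.symm K (Finset.mem_univ K)
  have h2 := (Finset.sum_eq_zero_iff_of_nonneg fun i _ => hn K i).1 h1 i (Finset.mem_univ i)
  have h3 := (mul_eq_zero.1 h2).resolve_left (hc K i).ne'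
  have hcont := continuousOn_tField (K := K) s i
  rw [Mesh.faceInt, setIntegral_eq_zero_iff_of_nonneg_ae] at h3
  · have h4 : EqOn (fun ξ => M.tField k s (M.faceOf K i) (M.bmap K i ξ)) (fun _ => 0)
        (interior M.shape.face) := by
      refine Measure.eqOn_open_of_ae_eq (μ := volume) ?_ isOpen_interior
        (hcont.mono interior_subset) continuousOn_const
      rw [Measure.restrict_congr_set M.shape.interior_face_ae_eq]
      filter_upwards [h3, ae_restrict_mem M.shape.measurableSet_face] with ξ h5 hξ
      exact dotProduct_self_eq_zero.1 ((mul_eq_zero.1 h5).resolve_right (M.areaElem_pos K hξ).ne')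
    have h5 := h4.of_subset_closure hcont continuousOn_const interior_subset
      M.shape.subset_closure_interior_face
    obtain ⟨σ, hσ, he⟩ := M.compat K i
    obtain ⟨ξ, hξ, rfl⟩ : η ∈ σ '' M.shape.face := by rwa [hσ]
    rw [← he ξ hξ]
    exact h5 hξ
  · filter_upwards [ae_restrict_mem M.shape.measurableSet_face] with ξ hξ
    exact mul_nonneg (dotProduct_self_nonneg' _) (M.areaElem_pos K hξ).le
  · exact Mesh.integrableOn_mul_areaElem
      ((continuousOn_dotProduct hcont hcont).integrableOn_compact M.shape.isCompact_face)

/-! ### The data -/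

theorem isLinearMap_setIntegral {U X : Type*} [AddCommGroup U] [Module ℝ U] [MeasurableSpace X]
    {μ : Measure X} {s : Set X} (hs : MeasurableSet s) {F : U → X → ℝ}
    (hF : ∀ x ∈ s, IsLinearMap ℝ fun u => F u x) (hi : ∀ u, IntegrableOn (F u) s μ) :
    IsLinearMap ℝ fun u => ∫ x in s, F u x ∂μ where
  map_add x y := by
    rw [← integral_add (hi _) (hi _)]
    exact setIntegral_congr_fun hs fun a ha => (hF a ha).map_add x y
  map_smul c x := by
    rw [← integral_smul]
    exact setIntegral_congr_fun hs fun a ha => (hF a ha).map_smul c x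

theorem isLinearMap_dotProduct {U : Type*} [AddCommGroup U] [Module ℝ U] {f : U → R3}
    (hf : IsLinearMap ℝ f) (a : R3) : IsLinearMap ℝ fun u => a ⬝ᵥ f u where
  map_add x y := by rw [hf.map_add, dotProduct_add]
  map_smul c x := by rw [hf.map_smul, dotProduct_smul]

theorem isLinearMap_const_mul {U : Type*} [AddCommGroup U] [Module ℝ U] {f : U → ℝ}
    (hf : IsLinearMap ℝ f) (a : ℝ) : IsLinearMap ℝ fun u => a * f u where
  map_add x y := by rw [hf.map_add, mul_add]
  map_smul c x := by rw [hf.map_smul, smul_eq_mul, smul_eq_mul]; ring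

theorem isLinearMap_add {U : Type*} [AddCommGroup U] [Module ℝ U] {f g : U → ℝ}
    (hf : IsLinearMap ℝ f) (hg : IsLinearMap ℝ g) : IsLinearMap ℝ fun u => f u + g u where
  map_add x y := by rw [hf.map_add, hg.map_add]; ring
  map_smul c x := by rw [hf.map_smul, hg.map_smul, smul_add]

theorem isLinearMap_neg {U : Type*} [AddCommGroup U] [Module ℝ U] {f : U → ℝ}
    (hf : IsLinearMap ℝ f) : IsLinearMap ℝ fun u => - f u := by
  simpa using isLinearMap_const_mul hf (-1)

theorem isLinearMap_sum {U ι : Type*} [AddCommGroup U] [Module ℝ U] {s : Finset ι} {f : ι → U → ℝ}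
    (hf : ∀ i, IsLinearMap ℝ (f i)) : IsLinearMap ℝ fun u => ∑ i ∈ s, f i u where
  map_add x y := by simp only [(hf _).map_add, Finset.sum_add_distrib]
  map_smul c x := by simp only [(hf _).map_smul, Finset.smul_sum]

theorem isLinearMap_loadC {j : R3 → R3} {ρ : R3 → ℝ} (hj : IntegrableOn j (M.elem K))
    (hρ : IntegrableOn ρ (M.elem K)) : IsLinearMap ℝ (loadC (k := k) C K j ρ) := by
  let l1 : ElemCoef k →ₗ[ℝ] (Fin 3 → Coef 3 k) := LinearMap.fst ℝ _ _
  let l3 : ElemCoef k →ₗ[ℝ] Coef 3 k := LinearMap.snd ℝ _ _ ∘ₗ LinearMap.snd ℝ _ _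
  unfold loadC load
  have h1 : IsLinearMap ℝ fun q => ∫ x in M.elem K, j x ⬝ᵥ M.vField k K (l1 q) x :=
    isLinearMap_setIntegral (M.measurableSet_elem K) (fun x _ => isLinearMap_dotProduct
      (isLinearMap_vField l1 x) _) fun u =>
        Mesh.ElemCont.integrableOn_dotProduct (vField_elemCont _) hj
  have h2 : IsLinearMap ℝ fun q => ∫ x in M.elem K, ρ x / C.ε₀ * M.sField k K (l3 q) x :=
    isLinearMap_setIntegral (M.measurableSet_elem K) (fun x _ => isLinearMap_const_mul
      (isLinearMap_sField l3 x) _) fun u => (sField_elemCont _).integrableOn_mul (hρ.div_const _)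
  exact isLinearMap_add (isLinearMap_neg h1) h2

theorem isLinearMap_traceLoad {einc : R3 → R3} (hinc : ∀ K i, M.IsBdry (M.faceOf K i) →
      IntegrableOn (fun ξ => einc (M.bmap K i ξ)) M.shape.face) :
    IsLinearMap ℝ fun m : M.traceCoef k => traceLoad M einc (M.tField k m) := by
  classical
  refine isLinearMap_neg (isLinearMap_sum fun K => isLinearMap_sum fun i => ?_)
  by_cases hb : M.IsBdry (M.faceOf K i)
  · simp only [if_pos hb]
    refine isLinearMap_setIntegral M.shape.measurableSet_face (fun ξ _ => ?_) fun m =>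
      Mesh.integrableOn_mul_areaElem ?_
    · simp only [mul_comm _ (areaElem _ _)]
      exact isLinearMap_const_mul (isLinearMap_dotProduct
        (isLinearMap_tField LinearMap.id _ _) _) _
    · simp only [dotProduct_comm _ (M.tField k m _ _)]
      exact integrableOn_dotProduct_tang (continuousOn_tField m i) (hinc K i hb)
  · simp only [if_neg hb]
    exact ⟨fun _ _ => by simp, fun _ _ => by simp⟩

/-- A uniformly Lipschitz integrand turns the `L²` distance of the data into an `L¹` distance, by
Hölder's inequality on a finite measure space. The general `B` covers `j`, `ρ` and the incident
field at once. -/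
theorem ContInL2.continuousOn_integral {α E : Type*} [MeasurableSpace α] [NormedAddCommGroup E]
    {μ : Measure α} [IsFiniteMeasure μ] {T : ℝ} {f : ℝ → α → E} (hf : ContInL2 μ T f)
    {B : α → E → ℝ} {c : ℝ} (hB : ∀ᵐ x ∂μ, ∀ a b, |B x a - B x b| ≤ c * ‖a - b‖)
    (hi : ∀ t ∈ Icc 0 T, Integrable (fun x => B x (f t x)) μ) :
    ContinuousOn (fun t => ∫ x, B x (f t x) ∂μ) (Icc 0 T) := by
  intro t ht
  refine tendsto_integral_of_L1' _ (hi t ht).1 ?_ ?_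
  · filter_upwards [self_mem_nhdsWithin] with s hs using hi s hs
  · have hbound : ∀ᶠ s in 𝓝[Icc 0 T] t,
        eLpNorm ((fun x => B x (f s x)) - fun x => B x (f t x)) 1 μ
          ≤ ENNReal.ofReal c * (eLpNorm (f s - f t) 2 μ * μ univ ^ (1 / (1 : ENNReal).toReal - 1 / (2 : ENNReal).toReal)) := by
      filter_upwards [self_mem_nhdsWithin] with s hs
      refine (eLpNorm_le_mul_eLpNorm_of_ae_le_mul (g := f s - f t) (c := c) ?_ 1).trans ?_
      · filter_upwards [hB] with x hx using hx _ _
      · gcongr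
        exact eLpNorm_le_eLpNorm_mul_rpow_measure_univ (by norm_num)
          ((hf.1 s hs).1.sub (hf.1 t ht).1)
    have hfin : μ univ ^ (1 / (1 : ENNReal).toReal - 1 / (2 : ENNReal).toReal) ≠ ⊤ :=
      ENNReal.rpow_ne_top_of_nonneg (by norm_num) (measure_ne_top μ univ)
    have hlim : Tendsto (fun s => ENNReal.ofReal c * (eLpNorm (f s - f t) 2 μ *
        μ univ ^ (1 / (1 : ENNReal).toReal - 1 / (2 : ENNReal).toReal))) (𝓝[Icc 0 T] t) (𝓝 0) := by
      have h1 := ENNReal.Tendsto.mul_const (b := μ univ ^ (1 / (1 : ENNReal).toReal -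
        1 / (2 : ENNReal).toReal)) (hf.2 t ht) (Or.inr hfin)
      have h2 := ENNReal.Tendsto.const_mul (a := ENNReal.ofReal c) h1 (Or.inr ENNReal.ofReal_ne_top)
      simpa using h2
    exact tendsto_of_tendsto_of_tendsto_of_le_of_le' tendsto_const_nhds hlim
      (Eventually.of_forall fun _ => bot_le) hbound

theorem ContInL2.mono_measure {α E : Type*} [MeasurableSpace α] [NormedAddCommGroup E]
    {μ ν : Measure α} {T : ℝ} {f : ℝ → α → E} (hf : ContInL2 μ T f) (h : ν ≤ μ) :
    ContInL2 ν T f :=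
  ⟨fun t ht => (hf.1 t ht).mono_measure h, fun t ht =>
    tendsto_of_tendsto_of_tendsto_of_le_of_le tendsto_const_nhds (hf.2 t ht)
      (fun _ => bot_le) fun _ => eLpNorm_mono_measure _ h⟩

/-- The norm on `R3` is the maximum norm, hence the factor 3. -/
theorem abs_dotProduct_le {a b : R3} {c : ℝ} (hb : ∀ i, |b i| ≤ c) : |a ⬝ᵥ b| ≤ 3 * c * ‖a‖ := by
  have h : ∀ i, |a i * b i| ≤ c * ‖a‖ := fun i => by
    rw [abs_mul, mul_comm]
    exact mul_le_mul (hb i) (norm_le_pi_norm a i) (abs_nonneg _) ((abs_nonneg _).trans (hb i))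
  rw [dotProduct, Fin.sum_univ_three]
  have h1 := abs_add_three (a 0 * b 0) (a 1 * b 1) (a 2 * b 2)
  linarith [h 0, h 1, h 2]

theorem continuousOn_loadC {T : ℝ} {j : ℝ → R3 → R3} {ρ : ℝ → R3 → ℝ}
    (hj : ContInL2 (volume.restrict Ω) T j) (hρ : ContInL2 (volume.restrict Ω) T ρ)
    (q : ElemCoef k) : ContinuousOn (fun t => loadC C K (j t) (ρ t) q) (Icc 0 T) := by
  have : IsFiniteMeasure (volume.restrict (M.elem K)) := ⟨by simpa using M.volume_elem_lt_top K⟩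
  have hle : volume.restrict (M.elem K) ≤ volume.restrict Ω :=
    Measure.restrict_mono (M.subset K) le_rfl
  refine ContinuousOn.add (ContinuousOn.neg ?_) ?_
  · choose c hc using fun i => (vField_elemCont (K := K) q.1 i).exists_bound
    have hc' : ∀ x ∈ M.elem K, ∀ i, |M.vField k K q.1 x i| ≤ max (c 0) (max (c 1) (c 2)) := by
      intro x hx i
      refine (hc i x hx).trans ?_
      rcases fin_three_cases i with rfl | rfl | rfl <;> simp
    refine (hj.mono_measure hle).continuousOn_integral (B := fun x a => a ⬝ᵥ M.vField k K q.1 x)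
      (c := 3 * max (c 0) (max (c 1) (c 2))) ?_ fun t ht => ?_
    · filter_upwards [ae_restrict_mem (M.measurableSet_elem K)] with x hx a b
      rw [← sub_dotProduct]
      exact abs_dotProduct_le (hc' x hx)
    · exact Mesh.ElemCont.integrableOn_dotProduct (vField_elemCont _)
        (Mesh.integrableOn_elem_of_memLp (hj.1 t ht) K)
  · obtain ⟨c, hc⟩ := (sField_elemCont (K := K) q.2.2).exists_bound
    refine (hρ.mono_measure hle).continuousOn_integral
      (B := fun x a => a / C.ε₀ * M.sField k K q.2.2 x) (c := c / C.ε₀) ?_ fun t ht => ?_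
    · filter_upwards [ae_restrict_mem (M.measurableSet_elem K)] with x hx a b
      rw [← sub_mul, ← sub_div, abs_mul, abs_div, abs_of_pos C.ε₀_pos, Real.norm_eq_abs,
        div_mul_eq_mul_div, div_mul_eq_mul_div, mul_comm c]
      have := C.ε₀_pos
      gcongr
      exact hc x hx
    · exact (sField_elemCont _).integrableOn_mul
        ((Mesh.integrableOn_elem_of_memLp (hρ.1 t ht) K).div_const _)

theorem ContInL2Bdry.integrableOn {T : ℝ} {einc : ℝ → R3 → R3} (h : ContInL2Bdry M T einc) {t : ℝ}
    (ht : t ∈ Icc 0 T) (K : M.Elem) (i : M.shape.Idx) (hb : M.IsBdry (M.faceOf K i)) :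
    IntegrableOn (fun ξ => einc t (M.bmap K i ξ)) M.shape.face := by
  have : IsFiniteMeasure (volume.restrict M.shape.face) :=
    ⟨by simpa using M.shape.isCompact_face.measure_lt_top⟩
  exact ((h K i hb).1 t ht).integrable (by norm_num)

theorem continuousOn_traceLoad {T : ℝ} {einc : ℝ → R3 → R3} (h : ContInL2Bdry M T einc)
    (m : M.traceCoef k) : ContinuousOn (fun t => traceLoad M (einc t) (M.tField k m)) (Icc 0 T) := by
  classical
  have : IsFiniteMeasure (volume.restrict M.shape.face) :=
    ⟨by simpa using M.shape.isCompact_face.measure_lt_top⟩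
  refine ContinuousOn.neg (continuousOn_finsetSum _ fun K _ => continuousOn_finsetSum _ fun i _ => ?_)
  by_cases hb : M.IsBdry (M.faceOf K i)
  swap
  · simp only [if_neg hb]
    exact continuousOn_const
  simp only [if_pos hb]
  have hg : ContinuousOn (fun ξ => areaElem (M.bmap K i) ξ •
      tang (M.normal K i ξ) (M.tField k m (M.faceOf K i) (M.bmap K i ξ))) M.shape.face :=
    (M.continuous_areaElem K i).continuousOn.smul
      (continuousOn_tang (M.continuousOn_normal K i) (continuousOn_tField m i))
  obtain ⟨c, hc⟩ := M.shape.isCompact_face.exists_bound_of_continuousOn hg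
  -- By symmetry of the tangential projection, projection and area element move to the bounded test
  -- function, which exhibits the Lipschitz constant in `a`.
  have hB : ∀ (ξ : R2) (a : R3), tang (M.normal K i ξ) a ⬝ᵥ
      M.tField k m (M.faceOf K i) (M.bmap K i ξ) * areaElem (M.bmap K i) ξ
      = a ⬝ᵥ (areaElem (M.bmap K i) ξ •
        tang (M.normal K i ξ) (M.tField k m (M.faceOf K i) (M.bmap K i ξ))) := fun ξ a => by
    rw [dotProduct_smul, tang_eq, tang_eq]
    simp only [sub_dotProduct, dotProduct_sub, smul_dotProduct, dotProduct_smul, smul_eq_mul,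
      dotProduct_comm a (M.normal K i ξ)]
    ring
  refine (h K i hb).continuousOn_integral
    (B := fun ξ a => tang (M.normal K i ξ) a ⬝ᵥ M.tField k m (M.faceOf K i) (M.bmap K i ξ) *
      areaElem (M.bmap K i) ξ) (c := 3 * c) ?_ fun t ht => ?_
  · filter_upwards [ae_restrict_mem M.shape.measurableSet_face] with ξ hξ a b
    rw [hB, hB, ← sub_dotProduct]
    exact abs_dotProduct_le fun l => (norm_le_pi_norm _ l).trans (hc ξ hξ)
  · refine Mesh.integrableOn_mul_areaElem ?_
    simp only [dotProduct_comm _ (M.tField k m _ _)]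
    exact integrableOn_dotProduct_tang (continuousOn_tField m i) (h.integrableOn ht K i hb)

/-! ### Energy balance for curves in finite-dimensional spaces -/

/-- By symmetry the derivative of `½ A(u, u)` is `A(u', u)`, and the identity is the integrated rate
equation. The rate and the dissipation are continuous because they are bilinear in continuous
curves. The source is their sum, so its integrability costs no further assumption. -/
theorem energy_balance {U W : Type*} [NormedAddCommGroup U] [NormedSpace ℝ U]
    [FiniteDimensional ℝ U] [NormedAddCommGroup W] [NormedSpace ℝ W] [FiniteDimensional ℝ W]
    {A : U → U → ℝ} {B : W → W → ℝ} (hA : IsBilinearMap ℝ A) (hAs : ∀ u v, A u v = A v u)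
    (hB : IsBilinearMap ℝ B) {T : ℝ} {u u' : ℝ → U} {w : ℝ → W}
    (hu : ∀ t ∈ Icc 0 T, HasDerivWithinAt u (u' t) (Icc 0 T) t) (hu' : ContinuousOn u' (Icc 0 T))
    (hw : ContinuousOn w (Icc 0 T)) {E d s : ℝ → ℝ} (hE : ∀ t ∈ Icc 0 T, E t = 1 / 2 * A (u t) (u t))
    (hd : ∀ t ∈ Icc 0 T, d t = B (w t) (w t)) (hs : ∀ t ∈ Icc 0 T, A (u' t) (u t) + d t = s t) :
    ∀ t ∈ Icc 0 T, IntervalIntegrable d volume 0 t ∧ IntervalIntegrable s volume 0 t ∧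
      E t + ∫ r in (0)..t, d r = E 0 + ∫ r in (0)..t, s r := by
  obtain ⟨a, ha⟩ := exists_clm_of_isBilinearMap hA
  obtain ⟨b, hb⟩ := exists_clm_of_isBilinearMap hB
  have huc : ContinuousOn u (Icc 0 T) := fun t ht => (hu t ht).continuousWithinAt
  have hdc : ContinuousOn d (Icc 0 T) :=
    ((b.continuous.comp_continuousOn hw).clm_apply hw).congr fun t ht => by
      rw [hd t ht, ← hb]; rfl
  have hrc : ContinuousOn (fun t => A (u' t) (u t)) (Icc 0 T) :=
    ((a.continuous.comp_continuousOn hu').clm_apply huc).congr fun t ht => (ha _ _).symm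
  have hsc : ContinuousOn s (Icc 0 T) := (hrc.add hdc).congr fun t ht => (hs t ht).symm
  have hEd : ∀ t ∈ Icc 0 T, HasDerivWithinAt E (A (u' t) (u t)) (Icc 0 T) t := by
    intro t ht
    have h1 : HasDerivWithinAt (fun r => a (u r)) (a (u' t)) (Icc 0 T) t :=
      a.hasFDerivAt.comp_hasDerivWithinAt t (hu t ht)
    have h2 := (h1.clm_apply (hu t ht)).const_mul (1 / 2)
    have h3 : 1 / 2 * (a (u' t) (u t) + a (u t) (u' t)) = A (u' t) (u t) := by
      rw [ha, ha, hAs (u t)]; ring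
    rw [h3] at h2
    exact h2.congr (fun r hr => by rw [hE r hr, ha]) (by rw [hE t ht, ha])
  intro t ht
  have hsub : uIcc 0 t ⊆ Icc 0 T := by
    rw [uIcc_of_le ht.1]; exact Icc_subset_Icc_right ht.2
  have hsub' : Icc 0 t ⊆ Icc 0 T := Icc_subset_Icc_right ht.2
  have hid := (hdc.mono hsub).intervalIntegrable (μ := volume)
  have hir := (hrc.mono hsub).intervalIntegrable (μ := volume)
  refine ⟨hid, (hsc.mono hsub).intervalIntegrable, ?_⟩
  have h1 : ∫ r in (0)..t, A (u' r) (u r) = E t - E 0 := by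
    refine intervalIntegral.integral_eq_sub_of_hasDeriv_right_of_le ht.1
      (fun r hr => (hEd r (hsub' hr)).continuousWithinAt.mono hsub') (fun r hr => ?_) hir
    have hr' : r ∈ Icc 0 T := hsub' (Ioo_subset_Icc_self hr)
    exact (hEd r hr').mono_of_mem_nhdsWithin
      (mem_of_superset (Ioc_mem_nhdsGT (hr.2.trans_le ht.2)) fun x hx => ⟨hr.1.le.trans hx.1.le, hx.2⟩)
  have h2 : ∫ r in (0)..t, s r = (∫ r in (0)..t, A (u' r) (u r)) + ∫ r in (0)..t, d r := by
    rw [← intervalIntegral.integral_add hir hid]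
    exact intervalIntegral.integral_congr fun r hr => (hs r (hsub hr)).symm
  rw [h2, h1]
  ring

/-! ### Coefficients of time-dependent fields -/

variable {Ω : Set R3} {p : ℕ} {M : Mesh Ω p} {C : Coeff M} {k : ℕ} {K : M.Elem} {T : ℝ}

theorem hasDerivWithinAt_of_linear {V E X : Type*} [NormedAddCommGroup V] [NormedSpace ℝ V]
    [FiniteDimensional ℝ V] [NormedAddCommGroup E] [NormedSpace ℝ E] (Φ : V →ₗ[ℝ] (X → E))
    {c : ℝ → V} {c' : V} {s : Set ℝ} {t : ℝ} (hc : HasDerivWithinAt c c' s t) (x : X) :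
    HasDerivWithinAt (fun r => Φ (c r) x) (Φ c' x) s t :=
  (LinearMap.toContinuousLinearMap
    ((LinearMap.proj x : (X → E) →ₗ[ℝ] E) ∘ₗ Φ)).hasFDerivAt.comp_hasDerivWithinAt t hc

/-- The reconstruction from coefficients is linear and finite-dimensional, hence commutes with the
time derivative. Positivity of `T` makes one-sided derivatives on `[0, T]` unique. -/
theorem dt_eqOn {V E : Type*} [NormedAddCommGroup V] [NormedSpace ℝ V]
    [FiniteDimensional ℝ V] [NormedAddCommGroup E] [NormedSpace ℝ E] (hT : 0 < T)
    (Φ : V →ₗ[ℝ] (R3 → E)) {c c' : ℝ → V}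
    (hc : ∀ t ∈ Icc 0 T, HasDerivWithinAt c (c' t) (Icc 0 T) t) {f : ℝ → R3 → E} {D : Set R3}
    (hf : ∀ t ∈ Icc 0 T, EqOn (f t) (Φ (c t)) D) {t : ℝ} (ht : t ∈ Icc 0 T) :
    EqOn (dt T f t) (Φ (c' t)) D := fun x hx =>
  ((hasDerivWithinAt_of_linear Φ (hc t ht) x).congr (fun s hs => hf s hs hx)
    (hf t ht hx)).derivWithin (uniqueDiffOn_Icc hT t ht)

theorem hasDerivWithinAt_coef {u : ℝ → ElemCoef k} {u' : ElemCoef k} {s : Set ℝ} {t : ℝ}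
    (hu : HasDerivWithinAt u u' s t) : HasDerivWithinAt (fun t => (u t).1) u'.1 s t ∧
      HasDerivWithinAt (fun t => (u t).2.1) u'.2.1 s t ∧
      HasDerivWithinAt (fun t => (u t).2.2) u'.2.2 s t :=
  ⟨hu.fst, hu.snd.fst, hu.snd.snd⟩

/-- `u` is the vector of coefficients of `(e, h, φ)` on `K`. -/
structure Represents (K : M.Elem) (u : ElemCoef k) (e h : R3 → R3) (φ : R3 → ℝ) : Prop where
  e : EqOn e (M.vField k K u.1) (M.map K '' M.shape.body)
  h : EqOn h (M.vField k K u.2.1) (M.map K '' M.shape.body)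
  φ : EqOn φ (M.sField k K u.2.2) (M.map K '' M.shape.body)

theorem represents_self (K : M.Elem) (u : ElemCoef k) :
    Represents K u (M.vField k K u.1) (M.vField k K u.2.1) (M.sField k K u.2.2) :=
  ⟨fun _ _ => rfl, fun _ _ => rfl, fun _ _ => rfl⟩

theorem exists_represents {e h : R3 → R3} {φ : R3 → ℝ} (he : M.InV k K e) (hh : M.InV k K h)
    (hφ : M.InW k K φ) : ∃ u : ElemCoef k, Represents K u e h φ := by
  obtain ⟨a, ha⟩ := he.exists_vField
  obtain ⟨b, hb⟩ := hh.exists_vField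
  obtain ⟨c, hc⟩ := hφ.exists_sField
  exact ⟨(a, b, c), ha, hb, hc⟩

theorem sField_separating (c : Coef 3 k)
    (h : ∀ x : M.map K '' M.shape.body, (LinearMap.proj (x : R3) ∘ₗ M.sField k K) c = 0) : c = 0 :=
  Mesh.sField_eq_zero fun x hx => h ⟨x, M.elem_subset_image K hx⟩

theorem differentiableOn_coef {c : ℝ → Coef 3 k} {f : ℝ → R3 → ℝ} {s : Set ℝ}
    (hf : ∀ t ∈ s, EqOn (f t) (M.sField k K (c t)) (M.map K '' M.shape.body))
    (hd : ∀ x ∈ M.map K '' M.shape.body, DifferentiableOn ℝ (fun t => f t x) s) :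
    DifferentiableOn ℝ c s :=
  differentiableOn_of_separating sField_separating fun x =>
    (hd x x.2).congr fun t ht => (hf t ht x.2).symm

theorem differentiableOn_vCoef {c : ℝ → Fin 3 → Coef 3 k} {f : ℝ → R3 → R3} {s : Set ℝ}
    (hf : ∀ t ∈ s, EqOn (f t) (M.vField k K (c t)) (M.map K '' M.shape.body))
    (hd : ∀ x ∈ M.map K '' M.shape.body, DifferentiableOn ℝ (fun t => f t x) s) :
    DifferentiableOn ℝ c s :=
  differentiableOn_pi.2 fun i => differentiableOn_coef (f := fun t x => f t x i)
    (fun t ht _ hx => congrFun (hf t ht hx) i) fun x hx => differentiableOn_pi.1 (hd x hx) i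

/-- Coefficients are chosen separately at each time. Their differentiability is not built into the
choice but follows because evaluations at points separate polynomials. -/
theorem exists_represents_curve (hT : 0 < T) {e h : ℝ → R3 → R3} {φ : ℝ → R3 → ℝ}
    (he : ∀ t ∈ Icc 0 T, M.InV k K (e t)) (hh : ∀ t ∈ Icc 0 T, M.InV k K (h t))
    (hφ : ∀ t ∈ Icc 0 T, M.InW k K (φ t))
    (hed : ∀ x ∈ M.map K '' M.shape.body, DifferentiableOn ℝ (fun t => e t x) (Icc 0 T))
    (hhd : ∀ x ∈ M.map K '' M.shape.body, DifferentiableOn ℝ (fun t => h t x) (Icc 0 T))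
    (hφd : ∀ x ∈ M.map K '' M.shape.body, DifferentiableOn ℝ (fun t => φ t x) (Icc 0 T)) :
    ∃ u u' : ℝ → ElemCoef k, (∀ t ∈ Icc 0 T, HasDerivWithinAt u (u' t) (Icc 0 T) t) ∧
      ∀ t ∈ Icc 0 T, Represents K (u t) (e t) (h t) (φ t) ∧
        Represents K (u' t) (dt T e t) (dt T h t) (dt T φ t) := by
  choose! u hu using fun t ht => exists_represents (he t ht) (hh t ht) (hφ t ht)
  have h1 : DifferentiableOn ℝ u (Icc 0 T) :=
    (differentiableOn_vCoef (fun t ht => (hu t ht).e) hed).prodMk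
      ((differentiableOn_vCoef (fun t ht => (hu t ht).h) hhd).prodMk
        (differentiableOn_coef (fun t ht => (hu t ht).φ) hφd))
  have h2 : ∀ t ∈ Icc 0 T, HasDerivWithinAt u (derivWithin u (Icc 0 T) t) (Icc 0 T) t :=
    fun t ht => (h1 t ht).hasDerivWithinAt
  refine ⟨u, derivWithin u (Icc 0 T), h2, fun t ht => ⟨hu t ht, ?_, ?_, ?_⟩⟩
  · exact dt_eqOn hT (M.vField k K) (fun s hs => (hasDerivWithinAt_coef (h2 s hs)).1)
      (fun s hs => (hu s hs).e) ht
  · exact dt_eqOn hT (M.vField k K) (fun s hs => (hasDerivWithinAt_coef (h2 s hs)).2.1)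
      (fun s hs => (hu s hs).h) ht
  · exact dt_eqOn hT (M.sField k K) (fun s hs => (hasDerivWithinAt_coef (h2 s hs)).2.2)
      (fun s hs => (hu s hs).φ) ht

/-- The fields with coefficients `u` are differentiable in time. -/
theorem represents_dt (hT : 0 < T) {u u' : ℝ → ElemCoef k}
    (hu : ∀ t ∈ Icc 0 T, HasDerivWithinAt u (u' t) (Icc 0 T) t) {t : ℝ} (ht : t ∈ Icc 0 T) :
    Represents K (u' t) (dt T (fun t => M.vField k K (u t).1) t)
      (dt T (fun t => M.vField k K (u t).2.1) t) (dt T (fun t => M.sField k K (u t).2.2) t) where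
  e := dt_eqOn hT (M.vField k K) (fun s hs => (hasDerivWithinAt_coef (hu s hs)).1)
    (fun _ _ _ _ => rfl) ht
  h := dt_eqOn hT (M.vField k K) (fun s hs => (hasDerivWithinAt_coef (hu s hs)).2.1)
    (fun _ _ _ _ => rfl) ht
  φ := dt_eqOn hT (M.sField k K) (fun s hs => (hasDerivWithinAt_coef (hu s hs)).2.2)
    (fun _ _ _ _ => rfl) ht

theorem differentiableOn_fields {u u' : ℝ → ElemCoef k} {s : Set ℝ}
    (hu : ∀ t ∈ s, HasDerivWithinAt u (u' t) s t) (x : R3) :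
    DifferentiableOn ℝ (fun t => M.vField k K (u t).1 x) s ∧
      DifferentiableOn ℝ (fun t => M.vField k K (u t).2.1 x) s ∧
      DifferentiableOn ℝ (fun t => M.sField k K (u t).2.2 x) s :=
  ⟨fun t ht => (hasDerivWithinAt_of_linear (M.vField k K)
      (hasDerivWithinAt_coef (hu t ht)).1 x).differentiableWithinAt,
    fun t ht => (hasDerivWithinAt_of_linear (M.vField k K)
      (hasDerivWithinAt_coef (hu t ht)).2.1 x).differentiableWithinAt,
    fun t ht => (hasDerivWithinAt_of_linear (M.sField k K)
      (hasDerivWithinAt_coef (hu t ht)).2.2 x).differentiableWithinAt⟩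

section Represents

variable {u u' : ElemCoef k} {e h et ht : R3 → R3} {φ φt : R3 → ℝ}

theorem Represents.unique {v : ElemCoef k} (hu : Represents K u e h φ) (hv : Represents K v e h φ) :
    u = v := by
  have hs := M.elem_subset_image K
  have h1 : u.1 - v.1 = 0 := Mesh.vField_eq_zero (K := K) fun x hx => by
    rw [map_sub, Pi.sub_apply, ← hu.e (hs hx), ← hv.e (hs hx), sub_self]
  have h2 : u.2.1 - v.2.1 = 0 := Mesh.vField_eq_zero (K := K) fun x hx => by
    rw [map_sub, Pi.sub_apply, ← hu.h (hs hx), ← hv.h (hs hx), sub_self]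
  have h3 : u.2.2 - v.2.2 = 0 := Mesh.sField_eq_zero (K := K) fun x hx => by
    rw [map_sub, Pi.sub_apply, ← hu.φ (hs hx), ← hv.φ (hs hx), sub_self]
  exact Prod.ext (sub_eq_zero.1 h1) (Prod.ext (sub_eq_zero.1 h2) (sub_eq_zero.1 h3))

theorem Represents.congr {e' h' : R3 → R3} {φ' : R3 → ℝ} (hu : Represents K u e h φ)
    (he : EqOn e' e (M.map K '' M.shape.body)) (hh : EqOn h' h (M.map K '' M.shape.body))
    (hφ : EqOn φ' φ (M.map K '' M.shape.body)) : Represents K u e' h' φ' :=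
  ⟨he.trans hu.e, hh.trans hu.h, hφ.trans hu.φ⟩

theorem Represents.localRate (hu' : Represents K u' et ht φt) (hu : Represents K u e h φ) :
    localRate C K et ht φt e h φ = massC C K u' u :=
  localRate_congr hu'.e hu'.h hu'.φ hu.e hu.h hu.φ

theorem Represents.localEnergy (hu : Represents K u e h φ) :
    localEnergy C K e h φ = 1 / 2 * massC C K u u := by
  rw [← hu.localRate hu, GLMHDG.localEnergy, GLMHDG.localRate]
  have : 1 / (2 * C.α₁ ^ 2) = 1 / 2 * (1 / C.α₁ ^ 2) := by rw [one_div_mul_one_div]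
  rw [this]
  ring

theorem Represents.dissip {eh : M.Face → R3 → R3} {s : M.traceCoef k} (hu : Represents K u e h φ)
    (hs : ∀ i, ∀ ξ ∈ M.shape.face,
      eh (M.faceOf K i) (M.bmap K i ξ) = M.tField k s (M.faceOf K i) (M.bmap K i ξ)) :
    phiDissip C K φ + tauForm C K
        (fun i ξ => e (M.bmap K i ξ) - eh (M.faceOf K i) (M.bmap K i ξ))
        (fun i ξ => e (M.bmap K i ξ) - eh (M.faceOf K i) (M.bmap K i ξ))
      = dissipC C K (u, s) (u, s) := by
  have h1 : ∀ i, ∀ ξ ∈ M.shape.face, e (M.bmap K i ξ) - eh (M.faceOf K i) (M.bmap K i ξ)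
      = M.vField k K u.1 (M.bmap K i ξ) - M.tField k s (M.faceOf K i) (M.bmap K i ξ) :=
    fun i ξ hξ => by rw [hu.e (Mesh.mem_closure_of_bmap hξ), hs i ξ hξ]
  rw [phiDissip_congr hu.φ, tauForm_congr h1 h1]
  rfl

/-- Test functions are also represented by coefficients, and neither side sees values off the closed
element. The equations for functions therefore become equations between vectors. -/
theorem Represents.localEqs_iff {eh : M.Face → R3 → R3} {s : M.traceCoef k} {j : R3 → R3}
    {ρ : R3 → ℝ} (hu : Represents K u e h φ) (hu' : Represents K u' et ht φt)
    (hs : ∀ i, ∀ ξ ∈ M.shape.face,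
      eh (M.faceOf K i) (M.bmap K i ξ) = M.tField k s (M.faceOf K i) (M.bmap K i ξ)) :
    LocalEqs C k K e h φ et ht φt eh j ρ ↔
      ∀ q : ElemCoef k, massC C K u' q + stiffC C K (u, s) q = loadC C K j ρ q := by
  rw [GLMHDG.localEqs_iff]
  constructor
  · intro H q
    rw [loadC, ← H _ _ _ (Mesh.inV_vField K q.1) (Mesh.inV_vField K q.2.1) (Mesh.inW_sField K q.2.2),
      hu'.localRate (represents_self K q), stiff_congr hu.e hu.h hu.φ hs (fun _ _ => rfl)
        (fun _ _ => rfl) (fun _ _ => rfl)]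
    rfl
  · intro H v w ψ hv hw hψ
    obtain ⟨q, hq⟩ := exists_represents hv hw hψ
    rw [hu'.localRate hq, stiff_congr hu.e hu.h hu.φ hs hq.e hq.h hq.φ, load_congr hq.e hq.φ]
    exact H q

end Represents

theorem traceCoef_separating (c : M.traceCoef k) (h : ∀ r : M.Face × M.shape.face × Fin 3,
    (LinearMap.proj r.2.2 ∘ₗ LinearMap.proj (M.faceMap r.1 r.2.1) ∘ₗ LinearMap.proj r.1 ∘ₗ
      M.tField k) c = 0) : c = 0 :=
  Mesh.tField_eq_zero fun F ξ hξ => funext fun i => h (F, ⟨ξ, hξ⟩, i)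

theorem exists_trace_curve {eh : ℝ → M.Face → R3 → R3} (heh : ∀ t ∈ Icc 0 T, M.InS k (eh t)) :
    ∃ s : ℝ → M.traceCoef k, ∀ t ∈ Icc 0 T, ∀ F,
      EqOn (eh t F) (M.tField k (s t) F) (M.faceMap F '' M.shape.face) := by
  choose! s hs using fun t ht => (heh t ht).exists_tField
  exact ⟨s, hs⟩

theorem continuousOn_traceCoef {eh : ℝ → M.Face → R3 → R3} {s : ℝ → M.traceCoef k}
    (hs : ∀ t ∈ Icc 0 T, ∀ F, EqOn (eh t F) (M.tField k (s t) F) (M.faceMap F '' M.shape.face))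
    (hc : ∀ F, ∀ ξ ∈ M.shape.face, ContinuousOn (fun t => eh t F (M.faceMap F ξ)) (Icc 0 T)) :
    ContinuousOn s (Icc 0 T) :=
  continuousOn_of_separating traceCoef_separating fun r =>
    (continuousOn_pi.1 (hc r.1 r.2.1 r.2.1.2) r.2.2).congr fun t ht =>
      congrFun (hs t ht r.1 (mem_image_of_mem _ r.2.1.2)).symm r.2.2

/-! ### The local problem -/

variable {Ω : Set R3} {p : ℕ} {M : Mesh Ω p} {C : Coeff M} {k : ℕ} {K : M.Elem} {T : ℝ}

theorem isBilinearMap_zero {U V : Type*} [AddCommGroup U] [Module ℝ U] [AddCommGroup V]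
    [Module ℝ V] : IsBilinearMap ℝ fun (_ : U) (_ : V) => (0 : ℝ) :=
  ⟨fun _ _ _ => by simp, fun _ _ _ => by simp, fun _ _ _ => by simp, fun _ _ _ => by simp⟩

variable (C) in
/-- The local problem in terms of coefficients, as a system without algebraic part. -/
abbrev LocalODE (K : M.Elem) (T : ℝ) (s : ℝ → M.traceCoef k) (j : ℝ → R3 → R3) (ρ : ℝ → R3 → ℝ)
    (u u' : ℝ → ElemCoef k) : Prop :=
  IsDAESol (S := Fin 0 → ℝ) (massC C K) (fun u q => stiffC C K (u.1, 0) q) (fun _ _ => 0) T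
    (fun t q => loadC C K (j t) (ρ t) q - stiffC C K (0, s t) q) (fun _ _ => 0) u u' 0

section

variable {s : ℝ → M.traceCoef k} {j : ℝ → R3 → R3} {ρ : ℝ → R3 → ℝ}
  {eh : ℝ → M.Face → R3 → R3} {e0 h0 : R3 → R3} {φ0 : R3 → ℝ}

/-- Linearity in the pair lets a prescribed trace be moved into the load of the local problem. -/
theorem stiffC_split (u : ElemCoef k) (s : M.traceCoef k) (q : ElemCoef k) :
    stiffC C K (u, s) q = stiffC C K (u, 0) q + stiffC C K (0, s) q := by
  rw [← isBilinearMap_stiffC.add_left, Prod.mk_add_mk, add_zero, zero_add]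

theorem IsLocalSol.exists_coef {e h : ℝ → R3 → R3} {φ : ℝ → R3 → ℝ} (hT : 0 < T)
    (hs : ∀ t ∈ Icc 0 T, ∀ F, EqOn (eh t F) (M.tField k (s t) F) (M.faceMap F '' M.shape.face))
    (hsol : IsLocalSol C k T K eh j ρ e0 h0 φ0 e h φ) :
    ∃ u u', LocalODE C K T s j ρ u u' ∧ Represents K (u 0) e0 h0 φ0 ∧
      ∀ t ∈ Icc 0 T, Represents K (u t) (e t) (h t) (φ t) ∧
        Represents K (u' t) (dt T e t) (dt T h t) (dt T φ t) := by
  obtain ⟨u, u', hd, hr⟩ := exists_represents_curve hT hsol.mem_e hsol.mem_h hsol.mem_φ hsol.diff_e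
    hsol.diff_h hsol.diff_φ
  refine ⟨u, u', ⟨hd, fun t ht v => ?_, fun _ _ _ => rfl⟩,
    (hr 0 (left_mem_Icc.2 hT.le)).1.congr hsol.init_e.symm hsol.init_h.symm hsol.init_φ.symm, hr⟩
  have h1 := ((hr t ht).1.localEqs_iff (hr t ht).2
    (fun i ξ hξ => bmap_congr (hs t ht) K i hξ)).1 (hsol.eqs t ht) v
  rw [stiffC_split] at h1
  exact eq_sub_of_add_eq (by rw [add_assoc]; exact h1)

theorem LocalODE.isLocalSol {u u' : ℝ → ElemCoef k} (hT : 0 < T)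
    (hs : ∀ t ∈ Icc 0 T, ∀ F, EqOn (eh t F) (M.tField k (s t) F) (M.faceMap F '' M.shape.face))
    (hu : LocalODE C K T s j ρ u u') (h0' : Represents K (u 0) e0 h0 φ0) :
    IsLocalSol C k T K eh j ρ e0 h0 φ0 (fun t => M.vField k K (u t).1)
      (fun t => M.vField k K (u t).2.1) (fun t => M.sField k K (u t).2.2) where
  mem_e _ _ := Mesh.inV_vField K _
  mem_h _ _ := Mesh.inV_vField K _
  mem_φ _ _ := Mesh.inW_sField K _
  diff_e x _ := (differentiableOn_fields hu.deriv x).1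
  diff_h x _ := (differentiableOn_fields hu.deriv x).2.1
  diff_φ x _ := (differentiableOn_fields hu.deriv x).2.2
  init_e := h0'.e.symm
  init_h := h0'.h.symm
  init_φ := h0'.φ.symm
  eqs t ht := by
    refine ((represents_self K (u t)).localEqs_iff (represents_dt hT hu.deriv ht)
      (fun i ξ hξ => bmap_congr (hs t ht) K i hξ)).2 fun q => ?_
    rw [stiffC_split, ← add_assoc]
    exact add_eq_of_eq_sub (hu.diff t ht q)

theorem isLinearMap_localLoad (hj : ContInL2 (volume.restrict Ω) T j)
    (hρ : ContInL2 (volume.restrict Ω) T ρ) {t : ℝ} (ht : t ∈ Icc 0 T) :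
    IsLinearMap ℝ fun q : ElemCoef k => loadC C K (j t) (ρ t) q :=
  isLinearMap_loadC (Mesh.integrableOn_elem_of_memLp (hj.1 t ht) K)
    (Mesh.integrableOn_elem_of_memLp (hρ.1 t ht) K)

theorem isLinearMap_localODE_load (hj : ContInL2 (volume.restrict Ω) T j)
    (hρ : ContInL2 (volume.restrict Ω) T ρ) {t : ℝ} (ht : t ∈ Icc 0 T) :
    IsLinearMap ℝ fun q : ElemCoef k => loadC C K (j t) (ρ t) q - stiffC C K (0, s t) q :=
  isLinearMap_sub (isLinearMap_localLoad hj hρ ht)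
    ⟨isBilinearMap_stiffC.add_right _, fun c => isBilinearMap_stiffC.smul_right c _⟩

theorem continuousOn_localODE_load (hj : ContInL2 (volume.restrict Ω) T j)
    (hρ : ContInL2 (volume.restrict Ω) T ρ) (hs : ContinuousOn s (Icc 0 T)) (q : ElemCoef k) :
    ContinuousOn (fun t => loadC C K (j t) (ρ t) q - stiffC C K (0, s t) q) (Icc 0 T) := by
  obtain ⟨B, hB⟩ := exists_clm_of_isBilinearMap (isBilinearMap_stiffC (C := C) (K := K) (k := k))
  simp only [← hB]
  exact (continuousOn_loadC hj hρ q).sub ((B.continuous.comp_continuousOn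
    (continuousOn_const.prodMk hs)).clm_apply continuousOn_const)

theorem isBilinearMap_prodMk_zero {U V S S' : Type*} [AddCommGroup U] [Module ℝ U]
    [AddCommGroup V] [Module ℝ V] [AddCommGroup S] [Module ℝ S] [AddCommGroup S'] [Module ℝ S']
    {F : U × S → V → ℝ} (hF : IsBilinearMap ℝ F) :
    IsBilinearMap ℝ fun (u : U × S') (v : V) => F (u.1, 0) v :=
  isBilinearMap_comp hF (LinearMap.inl ℝ U S ∘ₗ LinearMap.fst ℝ U S') LinearMap.id

theorem isBilinearMap_localODE_stiff : IsBilinearMap ℝ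
    fun (u : ElemCoef k × (Fin 0 → ℝ)) (q : ElemCoef k) => stiffC C K (u.1, 0) q :=
  isBilinearMap_prodMk_zero isBilinearMap_stiffC

theorem exists_isLocalSol (hT : 0 < T) (hj : ContInL2 (volume.restrict Ω) T j)
    (hρ : ContInL2 (volume.restrict Ω) T ρ) (heh : ∀ t ∈ Icc 0 T, M.InS k (eh t))
    (hehc : ∀ F, ∀ ξ ∈ M.shape.face, ContinuousOn (fun t => eh t F (M.faceMap F ξ)) (Icc 0 T))
    (he0 : M.InV k K e0) (hh0 : M.InV k K h0) (hφ0 : M.InW k K φ0) :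
    ∃ e h φ, IsLocalSol C k T K eh j ρ e0 h0 φ0 e h φ := by
  obtain ⟨s, hs⟩ := exists_trace_curve heh
  have hsc := continuousOn_traceCoef hs hehc
  obtain ⟨u₀, hu₀⟩ := exists_represents he0 hh0 hφ0
  obtain ⟨u, u', r, hu, h0⟩ := exists_daeSol hT (isBilinearMap_massC (C := C) (K := K) (k := k))
    (fun u hu => massC_pos hu) isBilinearMap_localODE_stiff
    (isBilinearMap_zero (U := ElemCoef k × (Fin 0 → ℝ)) (V := Fin 0 → ℝ))
    -- The algebraic variable ranges over the zero space, where definiteness is vacuous.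
    (fun s hs => absurd (Subsingleton.elim s 0) hs)
    (fun t ht => isLinearMap_localODE_load (s := s) hj hρ ht) (continuousOn_localODE_load hj hρ hsc)
    (l := fun _ _ => 0) (fun t ht => ⟨fun _ _ => by simp, fun _ _ => by simp⟩)
    (fun _ => continuousOn_const) u₀
  have hu' : LocalODE C K T s j ρ u u' := by rwa [Subsingleton.elim r 0] at hu
  exact ⟨_, _, _, hu'.isLocalSol hT hs (h0 ▸ hu₀)⟩

theorem IsLocalSol.unique (hT : 0 < T) (hj : ContInL2 (volume.restrict Ω) T j)
    (hρ : ContInL2 (volume.restrict Ω) T ρ) (heh : ∀ t ∈ Icc 0 T, M.InS k (eh t))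
    (hehc : ∀ F, ∀ ξ ∈ M.shape.face, ContinuousOn (fun t => eh t F (M.faceMap F ξ)) (Icc 0 T))
    {e h e' h' : ℝ → R3 → R3} {φ φ' : ℝ → R3 → ℝ}
    (h₁ : IsLocalSol C k T K eh j ρ e0 h0 φ0 e h φ)
    (h₂ : IsLocalSol C k T K eh j ρ e0 h0 φ0 e' h' φ') {t : ℝ} (ht : t ∈ Icc 0 T) {x : R3}
    (hx : x ∈ M.map K '' M.shape.body) : e t x = e' t x ∧ h t x = h' t x ∧ φ t x = φ' t x := by
  obtain ⟨s, hs⟩ := exists_trace_curve heh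
  have hsc := continuousOn_traceCoef hs hehc
  obtain ⟨u, u', hu, hu0, hur⟩ := h₁.exists_coef hT hs
  obtain ⟨v, v', hv, hv0, hvr⟩ := h₂.exists_coef hT hs
  have huv := (hu.unique (isBilinearMap_massC (C := C) (K := K) (k := k))
    (fun u hu => massC_pos hu) isBilinearMap_localODE_stiff
    (isBilinearMap_zero (U := ElemCoef k × (Fin 0 → ℝ)) (V := Fin 0 → ℝ))
    (fun s hs => absurd (Subsingleton.elim s 0) hs)
    (fun t ht => isLinearMap_localODE_load (s := s) hj hρ ht) (continuousOn_localODE_load hj hρ hsc)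
    (fun t ht => ⟨fun _ _ => by simp, fun _ _ => by simp⟩) (fun _ => continuousOn_const) hv
    (hu0.unique hv0) t ht).1
  have h3 := (hur t ht).1
  have h4 := (hvr t ht).1
  rw [huv] at h3
  exact ⟨(h3.e hx).trans (h4.e hx).symm, (h3.h hx).trans (h4.h hx).symm,
    (h3.φ hx).trans (h4.φ hx).symm⟩

theorem IsLocalSol.energy (hT : 0 < T) (hj : ContInL2 (volume.restrict Ω) T j)
    (hρ : ContInL2 (volume.restrict Ω) T ρ) (heh : ∀ t ∈ Icc 0 T, M.InS k (eh t))
    (hehc : ∀ F, ∀ ξ ∈ M.shape.face, ContinuousOn (fun t => eh t F (M.faceMap F ξ)) (Icc 0 T))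
    {e h : ℝ → R3 → R3} {φ : ℝ → R3 → ℝ} (hsol : IsLocalSol C k T K eh j ρ e0 h0 φ0 e h φ) :
    ∀ t ∈ Icc 0 T, IntervalIntegrable (fun s => localDissip C K (e s) (φ s)) volume 0 t ∧
      IntervalIntegrable (fun s => localSource C K (e s) (h s) (φ s) (eh s) (j s) (ρ s)) volume 0 t ∧
      localEnergy C K (e t) (h t) (φ t) + ∫ s in (0)..t, localDissip C K (e s) (φ s)
        = localEnergy C K (e 0) (h 0) (φ 0)
          + ∫ s in (0)..t, localSource C K (e s) (h s) (φ s) (eh s) (j s) (ρ s) := by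
  obtain ⟨s, hs⟩ := exists_trace_curve heh
  have hsc := continuousOn_traceCoef hs hehc
  obtain ⟨u, u', hu, hu0, hur⟩ := hsol.exists_coef hT hs
  obtain ⟨huc, hu'c, -⟩ := hu.continuousOn (isBilinearMap_massC (C := C) (K := K) (k := k))
    (fun u hu => massC_pos hu) isBilinearMap_localODE_stiff
    (isBilinearMap_zero (U := ElemCoef k × (Fin 0 → ℝ)) (V := Fin 0 → ℝ))
    (fun s hs => absurd (Subsingleton.elim s 0) hs)
    (fun t ht => isLinearMap_localODE_load (s := s) hj hρ ht) (continuousOn_localODE_load hj hρ hsc)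
    (fun t ht => ⟨fun _ _ => by simp, fun _ _ => by simp⟩) (fun _ => continuousOn_const)
  refine energy_balance (E := fun t => localEnergy C K (e t) (h t) (φ t))
    (isBilinearMap_massC (C := C) (K := K) (k := k)) massC_comm
    (isBilinearMap_dissipC (C := C) (K := K) (k := k)) hu.deriv hu'c
    (w := fun t => (u t, 0)) (huc.prodMk continuousOn_const) (fun t ht => (hur t ht).1.localEnergy)
    (fun t ht => ?_) fun t ht => ?_
  -- With zero in place of the trace the dissipation form reduces to `⟨τ e × n, e × n⟩`, as the
  -- local identity requires. The true trace appears only in its source.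
  · rw [← (hur t ht).1.dissip (eh := fun _ _ => 0) (s := 0) fun i ξ _ => by simp]
    simp only [sub_zero, localDissip]
  · rw [← (hur t ht).2.localRate (hur t ht).1]
    exact (hsol.eqs t ht).local_energy (hsol.mem_e t ht) (hsol.mem_h t ht) (hsol.mem_φ t ht)
      ((heh t ht).continuousOn_bmap K)

end

/-! ### The semi-discrete problem -/

variable {Ω : Set R3} {p : ℕ} {M : Mesh Ω p} {C : Coeff M} {k : ℕ} {T : ℝ}

section Forms

/-! ### Sums of forms over the elements -/

variable {ι : Type*} [Fintype ι] {U : Type*} [AddCommGroup U] [Module ℝ U]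

/-- Test vectors supported on a single index recover the individual equations. The discrete spaces
are discontinuous, so elementwise equations and their sum are equivalent. -/
theorem forall_sum_eq_iff [DecidableEq ι] {a b : ι → U → ℝ} (ha : ∀ i, IsLinearMap ℝ (a i))
    (hb : ∀ i, IsLinearMap ℝ (b i)) :
    (∀ i q, a i q = b i q) ↔ ∀ q : ι → U, ∑ i, a i (q i) = ∑ i, b i (q i) := by
  constructor
  · exact fun h q => Finset.sum_congr rfl fun i _ => h i _
  · intro h i q
    have h1 := h (Pi.single i q)
    rw [Finset.sum_eq_single i, Finset.sum_eq_single i] at h1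
    · simpa using h1
    · intro l _ hl
      rw [Pi.single_eq_of_ne hl, (hb l).map_zero]
    · simp
    · intro l _ hl
      rw [Pi.single_eq_of_ne hl, (ha l).map_zero]
    · simp

theorem isBilinearMap_sum_proj {V : Type*} [AddCommGroup V] [Module ℝ V] {F : ι → U → V → ℝ}
    (hF : ∀ i, IsBilinearMap ℝ (F i)) :
    IsBilinearMap ℝ fun (u : ι → U) (v : ι → V) => ∑ i, F i (u i) (v i) :=
  isBilinearMap_sum fun i => isBilinearMap_comp (hF i) (LinearMap.proj i : (ι → U) →ₗ[ℝ] U)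
    (LinearMap.proj i : (ι → V) →ₗ[ℝ] V)

theorem isBilinearMap_sum_proj_prod {S V : Type*} [AddCommGroup S] [Module ℝ S] [AddCommGroup V]
    [Module ℝ V] {F : ι → U × S → V → ℝ} (hF : ∀ i, IsBilinearMap ℝ (F i)) :
    IsBilinearMap ℝ fun (u : (ι → U) × S) (v : ι → V) => ∑ i, F i (u.1 i, u.2) (v i) :=
  isBilinearMap_sum fun i => isBilinearMap_comp (hF i)
    (((LinearMap.proj i : (ι → U) →ₗ[ℝ] U) ∘ₗ LinearMap.fst ℝ (ι → U) S).prod (LinearMap.snd ℝ (ι → U) S))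
    (LinearMap.proj i : (ι → V) →ₗ[ℝ] V)

theorem isBilinearMap_sum_prod_prod {S : Type*} [AddCommGroup S] [Module ℝ S]
    {F : ι → U × S → U × S → ℝ} (hF : ∀ i, IsBilinearMap ℝ (F i)) :
    IsBilinearMap ℝ fun (u v : (ι → U) × S) => ∑ i, F i (u.1 i, u.2) (v.1 i, v.2) :=
  isBilinearMap_sum fun i => isBilinearMap_comp (hF i)
    (((LinearMap.proj i : (ι → U) →ₗ[ℝ] U) ∘ₗ LinearMap.fst ℝ (ι → U) S).prod (LinearMap.snd ℝ (ι → U) S))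
    (((LinearMap.proj i : (ι → U) →ₗ[ℝ] U) ∘ₗ LinearMap.fst ℝ (ι → U) S).prod (LinearMap.snd ℝ (ι → U) S))

theorem isLinearMap_sum_proj {f : ι → U → ℝ} (hf : ∀ i, IsLinearMap ℝ (f i)) :
    IsLinearMap ℝ fun q : ι → U => ∑ i, f i (q i) :=
  isLinearMap_sum fun i => ⟨fun _ _ => (hf i).map_add _ _, fun _ _ => (hf i).map_smul _ _⟩

end Forms

variable (C) in
/-- The semi-discrete problem in terms of coefficients. -/
abbrev GlobalDAE (T : ℝ) (j : ℝ → R3 → R3) (ρ : ℝ → R3 → ℝ) (einc : ℝ → R3 → R3)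
    (u u' : ℝ → M.Elem → ElemCoef k) (s : ℝ → M.traceCoef k) : Prop :=
  IsDAESol (fun u q : M.Elem → ElemCoef k => ∑ K, massC C K (u K) (q K))
    (fun (u : (M.Elem → ElemCoef k) × M.traceCoef k) (q : M.Elem → ElemCoef k) =>
      ∑ K, stiffC C K (u.1 K, u.2) (q K))
    (traceC C) T (fun t (q : M.Elem → ElemCoef k) => ∑ K, loadC C K (j t) (ρ t) (q K))
    (fun t (m : M.traceCoef k) => traceLoad M (einc t) (M.tField k m)) u u' s

variable {j : ℝ → R3 → R3} {ρ : ℝ → R3 → ℝ} {einc : ℝ → R3 → R3}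
  {e0 h0 : M.Elem → R3 → R3} {φ0 : M.Elem → R3 → ℝ}

section Instant

variable {u u' : M.Elem → ElemCoef k} {s : M.traceCoef k} {e h et ht : M.Elem → R3 → R3}
  {φ φt : M.Elem → R3 → ℝ} {eh : M.Face → R3 → R3}

/-- The bridge between the method and the abstract system: at each instant the equations for the
fields are equivalent to those for the coefficients. It is used in one direction for uniqueness and
in the other for existence. -/
theorem scheme_iff {j : R3 → R3} {ρ : R3 → ℝ} {einc : R3 → R3}
    (hj : ∀ K, IntegrableOn j (M.elem K)) (hρ : ∀ K, IntegrableOn ρ (M.elem K))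
    (hinc : ∀ K i, M.IsBdry (M.faceOf K i) →
      IntegrableOn (fun ξ => einc (M.bmap K i ξ)) M.shape.face)
    (hu : ∀ K, Represents K (u K) (e K) (h K) (φ K))
    (hu' : ∀ K, Represents K (u' K) (et K) (ht K) (φt K)) (heh : M.InS k eh)
    (hs : ∀ F, EqOn (eh F) (M.tField k s F) (M.faceMap F '' M.shape.face)) :
    Scheme C k e h φ et ht φt eh j ρ einc ↔
      (∀ q : M.Elem → ElemCoef k, ∑ K, massC C K (u' K) (q K) + ∑ K, stiffC C K (u K, s) (q K)
        = ∑ K, loadC C K j ρ (q K)) ∧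
      ∀ m : M.traceCoef k, traceC C (u, s) m = traceLoad M einc (M.tField k m) := by
  classical
  refine and_congr ?_ ?_
  · simp only [← Finset.sum_add_distrib]
    rw [← forall_sum_eq_iff (a := fun K q => massC C K (u' K) q + stiffC C K (u K, s) q)
      (fun K => isLinearMap_add
        ⟨isBilinearMap_massC.add_right _, fun c => isBilinearMap_massC.smul_right c _⟩
        ⟨isBilinearMap_stiffC.add_right _, fun c => isBilinearMap_stiffC.smul_right c _⟩)
      fun K => isLinearMap_loadC (hj K) (hρ K)]
    exact forall_congr' fun K => (hu K).localEqs_iff (hu' K) fun i ξ hξ => bmap_congr hs K i hξ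
  · rw [traceEq_iff heh hinc]
    constructor
    · intro H m
      rw [← H _ (Mesh.inS_tField m)]
      exact (traceForm_congr (fun K => (hu K).e) (fun K => (hu K).h) hs fun _ _ _ => rfl).symm
    · intro H m hm
      obtain ⟨c, hc⟩ := hm.exists_tField
      rw [traceForm_congr (fun K => (hu K).e) (fun K => (hu K).h) hs hc, traceLoad_congr hc]
      exact H c

end Instant

theorem IsSol.exists_coef {e h : ℝ → M.Elem → R3 → R3} {φ : ℝ → M.Elem → R3 → ℝ}
    {eh : ℝ → M.Face → R3 → R3} (hT : 0 < T) (hj : ContInL2 (volume.restrict Ω) T j)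
    (hρ : ContInL2 (volume.restrict Ω) T ρ) (hinc : ContInL2Bdry M T einc)
    (hsol : IsSol C k T j ρ einc e0 h0 φ0 e h φ eh) :
    ∃ u u' s, GlobalDAE (k := k) C T j ρ einc u u' s ∧
      (∀ K, Represents K (u 0 K) (e0 K) (h0 K) (φ0 K)) ∧ ∀ t ∈ Icc 0 T,
        (∀ K, Represents K (u t K) (e t K) (h t K) (φ t K)) ∧
        (∀ K, Represents K (u' t K) (dt T (fun s => e s K) t) (dt T (fun s => h s K) t)
          (dt T (fun s => φ s K) t)) ∧
        ∀ F, EqOn (eh t F) (M.tField k (s t) F) (M.faceMap F '' M.shape.face) := by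
  choose u u' hd hr using fun K => exists_represents_curve hT (fun t ht => hsol.mem_e t ht K)
    (fun t ht => hsol.mem_h t ht K) (fun t ht => hsol.mem_φ t ht K) (hsol.diff_e K) (hsol.diff_h K)
    (hsol.diff_φ K)
  obtain ⟨s, hs⟩ := exists_trace_curve hsol.mem_eh
  have h1 := fun t ht => (scheme_iff (fun K => Mesh.integrableOn_elem_of_memLp (hj.1 t ht) K)
    (fun K => Mesh.integrableOn_elem_of_memLp (hρ.1 t ht) K) (hinc.integrableOn ht)
    (fun K => (hr K t ht).1) (fun K => (hr K t ht).2) (hsol.mem_eh t ht) (hs t ht)).1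
    (hsol.eqs t ht)
  exact ⟨fun t K => u K t, fun t K => u' K t, s,
    ⟨fun t ht => hasDerivWithinAt_pi.2 fun K => hd K t ht, fun t ht => (h1 t ht).1,
      fun t ht => (h1 t ht).2⟩,
    fun K => (hr K 0 (left_mem_Icc.2 hT.le)).1.congr (hsol.init_e K).symm (hsol.init_h K).symm
      (hsol.init_φ K).symm,
    fun t ht => ⟨fun K => (hr K t ht).1, fun K => (hr K t ht).2, hs t ht⟩⟩

theorem GlobalDAE.isSol {u u' : ℝ → M.Elem → ElemCoef k} {s : ℝ → M.traceCoef k} (hT : 0 < T)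
    (hj : ContInL2 (volume.restrict Ω) T j) (hρ : ContInL2 (volume.restrict Ω) T ρ)
    (hinc : ContInL2Bdry M T einc) (hu : GlobalDAE C T j ρ einc u u' s)
    (h0' : ∀ K, Represents K (u 0 K) (e0 K) (h0 K) (φ0 K)) :
    IsSol C k T j ρ einc e0 h0 φ0 (fun t K => M.vField k K (u t K).1)
      (fun t K => M.vField k K (u t K).2.1) (fun t K => M.sField k K (u t K).2.2)
      (fun t => M.tField k (s t)) := by
  have hd : ∀ K, ∀ t ∈ Icc 0 T, HasDerivWithinAt (fun t => u t K) (u' t K) (Icc 0 T) t :=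
    fun K t ht => hasDerivWithinAt_pi.1 (hu.deriv t ht) K
  exact {
    mem_e := fun _ _ _ => Mesh.inV_vField _ _
    mem_h := fun _ _ _ => Mesh.inV_vField _ _
    mem_φ := fun _ _ _ => Mesh.inW_sField _ _
    mem_eh := fun _ _ => Mesh.inS_tField _
    diff_e := fun K x _ => (differentiableOn_fields (hd K) x).1
    diff_h := fun K x _ => (differentiableOn_fields (hd K) x).2.1
    diff_φ := fun K x _ => (differentiableOn_fields (hd K) x).2.2
    init_e := fun K => (h0' K).e.symm
    init_h := fun K => (h0' K).h.symm
    init_φ := fun K => (h0' K).φ.symm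
    eqs := fun t ht => (scheme_iff (fun K => Mesh.integrableOn_elem_of_memLp (hj.1 t ht) K)
      (fun K => Mesh.integrableOn_elem_of_memLp (hρ.1 t ht) K) (hinc.integrableOn ht)
      (fun K => represents_self K (u t K)) (fun K => represents_dt hT (hd K) ht)
      (Mesh.inS_tField (s t)) (fun _ _ _ => rfl)).2 ⟨hu.diff t ht, hu.alg t ht⟩ }

theorem isBilinearMap_globalMass :
    IsBilinearMap ℝ fun u q : M.Elem → ElemCoef k => ∑ K, massC C K (u K) (q K) :=
  isBilinearMap_sum_proj fun _ => isBilinearMap_massC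

theorem isBilinearMap_globalStiff :
    IsBilinearMap ℝ fun (u : (M.Elem → ElemCoef k) × M.traceCoef k) (q : M.Elem → ElemCoef k) =>
      ∑ K, stiffC C K (u.1 K, u.2) (q K) :=
  isBilinearMap_sum_proj_prod fun _ => isBilinearMap_stiffC

theorem isBilinearMap_globalDissip :
    IsBilinearMap ℝ fun u v : (M.Elem → ElemCoef k) × M.traceCoef k =>
      ∑ K, dissipC C K (u.1 K, u.2) (v.1 K, v.2) :=
  isBilinearMap_sum_prod_prod fun _ => isBilinearMap_dissipC

theorem isLinearMap_globalLoad (hj : ContInL2 (volume.restrict Ω) T j)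
    (hρ : ContInL2 (volume.restrict Ω) T ρ) {t : ℝ} (ht : t ∈ Icc 0 T) :
    IsLinearMap ℝ fun q : M.Elem → ElemCoef k => ∑ K, loadC C K (j t) (ρ t) (q K) :=
  isLinearMap_sum_proj fun _ => isLinearMap_localLoad hj hρ ht

theorem continuousOn_globalLoad (hj : ContInL2 (volume.restrict Ω) T j)
    (hρ : ContInL2 (volume.restrict Ω) T ρ) (q : M.Elem → ElemCoef k) :
    ContinuousOn (fun t => ∑ K, loadC C K (j t) (ρ t) (q K)) (Icc 0 T) :=
  continuousOn_finsetSum _ fun K _ => continuousOn_loadC hj hρ (q K)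

theorem exists_isSol (hT : 0 < T) (hj : ContInL2 (volume.restrict Ω) T j)
    (hρ : ContInL2 (volume.restrict Ω) T ρ) (hinc : ContInL2Bdry M T einc)
    (he0 : ∀ K, M.InV k K (e0 K)) (hh0 : ∀ K, M.InV k K (h0 K)) (hφ0 : ∀ K, M.InW k K (φ0 K)) :
    ∃ e h φ eh, IsSol C k T j ρ einc e0 h0 φ0 e h φ eh := by
  choose u₀ hu₀ using fun K => exists_represents (he0 K) (hh0 K) (hφ0 K)
  obtain ⟨u, u', s, hu, h0⟩ := exists_daeSol hT
    (isBilinearMap_globalMass (C := C) (k := k)) (fun u hu => massC_sum_pos hu)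
    isBilinearMap_globalStiff
    isBilinearMap_traceC (fun s hs => traceC_pos hs) (fun t ht => isLinearMap_globalLoad hj hρ ht)
    (continuousOn_globalLoad hj hρ) (fun t ht => isLinearMap_traceLoad (hinc.integrableOn ht))
    (continuousOn_traceLoad hinc) u₀
  exact ⟨_, _, _, _, GlobalDAE.isSol hT hj hρ hinc hu fun K => by rw [h0]; exact hu₀ K⟩

theorem IsSol.unique (hT : 0 < T) (hj : ContInL2 (volume.restrict Ω) T j)
    (hρ : ContInL2 (volume.restrict Ω) T ρ) (hinc : ContInL2Bdry M T einc)
    {e h e' h' : ℝ → M.Elem → R3 → R3} {φ φ' : ℝ → M.Elem → R3 → ℝ} {eh eh' : ℝ → M.Face → R3 → R3}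
    (h₁ : IsSol C k T j ρ einc e0 h0 φ0 e h φ eh)
    (h₂ : IsSol C k T j ρ einc e0 h0 φ0 e' h' φ' eh') {t : ℝ} (ht : t ∈ Icc 0 T) :
    (∀ K, ∀ x ∈ M.map K '' M.shape.body,
      e t K x = e' t K x ∧ h t K x = h' t K x ∧ φ t K x = φ' t K x) ∧
    ∀ F, ∀ x ∈ M.faceMap F '' M.shape.face, eh t F x = eh' t F x := by
  obtain ⟨u, u', s, hu, hu0, hur⟩ := h₁.exists_coef hT hj hρ hinc
  obtain ⟨v, v', r, hv, hv0, hvr⟩ := h₂.exists_coef hT hj hρ hinc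
  obtain ⟨huv, hsr⟩ := hu.unique
    (isBilinearMap_globalMass (C := C) (k := k)) (fun u hu => massC_sum_pos hu)
    isBilinearMap_globalStiff
    isBilinearMap_traceC (fun s hs => traceC_pos hs) (fun t ht => isLinearMap_globalLoad hj hρ ht)
    (continuousOn_globalLoad hj hρ) (fun t ht => isLinearMap_traceLoad (hinc.integrableOn ht))
    (continuousOn_traceLoad hinc) hv (funext fun K => (hu0 K).unique (hv0 K)) t ht
  refine ⟨fun K x hx => ?_, fun F x hx => ?_⟩
  · have h3 := (hur t ht).1 K
    have h4 := (hvr t ht).1 K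
    rw [huv] at h3
    exact ⟨(h3.e hx).trans (h4.e hx).symm, (h3.h hx).trans (h4.h hx).symm,
      (h3.φ hx).trans (h4.φ hx).symm⟩
  · rw [(hur t ht).2.2 F hx, (hvr t ht).2.2 F hx, hsr]

/-- The instantaneous balance `Scheme.energy_rate`, integrated by `energy_balance`. The reduction to
an ordinary differential equation supplies continuity of `u'` and of the trace, which a solution is
not required to have a priori. -/
theorem IsSol.energy (hΩ : IsOpen Ω) (hT : 0 < T) (hj : ContInL2 (volume.restrict Ω) T j)
    (hρ : ContInL2 (volume.restrict Ω) T ρ) (hinc : ContInL2Bdry M T einc)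
    {e h : ℝ → M.Elem → R3 → R3} {φ : ℝ → M.Elem → R3 → ℝ} {eh : ℝ → M.Face → R3 → R3}
    (hsol : IsSol C k T j ρ einc e0 h0 φ0 e h φ eh)
    (hpl : ∀ K i, M.IsBdry (M.faceOf K i) → M.IsPlanar (M.faceOf K i) ∨
      ∀ t ∈ Icc 0 T, ∃ m, M.InS k m ∧ ∀ ξ ∈ M.shape.face,
        tang (M.normal K i ξ) (einc t (M.bmap K i ξ)) = m (M.faceOf K i) (M.bmap K i ξ)) :
    ∀ t ∈ Icc 0 T, IntervalIntegrable (fun s => dissip C (e s) (φ s) (eh s)) volume 0 t ∧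
      IntervalIntegrable
        (fun s => source C (e s) (h s) (φ s) (eh s) (j s) (ρ s) (einc s)) volume 0 t ∧
      energy C (e t) (h t) (φ t) + ∫ s in (0)..t, dissip C (e s) (φ s) (eh s)
        = energy C (e 0) (h 0) (φ 0)
          + ∫ s in (0)..t, source C (e s) (h s) (φ s) (eh s) (j s) (ρ s) (einc s) := by
  obtain ⟨u, u', s, hu, hu0, hur⟩ := hsol.exists_coef hT hj hρ hinc
  have hA := isBilinearMap_globalMass (C := C) (k := k)
  obtain ⟨huc, hu'c, hsc⟩ := hu.continuousOn hA (fun u hu => massC_sum_pos hu)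
    isBilinearMap_globalStiff
    isBilinearMap_traceC (fun s hs => traceC_pos hs) (fun t ht => isLinearMap_globalLoad hj hρ ht)
    (continuousOn_globalLoad hj hρ) (fun t ht => isLinearMap_traceLoad (hinc.integrableOn ht))
    (continuousOn_traceLoad hinc)
  refine energy_balance (E := fun t => GLMHDG.energy C (e t) (h t) (φ t)) hA
    (fun u v => Finset.sum_congr rfl fun K _ => massC_comm _ _)
    (isBilinearMap_globalDissip (C := C) (k := k)) hu.deriv hu'c
    (w := fun t => (u t, s t)) (huc.prodMk hsc) (fun t ht => ?_) (fun t ht => ?_)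
    fun t ht => ?_
  · rw [Finset.mul_sum]
    exact Finset.sum_congr rfl fun K _ => ((hur t ht).1 K).localEnergy
  · exact Finset.sum_congr rfl fun K _ =>
      ((hur t ht).1 K).dissip fun i ξ hξ => bmap_congr (hur t ht).2.2 K i hξ
  · rw [← (hsol.eqs t ht).energy_rate hΩ (hsol.mem_e t ht) (hsol.mem_h t ht) (hsol.mem_φ t ht)
      (hsol.mem_eh t ht) (hinc.integrableOn ht)
      fun K i hb => (hpl K i hb).imp_right fun H => H t ht]
    exact congrArg (· + _) (Finset.sum_congr rfl fun K _ =>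
      (((hur t ht).2.1 K).localRate ((hur t ht).1 K)).symm)

theorem dissip_nonneg (e : M.Elem → R3 → R3) (φ : M.Elem → R3 → ℝ) (eh : M.Face → R3 → R3) :
    0 ≤ dissip C e φ eh := by
  have hf : ∀ K i (f : R2 → ℝ), (∀ ξ, 0 ≤ f ξ) → 0 ≤ M.faceInt K i f := fun K i f h =>
    setIntegral_nonneg M.shape.measurableSet_face fun ξ hξ =>
      mul_nonneg (h ξ) (M.areaElem_pos K hξ).le
  refine Finset.sum_nonneg fun K _ => add_nonneg (add_nonneg (mul_nonneg (by positivity) ?_)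
    (mul_nonneg (by positivity) ?_)) ?_
  · exact setIntegral_nonneg (M.measurableSet_elem K) fun x _ => mul_self_nonneg _
  · exact Finset.sum_nonneg fun i _ => hf K i _ fun ξ => mul_self_nonneg _
  · exact Finset.sum_nonneg fun i _ => hf K i _ fun ξ =>
      mul_nonneg (C.τ_pos K i).le (dotProduct_self_nonneg' _)

theorem tang_zero (n : R3) : tang n 0 = 0 := by
  rw [tang, map_zero, map_zero, LinearMap.zero_apply]

theorem bmap_mem_frontier {K : M.Elem} {i : M.shape.Idx} (hb : M.IsBdry (M.faceOf K i)) {ξ : R2}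
    (hξ : ξ ∈ M.shape.face) : M.bmap K i ξ ∈ frontier Ω := by
  obtain ⟨η, hη, he⟩ := Mesh.exists_faceMap_eq (K := K) (i := i) hξ
  rw [he]
  exact hb (mem_image_of_mem _ hη)

theorem source_eq_zero {e h : M.Elem → R3 → R3} {φ : M.Elem → R3 → ℝ} {eh : M.Face → R3 → R3}
    {j : R3 → R3} {ρ : R3 → ℝ} {einc : R3 → R3} (hj : ∀ x ∈ Ω, j x = 0) (hρ : ∀ x ∈ Ω, ρ x = 0)
    (hinc : ∀ x ∈ frontier Ω, einc x = 0) : source C e h φ eh j ρ einc = 0 := by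
  classical
  have h1 : ∀ K, ∫ x in M.elem K, j x ⬝ᵥ e K x = 0 := fun K =>
    setIntegral_eq_zero_of_forall_eq_zero fun x hx => by
      rw [hj x (M.subset K hx), zero_dotProduct]
  have h2 : ∀ K, ∫ x in M.elem K, ρ x / C.ε₀ * φ K x = 0 := fun K =>
    setIntegral_eq_zero_of_forall_eq_zero fun x hx => by
      rw [hρ x (M.subset K hx), _root_.zero_div, zero_mul]
  have h3 : (∑ K, ∑ i, if M.IsBdry (M.faceOf K i) then
        M.faceInt K i fun ξ => (M.normal K i ξ ⨯₃ hHat C K (e K) (h K) eh i ξ) ⬝ᵥ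
          tang (M.normal K i ξ) (einc (M.bmap K i ξ))
        else 0) = 0 := by
    refine Finset.sum_eq_zero fun K _ => Finset.sum_eq_zero fun i _ => ?_
    split_ifs with hb
    · rw [← Mesh.faceInt_zero (K := K) i]
      exact Mesh.faceInt_congr fun ξ hξ => by
        rw [hinc _ (bmap_mem_frontier hb hξ), tang_zero, dotProduct_zero]
    · rfl
  simp only [source, h1, h2, neg_zero, add_zero, Finset.sum_const_zero, zero_sub, neg_eq_zero]
  exact h3

theorem IsSol.antitoneOn_energy (hΩ : IsOpen Ω) (hT : 0 < T)
    (hj : ContInL2 (volume.restrict Ω) T j) (hρ : ContInL2 (volume.restrict Ω) T ρ)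
    (hinc : ContInL2Bdry M T einc) (hj0 : ∀ t ∈ Icc 0 T, ∀ x ∈ Ω, j t x = 0)
    (hρ0 : ∀ t ∈ Icc 0 T, ∀ x ∈ Ω, ρ t x = 0)
    (hinc0 : ∀ t ∈ Icc 0 T, ∀ x ∈ frontier Ω, einc t x = 0)
    {e h : ℝ → M.Elem → R3 → R3} {φ : ℝ → M.Elem → R3 → ℝ} {eh : ℝ → M.Face → R3 → R3}
    (hsol : IsSol C k T j ρ einc e0 h0 φ0 e h φ eh) :
    AntitoneOn (fun t => GLMHDG.energy C (e t) (h t) (φ t)) (Icc 0 T) := by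
  -- The zero field belongs to `S_h`, so a vanishing incident field satisfies the second alternative
  -- on every boundary face, and planarity is never needed.
  have hE := hsol.energy hΩ hT hj hρ hinc fun K i hb => Or.inr fun t ht =>
    ⟨fun _ _ => 0, fun F => ⟨fun i => isPolyOn_zero, fun ξ _ => zero_dotProduct _⟩, fun ξ hξ => by
      rw [hinc0 t ht _ (bmap_mem_frontier hb hξ), tang_zero]⟩
  have h1 : ∀ t ∈ Icc 0 T, GLMHDG.energy C (e t) (h t) (φ t)
      = GLMHDG.energy C (e 0) (h 0) (φ 0) - ∫ s in (0)..t, dissip C (e s) (φ s) (eh s) := by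
    intro t ht
    have h2 : ∫ s in (0)..t, source C (e s) (h s) (φ s) (eh s) (j s) (ρ s) (einc s) = 0 := by
      refine (intervalIntegral.integral_congr (g := fun _ => (0 : ℝ)) fun s hs => ?_).trans (by simp)
      rw [uIcc_of_le ht.1] at hs
      have hs' : s ∈ Icc 0 T := ⟨hs.1, hs.2.trans ht.2⟩
      exact source_eq_zero (hj0 s hs') (hρ0 s hs') (hinc0 s hs')
    have h3 := (hE t ht).2.2
    rw [h2, add_zero] at h3
    linarith
  intro a ha b hb hab
  have h2 := intervalIntegral.integral_interval_sub_left (hE b hb).1 (hE a ha).1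
  have h3 : 0 ≤ ∫ s in a..b, dissip C (e s) (φ s) (eh s) :=
    intervalIntegral.integral_nonneg hab fun s _ => dissip_nonneg _ _ _
  dsimp only
  rw [h1 a ha, h1 b hb]
  linarith

end GLMHDG

end

/-- Uniqueness is asserted on the closed elements and on the faces, because discrete functions are
unconstrained elsewhere. Continuity in time of a given trace is required pointwise on the faces,
which is equivalent to continuity of its coefficients. In the consistency statement the field `eh`
is determined by its values on the faces. -/
theorem mainTheorem1 {Ω : Set GLMHDG.R3} (hΩ : IsOpen Ω) {p : ℕ} (M : GLMHDG.Mesh Ω p)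
    (C : GLMHDG.Coeff M) (k : ℕ) (T : ℝ) (hT : 0 < T)
    (j : ℝ → GLMHDG.R3 → GLMHDG.R3) (ρ : ℝ → GLMHDG.R3 → ℝ) (einc : ℝ → GLMHDG.R3 → GLMHDG.R3)
    (hj : GLMHDG.ContInL2 (volume.restrict Ω) T j)
    (hρ : GLMHDG.ContInL2 (volume.restrict Ω) T ρ)
    (hinc : GLMHDG.ContInL2Bdry M T einc) :
    -- each local problem has a unique solution, which satisfies the local energy identity
    (∀ (K : M.Elem) (eh : ℝ → M.Face → GLMHDG.R3 → GLMHDG.R3)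
        (e0 h0 : GLMHDG.R3 → GLMHDG.R3) (φ0 : GLMHDG.R3 → ℝ),
      (∀ t ∈ Icc 0 T, M.InS k (eh t)) →
      (∀ F, ∀ ξ ∈ M.shape.face, ContinuousOn (fun t => eh t F (M.faceMap F ξ)) (Icc 0 T)) →
      M.InV k K e0 → M.InV k K h0 → M.InW k K φ0 →
      (∃ e h φ, GLMHDG.IsLocalSol C k T K eh j ρ e0 h0 φ0 e h φ) ∧
      (∀ e h φ e' h' φ', GLMHDG.IsLocalSol C k T K eh j ρ e0 h0 φ0 e h φ →
        GLMHDG.IsLocalSol C k T K eh j ρ e0 h0 φ0 e' h' φ' →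
        ∀ t ∈ Icc 0 T, ∀ x ∈ M.map K '' M.shape.body,
          e t x = e' t x ∧ h t x = h' t x ∧ φ t x = φ' t x) ∧
      (∀ e h φ, GLMHDG.IsLocalSol C k T K eh j ρ e0 h0 φ0 e h φ → ∀ t ∈ Icc 0 T,
        IntervalIntegrable (fun s => GLMHDG.localDissip C K (e s) (φ s)) volume 0 t ∧
        IntervalIntegrable
          (fun s => GLMHDG.localSource C K (e s) (h s) (φ s) (eh s) (j s) (ρ s)) volume 0 t ∧
        GLMHDG.localEnergy C K (e t) (h t) (φ t)
            + ∫ s in (0)..t, GLMHDG.localDissip C K (e s) (φ s)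
          = GLMHDG.localEnergy C K (e 0) (h 0) (φ 0)
            + ∫ s in (0)..t, GLMHDG.localSource C K (e s) (h s) (φ s) (eh s) (j s) (ρ s))) ∧
    -- the semi-discrete solution exists and is unique
    (∀ (e0 h0 : M.Elem → GLMHDG.R3 → GLMHDG.R3) (φ0 : M.Elem → GLMHDG.R3 → ℝ),
      (∀ K, M.InV k K (e0 K)) → (∀ K, M.InV k K (h0 K)) → (∀ K, M.InW k K (φ0 K)) →
      (∃ e h φ eh, GLMHDG.IsSol C k T j ρ einc e0 h0 φ0 e h φ eh) ∧
      (∀ e h φ eh e' h' φ' eh', GLMHDG.IsSol C k T j ρ einc e0 h0 φ0 e h φ eh →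
        GLMHDG.IsSol C k T j ρ einc e0 h0 φ0 e' h' φ' eh' →
        ∀ t ∈ Icc 0 T,
          (∀ K, ∀ x ∈ M.map K '' M.shape.body,
            e t K x = e' t K x ∧ h t K x = h' t K x ∧ φ t K x = φ' t K x) ∧
          (∀ F, ∀ x ∈ M.faceMap F '' M.shape.face, eh t F x = eh' t F x))) ∧
    -- the energy identity
    (∀ e0 h0 φ0 e h φ eh, GLMHDG.IsSol C k T j ρ einc e0 h0 φ0 e h φ eh →
      (∀ K i, M.IsBdry (M.faceOf K i) → M.IsPlanar (M.faceOf K i) ∨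
        ∀ t ∈ Icc 0 T, ∃ m, M.InS k m ∧ ∀ ξ ∈ M.shape.face,
          GLMHDG.tang (M.normal K i ξ) (einc t (M.bmap K i ξ))
            = m (M.faceOf K i) (M.bmap K i ξ)) →
      ∀ t ∈ Icc 0 T,
        IntervalIntegrable (fun s => GLMHDG.dissip C (e s) (φ s) (eh s)) volume 0 t ∧
        IntervalIntegrable
          (fun s => GLMHDG.source C (e s) (h s) (φ s) (eh s) (j s) (ρ s) (einc s)) volume 0 t ∧
        GLMHDG.energy C (e t) (h t) (φ t)
            + ∫ s in (0)..t, GLMHDG.dissip C (e s) (φ s) (eh s)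
          = GLMHDG.energy C (e 0) (h 0) (φ 0)
            + ∫ s in (0)..t,
                GLMHDG.source C (e s) (h s) (φ s) (eh s) (j s) (ρ s) (einc s)) ∧
    -- without sources and incident field the energy is non-increasing
    ((∀ t ∈ Icc 0 T, ∀ x ∈ Ω, j t x = 0) → (∀ t ∈ Icc 0 T, ∀ x ∈ Ω, ρ t x = 0) →
      (∀ t ∈ Icc 0 T, ∀ x ∈ frontier Ω, einc t x = 0) →
      ∀ e0 h0 φ0 e h φ eh, GLMHDG.IsSol C k T j ρ einc e0 h0 φ0 e h φ eh →
        AntitoneOn (fun t => GLMHDG.energy C (e t) (h t) (φ t)) (Icc 0 T)) ∧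
    -- consistency
    (∀ e h φ, GLMHDG.IsExact C T j ρ einc e h φ →
      (∀ t ∈ Ioo 0 T, ∀ F, ∀ ξ ∈ M.shape.face, φ t (M.faceMap F ξ) = 0) →
      ∀ eh : ℝ → M.Face → GLMHDG.R3 → GLMHDG.R3,
        (∀ t ∈ Ioo 0 T, ∀ K i, ∀ ξ ∈ M.shape.face,
          eh t (M.faceOf K i) (M.bmap K i ξ)
            = GLMHDG.tang (M.normal K i ξ) (e t (M.bmap K i ξ))) →
        ∀ t ∈ Ioo 0 T,
          GLMHDG.Scheme C k (fun _ => e t) (fun _ => h t) (fun _ => φ t)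
            (fun _ x => deriv (fun s => e s x) t) (fun _ x => deriv (fun s => h s x) t)
            (fun _ x => deriv (fun s => φ s x) t) (eh t) (j t) (ρ t) (einc t)) := by
  refine ⟨fun K eh e0 h0 φ0 heh hehc he0 hh0 hφ0 =>
      ⟨GLMHDG.exists_isLocalSol hT hj hρ heh hehc he0 hh0 hφ0,
        fun e h φ e' h' φ' h₁ h₂ t ht x hx =>
          GLMHDG.IsLocalSol.unique hT hj hρ heh hehc h₁ h₂ ht hx,
        fun e h φ hsol => GLMHDG.IsLocalSol.energy hT hj hρ heh hehc hsol⟩,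
    fun e0 h0 φ0 he0 hh0 hφ0 =>
      ⟨GLMHDG.exists_isSol hT hj hρ hinc he0 hh0 hφ0,
        fun e h φ eh e' h' φ' eh' h₁ h₂ t ht => GLMHDG.IsSol.unique hT hj hρ hinc h₁ h₂ ht⟩,
    fun e0 h0 φ0 e h φ eh hsol hpl => GLMHDG.IsSol.energy hΩ hT hj hρ hinc hsol hpl,
    fun hj0 hρ0 hinc0 e0 h0 φ0 e h φ eh hsol =>
      GLMHDG.IsSol.antitoneOn_energy hΩ hT hj hρ hinc hj0 hρ0 hinc0 hsol,
    fun e h φ hex hφ eh heh t ht => GLMHDG.scheme_of_isExact C hj hρ hex hφ heh ht⟩
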